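/- Let $\mathrm{Diff}(\mathbb C^2,0)$ be the group, under composition, of germs at the origin of holomorphic diffeomorphisms of $\mathbb C^2$ fixing $0$, and let $\mathrm{Diff}_1(\mathbb C^2,0)$ be its subgroup of germs tangent to the identity (derivative at $0$ equal to the identity). Given local holomorphic diffeomorphisms $h_1,\dots,h_k$ fixing $0$ and an open neighbourhood $V$ of $0$ on which all $h_i^{\pm1}$ are defined and one-to-one, the pseudogroup they generate on $V$ consists of the compositions $F=F_s\circ\cdots\circ F_1$ with $F_j\in\{h_i^{\pm1}\}$; the domain $\mathrm{Dom}_V(F)$ is the set of $x\in V$ with $F_l\circ\cdots\circ F_1(x)\in V$ for all $1\le l<s$ (the empty composition is the identity of $V$). The orbit of $p\in V$ is the set of points of $V$ of the form $F(p)$ with $p\in\mathrm{Dom}_V(F)$. It is locally discrete if every point $q$ of the orbit has a neighbourhood $W$ whose intersection with the orbit is $\{q\}$. A finitely generated group $G$ of germs has locally discrete orbits if, for some choice of local diffeomorphisms $h_1,\dots,h_k$ whose germs generate $G$ and some $V$ as above, the orbit of every $p\in V$ is locally discrete. Proposition. Let $G\subset\mathrm{Diff}_1(\mathbb C^2,0)$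 be a finitely generated group. (1) If $G$ has locally discrete orbits, then $G$ is solvable. (2) If $G$ is not solvable, then for every choice of local diffeomorphisms $h_1,\dots,h_k$ whose germs generate $G$ and every $V$ as above there is $\epsilon>0$ such that: (a) the pseudogroup on $V$ contains a sequence of elements $F_n$, all defined on the ball $B_\epsilon$ of radius $\epsilon$ about $0$ (i.e. $B_\epsilon\subset\mathrm{Dom}_V(F_n)$), whose germs at $0$ are different from the identity and which converge to the identity uniformly on $B_\epsilon$; and (b) some point $p\in B_\epsilon$ has an orbit in $V$ that is not locally discrete. -/

import Mathlib

open Filter Topology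

noncomputable section

namespace LocalDyn

variable (E : Type*) [NormedAddCommGroup E] [NormedSpace ℂ E]

/-- Self-maps of `E` that fix the origin and are holomorphic on a neighbourhood of it, a monoid
under composition. -/
def holFixing : Submonoid (Function.End E) where
  carrier := {f | AnalyticAt ℂ (f : E → E) 0 ∧ (f : E → E) 0 = 0}
  one_mem' := ⟨analyticAt_id, rfl⟩
  mul_mem' := by
    rintro f g ⟨hf, hf0⟩ ⟨hg, hg0⟩
    refine ⟨?_, ?_⟩
    · exact AnalyticAt.fun_comp (f := (g : E → E)) (g := (f : E → E)) (by rw [hg0]; exact hf) hg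
    · change (f : E → E) ((g : E → E) 0) = 0
      rw [hg0, hf0]

/-- Two such maps are identified when they agree on a neighbourhood of the origin. -/
def germCon : Con (holFixing E) where
  r f g := (f.1 : E → E) =ᶠ[𝓝 0] (g.1 : E → E)
  iseqv := ⟨fun _ => EventuallyEq.rfl, fun h => h.symm, fun h k => h.trans k⟩
  mul' := by
    intro f f' g g' hf hg
    have ht : Tendsto (g.1 : E → E) (𝓝 0) (𝓝 0) := by
      have := g.2.1.continuousAt.tendsto
      rwa [g.2.2] at this
    filter_upwards [hg, ht.eventually hf] with x hx hfx
    change (f.1 : E → E) ((g.1 : E → E) x) = (f'.1 : E → E) ((g'.1 : E → E) x)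
    rw [hfx, hx]

/-- The monoid of germs at `0` of holomorphic maps `(E, 0) → (E, 0)` under composition. -/
abbrev HolGerm := (germCon E).Quotient

/-- The group `Diff(E, 0)` of germs at `0` of holomorphic diffeomorphisms fixing `0`: the germs
of holomorphic maps which are invertible under composition. -/
abbrev DiffGerm := (HolGerm E)ˣ

/-- The derivative at the origin, as a homomorphism on germs. -/
def derivHom : HolGerm E →* (E →L[ℂ] E) :=
  (germCon E).lift
    { toFun := fun f => fderiv ℂ (f.1 : E → E) 0
      map_one' := fderiv_id
      map_mul' := by
        intro f g
        have hg := g.2.1.differentiableAt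
        have hf : DifferentiableAt ℂ (f.1 : E → E) ((g.1 : E → E) 0) := by
          rw [g.2.2]; exact f.2.1.differentiableAt
        have := fderiv_comp (0 : E) hf hg
        rw [g.2.2] at this
        exact this }
    (fun _ _ h => EventuallyEq.fderiv_eq h)

/-- The group `Diff₁(E, 0)` of germs of holomorphic diffeomorphisms tangent to the identity. -/
def tangentToId : Subgroup (DiffGerm E) := (Units.map (derivHom E)).ker

/-- A holomorphic diffeomorphism between two open neighbourhoods (`source` and `target`) of the
origin, fixing the origin. -/
structure LocalDiffeo extends OpenPartialHomeomorph E E where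
  zero_mem : (0 : E) ∈ source
  map_zero : toFun 0 = 0
  holo : AnalyticOnNhd ℂ toFun source
  holo_symm : AnalyticOnNhd ℂ invFun target

variable {E}

namespace LocalDiffeo

theorem zero_mem_target (h : LocalDiffeo E) : (0 : E) ∈ h.target := by
  have := h.map_source' h.zero_mem
  rwa [h.map_zero] at this

theorem inv_zero (h : LocalDiffeo E) : h.invFun 0 = 0 := by
  have := h.left_inv' h.zero_mem
  rwa [h.map_zero] at this

/-- The germ at the origin of a local diffeomorphism. -/
def germ (h : LocalDiffeo E) : DiffGerm E where
  val := ((⟨h.toFun, h.holo 0 h.zero_mem, h.map_zero⟩ : holFixing E) : HolGerm E)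
  inv := ((⟨h.invFun, h.holo_symm 0 h.zero_mem_target, h.inv_zero⟩ : holFixing E) : HolGerm E)
  val_inv := by
    refine (Con.eq (germCon E)).2 ?_
    filter_upwards [h.open_target.mem_nhds h.zero_mem_target] with x hx
    exact h.right_inv' hx
  inv_val := by
    refine (Con.eq (germCon E)).2 ?_
    filter_upwards [h.open_source.mem_nhds h.zero_mem] with x hx
    exact h.left_inv' hx

end LocalDiffeo

variable (E)

/-- Generators `h₁, …, h_k` of a pseudogroup (actual local diffeomorphisms, not germs) together
with an open neighbourhood `V` of the origin on which all `hᵢ` and all `hᵢ⁻¹` are defined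
(and hence injective). -/
structure Pseudogroup where
  k : ℕ
  gen : Fin k → LocalDiffeo E
  V : Set E
  isOpen_V : IsOpen V
  zero_mem : (0 : E) ∈ V
  subset_source : ∀ i, V ⊆ (gen i).source
  subset_target : ∀ i, V ⊆ (gen i).target

variable {E}

namespace Pseudogroup

variable (P : Pseudogroup E)

/-- The group of germs generated by the germs of `h₁, …, h_k`. -/
def group : Subgroup (DiffGerm E) := Subgroup.closure (Set.range fun i => (P.gen i).germ)

/-- A letter `(i, true)` stands for `hᵢ` and `(i, false)` for `hᵢ⁻¹`. -/
def letter (a : Fin P.k × Bool) : E → E :=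
  if a.2 then (P.gen a.1).toFun else (P.gen a.1).invFun

/-- The map `F_s ∘ ⋯ ∘ F₁` attached to the word `[F_s, …, F₁]`. -/
def wordMap : List (Fin P.k × Bool) → E → E
  | [], x => x
  | a :: w, x => P.letter a (wordMap w x)

/-- The domain of `F_s ∘ ⋯ ∘ F₁` as an element of the pseudogroup: the points `x ∈ V` with
`F_l ∘ ⋯ ∘ F₁ (x) ∈ V` for all `1 ≤ l < s`. -/
def dom : List (Fin P.k × Bool) → Set E
  | [] => P.V
  | _ :: w => {x | x ∈ dom w ∧ P.wordMap w x ∈ P.V}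

/-- The orbit of `p` in `V` under the pseudogroup. -/
def orbit (p : E) : Set E := {q | q ∈ P.V ∧ ∃ w, p ∈ P.dom w ∧ P.wordMap w p = q}

/-- The orbit of `p` is locally discrete: each of its points has a neighbourhood containing no
other point of the orbit. -/
def LocallyDiscreteAt (p : E) : Prop :=
  ∀ q ∈ P.orbit p, ∃ W ∈ 𝓝 q, W ∩ P.orbit p = {q}

end Pseudogroup

/-- A group `G` of germs has locally discrete orbits: it is generated by the germs of finitely many
local diffeomorphisms which, on some open neighbourhood `V` of the origin, generate a pseudogroup
all of whose orbits are locally discrete. -/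
def HasLocallyDiscreteOrbits (G : Subgroup (DiffGerm E)) : Prop :=
  ∃ P : Pseudogroup E, P.group = G ∧ ∀ p ∈ P.V, P.LocallyDiscreteAt p

end LocalDyn

end

/-! Statement (1) is the contrapositive of (2b), and (2b) follows from (2a): if all orbits in the
ball were locally discrete, the maps `F_n`, which move each point less and less, would eventually
fix each point. By Baire some `F_N` would be the identity on an open set, hence near `0` by analytic
continuation. Only (2a) has content.

For (2a), the commutator of two maps `ε`-close to the identity on a ball is, by Cauchy's estimate,
within `8ε²/τ` of it after the radius shrinks by `τ`, while conjugation by such a map at most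
doubles a smaller displacement. Let `S₀` be the generators on a ball so small that tangency to the
identity makes their displacement tiny relative to the radius. Let `S_{n+1}` be the commutators of
elements of `S_n`, together with their conjugates by at most 8 elements of `S_n` in succession. The
displacement halves at each stage and the losses of radius are summable (`isClose_commSeq`). It
remains to see that no `S_n` is trivial when the group is not solvable. This is algebraic: if
`conjComm S 8` generates a group of derived length at most four, then so does `S`
(`iterComm_four_closure`).

That statement is proved for formal diffeomorphisms, into which germs embed by Taylor series. Each
unipotent automorphism `σ` of the ring of power series has a formal flow and an infinitesimal
generator `log σ`, which determines `σ` and is carried along by conjugation. Over the fraction field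
these derivations live in a plane. A pigeonhole argument on the subgroups generated by `conjComm S
n`, `n ≤ 8`, gives `i`, `j` such that the `j`-th derived groups `A n` satisfy `A i ≠ 1` with `A (i +
2)` abelian; conjugation by `S` maps `A n` into `A (n + 1)`.

If `A (i + 1)` contains two independent generators, a fraction killed by both is constant, so every
element commuting with both has its generator in their complex span `W`. Then `S` acts on the plane
`W` by unipotent, hence commuting, maps, and the group is metabelian (`iterComm_two_of_rank_two`).
Otherwise take `γ ≠ 1` in `A i`: conjugation by `S` multiplies `log γ` by first integrals of `γ`, so
the group acts on the field of first integrals. The elements acting trivially there form a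
metabelian group (`iterComm_two_inf_fixer`), and a second pigeonhole shows that the action itself is
metabelian (`iterComm_two_le_fixer`). This gives derived length `2 + 2 = 4`. -/

noncomputable section

/-! ### The order filtration on formal power series and the automorphisms tangent to the identity -/

namespace FormalDiffeo

/-- Formal power series in two variables. -/
abbrev PS := MvPowerSeries (Fin 2) ℂ

open MvPowerSeries in
/-- The power series all of whose terms have degree at least `j`. -/
def ordIdeal (j : ℕ) : Ideal PS where
  carrier := {u | ∀ d : Fin 2 →₀ ℕ, d.degree < j → coeff d u = 0}
  zero_mem' := fun d _ => by simp
  add_mem' := fun {a b} ha hb d hd => by rw [map_add, ha d hd, hb d hd, add_zero]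
  smul_mem' := fun c u hu d hd => by
    rw [smul_eq_mul, coeff_mul]
    refine Finset.sum_eq_zero fun p hp => ?_
    rw [Finset.HasAntidiagonal.mem_antidiagonal] at hp
    rw [hu p.2 (lt_of_le_of_lt ?_ hd), mul_zero]
    rw [← hp, map_add]
    exact Nat.le_add_left _ _

open MvPowerSeries

theorem ordIdeal_zero (u : PS) : u ∈ ordIdeal 0 := fun _ hd => absurd hd (Nat.not_lt_zero _)

theorem ordIdeal_anti {i j : ℕ} (h : i ≤ j) : ordIdeal j ≤ ordIdeal i :=
  fun _ hu d hd => hu d (lt_of_lt_of_le hd h)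

theorem mul_mem_ordIdeal {i j : ℕ} {u v : PS} (hu : u ∈ ordIdeal i) (hv : v ∈ ordIdeal j) :
    u * v ∈ ordIdeal (i + j) := by
  intro d hd
  rw [coeff_mul]
  refine Finset.sum_eq_zero fun p hp => ?_
  rw [Finset.HasAntidiagonal.mem_antidiagonal] at hp
  rw [← hp, map_add] at hd
  rcases Nat.lt_or_ge p.1.degree i with h | h
  · rw [hu _ h, zero_mul]
  · rw [hv _ (by omega), mul_zero]

theorem eq_zero_of_forall_mem_ordIdeal {u : PS} (h : ∀ j, u ∈ ordIdeal j) : u = 0 := by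
  ext d
  exact h (d.degree + 1) d (Nat.lt_succ_self _)

theorem smul_mem_ordIdeal {j : ℕ} {u : PS} (c : ℂ) (hu : u ∈ ordIdeal j) : c • u ∈ ordIdeal j :=
  fun d hd => by rw [coeff_smul, hu d hd, mul_zero]

theorem X_mem_ordIdeal (i : Fin 2) : (X i : PS) ∈ ordIdeal 1 := by
  intro d hd
  have : d = 0 := by
    rw [← Finsupp.degree_eq_zero_iff]
    omega
  rw [this]
  exact coeff_zero_X i

theorem degree_fin_two (d : Fin 2 →₀ ℕ) : d.degree = d 0 + d 1 := by
  rw [Finsupp.degree_eq_sum, Fin.sum_univ_two]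

/-- A series with terms of degree at least `j` splits off a constant term, and the rest is a
combination of the variables with coefficients of order at least `j - 1`. -/
theorem exists_decomp (u : PS) : ∃ u₁ u₂ : PS, u = C (coeff 0 u) + X 0 * u₁ + X 1 * u₂ ∧
    ∀ j, u ∈ ordIdeal (j + 1) → u₁ ∈ ordIdeal j ∧ u₂ ∈ ordIdeal j := by
  let u₁ : PS := fun d => coeff (d + Finsupp.single 0 1) u
  -- Monomials divisible by both variables are assigned to `u₁`; the test `d 0 = 0` keeps them from
  -- being counted twice.
  let u₂ : PS := fun d => if d 0 = 0 then coeff (d + Finsupp.single 1 1) u else 0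
  have h₁ : ∀ d, coeff d u₁ = coeff (d + Finsupp.single 0 1) u := fun _ => rfl
  have h₂ : ∀ d, coeff d u₂ = if d 0 = 0 then coeff (d + Finsupp.single 1 1) u else 0 :=
    fun _ => rfl
  refine ⟨u₁, u₂, ?_, ?_⟩
  · ext d
    rw [map_add, map_add, X_def, X_def, coeff_monomial_mul, coeff_monomial_mul, h₁, h₂,
      coeff_C, one_mul, one_mul]
    simp only [Finsupp.single_le_iff]
    by_cases h0 : 1 ≤ d 0
    · have hd : d ≠ 0 := by rintro rfl; simp at h0
      have : (d - Finsupp.single 1 1 : Fin 2 →₀ ℕ) 0 = d 0 := by simp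
      rw [if_neg hd, if_pos h0, this, if_neg (by omega : ¬ d 0 = 0),
        tsub_add_cancel_of_le (by rwa [Finsupp.single_le_iff])]
      simp
    · by_cases h1 : 1 ≤ d 1
      · have hd : d ≠ 0 := by rintro rfl; simp at h1
        have : (d - Finsupp.single 1 1 : Fin 2 →₀ ℕ) 0 = d 0 := by simp
        rw [if_neg hd, if_neg h0, if_pos h1, this, if_pos (by omega : d 0 = 0),
          tsub_add_cancel_of_le (by rwa [Finsupp.single_le_iff])]
        simp
      · have hd : d = 0 := by
          rw [← Finsupp.degree_eq_zero_iff, degree_fin_two]; omega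
        rw [if_pos hd, if_neg h0, if_neg h1, hd]
        simp
  · intro j hu
    refine ⟨fun d hd => ?_, fun d hd => ?_⟩
    · rw [h₁]
      exact hu _ (by rw [map_add, Finsupp.degree_single]; omega)
    · rw [h₂]
      split_ifs
      · exact hu _ (by rw [map_add, Finsupp.degree_single]; omega)
      · rfl

theorem coeff_zero_of_mem {j : ℕ} {u : PS} (hu : u ∈ ordIdeal (j + 1)) : coeff 0 u = 0 :=
  hu 0 (by simp)

theorem C_eq_algebraMap (c : ℂ) : (C c : PS) = algebraMap ℂ PS c := rfl

/-- An algebra endomorphism moving the variables by terms of order two raises orders when the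
identity is subtracted. -/
theorem sub_mem_of_X (σ : PS →ₐ[ℂ] PS) (hσ : ∀ i, σ (X i) - X i ∈ ordIdeal 2) (j : ℕ) :
    ∀ u ∈ ordIdeal j, σ u - u ∈ ordIdeal (j + 1) := by
  have hX : ∀ i, σ (X i) ∈ ordIdeal 1 := fun i => by
    have := (ordIdeal 1).add_mem (ordIdeal_anti (by norm_num) (hσ i)) (X_mem_ordIdeal i)
    rwa [sub_add_cancel] at this
  have key : ∀ j : ℕ, (∀ u ∈ ordIdeal j, σ u - u ∈ ordIdeal (j + 1)) → ∀ i, ∀ v ∈ ordIdeal j,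
      σ (X i) * σ v - X i * v ∈ ordIdeal (j + 2) := by
    intro j ih i v hv
    have hσv : σ v ∈ ordIdeal j := by
      have := (ordIdeal j).add_mem (ordIdeal_anti (Nat.le_succ j) (ih v hv)) hv
      rwa [sub_add_cancel] at this
    have e : σ (X i) * σ v - X i * v = (σ (X i) - X i) * σ v + X i * (σ v - v) := by ring
    rw [e]
    refine (ordIdeal _).add_mem ?_ ?_
    · have := mul_mem_ordIdeal (hσ i) hσv
      rwa [add_comm] at this
    · have := mul_mem_ordIdeal (X_mem_ordIdeal i) (ih v hv)
      rwa [add_comm 1, add_assoc] at this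
  induction j with
  | zero =>
    intro u _
    obtain ⟨u₁, u₂, hu, -⟩ := exists_decomp u
    have e : σ u - u = σ (X 0) * σ u₁ + σ (X 1) * σ u₂ - (X 0 * u₁ + X 1 * u₂) := by
      conv_lhs => rw [hu]
      rw [map_add, map_add, map_mul, map_mul, C_eq_algebraMap, AlgHom.commutes]
      ring
    rw [e]
    refine (ordIdeal _).sub_mem ((ordIdeal _).add_mem ?_ ?_) ((ordIdeal _).add_mem ?_ ?_)
    · exact (ordIdeal 1).mul_mem_right _ (hX 0)
    · exact (ordIdeal 1).mul_mem_right _ (hX 1)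
    · exact (ordIdeal 1).mul_mem_right _ (X_mem_ordIdeal 0)
    · exact (ordIdeal 1).mul_mem_right _ (X_mem_ordIdeal 1)
  | succ j ih =>
    intro u hu
    obtain ⟨u₁, u₂, he, hd⟩ := exists_decomp u
    obtain ⟨h₁, h₂⟩ := hd j hu
    have e : σ u - u = (σ (X 0) * σ u₁ - X 0 * u₁) + (σ (X 1) * σ u₂ - X 1 * u₂) := by
      conv_lhs => rw [he]
      rw [map_add, map_add, map_mul, map_mul, C_eq_algebraMap, AlgHom.commutes]
      ring
    rw [e]
    exact (ordIdeal _).add_mem (key j ih 0 u₁ h₁) (key j ih 1 u₂ h₂)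

/-- Two algebra endomorphisms which send the variables to the same series of positive order are
equal. -/
theorem algHom_ext_of_X {σ τ : PS →ₐ[ℂ] PS} (hσ : ∀ i, σ (X i) ∈ ordIdeal 1)
    (h : ∀ i, σ (X i) = τ (X i)) : σ = τ := by
  have key : ∀ j u, σ u - τ u ∈ ordIdeal j := by
    intro j
    induction j with
    | zero => exact fun u => ordIdeal_zero _
    | succ j ih =>
      intro u
      obtain ⟨u₁, u₂, he, -⟩ := exists_decomp u
      have e : σ u - τ u = σ (X 0) * (σ u₁ - τ u₁) + σ (X 1) * (σ u₂ - τ u₂) := by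
        conv_lhs => rw [he]
        simp only [map_add, map_mul, C_eq_algebraMap, AlgHom.commutes, ← h]
        ring
      rw [e, add_comm j]
      exact (ordIdeal _).add_mem (mul_mem_ordIdeal (hσ 0) (ih u₁)) (mul_mem_ordIdeal (hσ 1) (ih u₂))
  ext1 u
  exact sub_eq_zero.1 (eq_zero_of_forall_mem_ordIdeal fun j => key j u)

/-- An algebra endomorphism sending the variables into positive order preserves the order
filtration. -/
theorem map_mem_of_X (σ : PS →ₐ[ℂ] PS) (hσ : ∀ i, σ (X i) ∈ ordIdeal 1) (j : ℕ) :
    ∀ u ∈ ordIdeal j, σ u ∈ ordIdeal j := by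
  induction j with
  | zero => exact fun u _ => ordIdeal_zero _
  | succ j ih =>
    intro u hu
    obtain ⟨u₁, u₂, he, hd⟩ := exists_decomp u
    obtain ⟨h₁, h₂⟩ := hd j hu
    rw [he, coeff_zero_of_mem hu]
    simp only [map_add, map_mul, map_zero, zero_add]
    rw [add_comm j]
    exact (ordIdeal _).add_mem (mul_mem_ordIdeal (hσ 0) (ih u₁ h₁))
      (mul_mem_ordIdeal (hσ 1) (ih u₂ h₂))

/-- A derivation of the ring of power series that kills both variables vanishes. -/
theorem derivation_eq_zero {D : Derivation ℂ PS PS} (h : ∀ i, D (X i) = 0) : D = 0 := by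
  have key : ∀ j u, D u ∈ ordIdeal j := by
    intro j
    induction j with
    | zero => exact fun u => ordIdeal_zero _
    | succ j ih =>
      intro u
      obtain ⟨u₁, u₂, he, -⟩ := exists_decomp u
      have e : D u = X 0 * D u₁ + X 1 * D u₂ := by
        conv_lhs => rw [he]
        simp only [map_add, Derivation.leibniz, C_eq_algebraMap, Derivation.map_algebraMap, h,
          smul_eq_mul]
        ring
      rw [e, add_comm j]
      exact (ordIdeal _).add_mem (mul_mem_ordIdeal (X_mem_ordIdeal 0) (ih u₁))
        (mul_mem_ordIdeal (X_mem_ordIdeal 1) (ih u₂))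
  ext1 u
  exact eq_zero_of_forall_mem_ordIdeal fun j => key j u

/-- The automorphisms of the ring of power series which are tangent to the identity. -/
def unip : Subgroup (PS ≃ₐ[ℂ] PS) where
  carrier := {σ | ∀ j, ∀ u ∈ ordIdeal j, σ u - u ∈ ordIdeal (j + 1)}
  one_mem' := fun j u _ => by simp
  mul_mem' := fun {σ τ} hσ hτ j u hu => by
    have h1 := hτ j u hu
    have h2 : τ u ∈ ordIdeal j := by
      have := (ordIdeal j).add_mem (ordIdeal_anti (Nat.le_succ j) h1) hu
      rwa [sub_add_cancel] at this
    have := (ordIdeal _).add_mem (hσ j _ h2) h1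
    rwa [sub_add_sub_cancel] at this
  inv_mem' := fun {σ} hσ j u hu => by
    have e : σ (σ⁻¹ u) = u := by rw [← AlgEquiv.mul_apply, mul_inv_cancel, AlgEquiv.one_apply]
    -- That `σ⁻¹` preserves the filtration is not known beforehand. If `σ⁻¹ u` has order `i < j`,
    -- then so far `u - σ⁻¹ u` has order `i + 1`, hence so does `σ⁻¹ u`; the order climbs up to `j`.
    have key : ∀ i ≤ j, σ⁻¹ u ∈ ordIdeal i := by
      intro i
      induction i with
      | zero => exact fun _ => ordIdeal_zero _
      | succ i ih =>
        intro hi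
        have h1 := hσ i _ (ih (by omega))
        rw [e] at h1
        have := (ordIdeal _).sub_mem (ordIdeal_anti hi hu) h1
        rwa [sub_sub_cancel] at this
    have := (ordIdeal _).neg_mem (hσ j _ (key j le_rfl))
    rwa [e, neg_sub] at this

theorem unip_map_mem {σ : PS ≃ₐ[ℂ] PS} (hσ : σ ∈ unip) {j : ℕ} {u : PS} (hu : u ∈ ordIdeal j) :
    σ u ∈ ordIdeal j := by
  have := (ordIdeal j).add_mem (ordIdeal_anti (Nat.le_succ j) (hσ j u hu)) hu
  rwa [sub_add_cancel] at this

end FormalDiffeo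

end

/-! ### The formal flow of a unipotent automorphism and its infinitesimal generator -/

noncomputable section

namespace FormalDiffeo

open MvPowerSeries

/-- The difference operator `σ - 1`. -/
def diffOp (σ : PS ≃ₐ[ℂ] PS) : Module.End ℂ PS := σ.toLinearMap - 1

theorem diffOp_apply (σ : PS ≃ₐ[ℂ] PS) (u : PS) : diffOp σ u = σ u - u := rfl

/-- Each factor `σ - 1` gains an order, so on any one coefficient a series in `σ - 1` is a finite
sum. This takes the place of convergence. -/
theorem diffOp_pow_mem (σ : unip) (k : ℕ) {j : ℕ} {u : PS} (hu : u ∈ ordIdeal j) :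
    (diffOp σ ^ k) u ∈ ordIdeal (j + k) := by
  induction k with
  | zero => simpa using hu
  | succ k ih =>
    rw [pow_succ', Module.End.mul_apply, diffOp_apply]
    exact σ.2 _ _ ih

/-- Binomial theorem for `σ = 1 + (σ - 1)`. The dependence on `n` is only through binomial
coefficients, which are polynomial in `n`, so `n` can be replaced by an indeterminate time. -/
theorem pow_eq_sum_diffOp (σ : PS ≃ₐ[ℂ] PS) (n : ℕ) (u : PS) :
    (σ ^ n) u = ∑ k ∈ Finset.range (n + 1), (n.choose k : ℂ) • (diffOp σ ^ k) u := by
  have h1 : (σ ^ n).toLinearMap = (diffOp σ + 1) ^ n := by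
    have : diffOp σ + 1 = σ.toLinearMap := sub_add_cancel _ _
    rw [this]
    ext1 v
    induction n with
    | zero => rfl
    | succ n ih =>
      rw [pow_succ', pow_succ', Module.End.mul_apply, ← ih]
      rfl
  have h2 := congrArg (fun f : Module.End ℂ PS => f u) h1
  simp only [AlgEquiv.toLinearMap_apply] at h2
  rw [h2, (Commute.one_right (diffOp σ)).add_pow, LinearMap.sum_apply]
  refine Finset.sum_congr rfl fun k _ => ?_
  rw [one_pow, mul_one, ← nsmul_eq_mul', LinearMap.smul_apply, Nat.cast_smul_eq_nsmul]

/-- The polynomial whose value at `n` is the binomial coefficient `n.choose k`. -/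
def binomPoly (k : ℕ) : Polynomial ℂ := Polynomial.C ((k.factorial : ℂ)⁻¹) * descPochhammer ℂ k

theorem binomPoly_eval (n k : ℕ) : (binomPoly k).eval (n : ℂ) = n.choose k := by
  rw [binomPoly, Polynomial.eval_mul, Polynomial.eval_C, Nat.cast_choose_eq_descPochhammer_div,
    div_eq_inv_mul]

/-- The series with polynomial coefficients which interpolates the iterates `σⁿ u`. -/
def interpFun (σ : PS ≃ₐ[ℂ] PS) (u : PS) : MvPowerSeries (Fin 2) (Polynomial ℂ) := fun d =>
  ∑ k ∈ Finset.range (d.degree + 1), Polynomial.C (coeff d ((diffOp σ ^ k) u)) * binomPoly k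

/-- Evaluation of polynomial coefficients at a natural number. -/
def evalAt (n : ℕ) : MvPowerSeries (Fin 2) (Polynomial ℂ) →+* PS :=
  MvPowerSeries.map (Polynomial.evalRingHom (n : ℂ))

theorem coeff_evalAt (n : ℕ) (F : MvPowerSeries (Fin 2) (Polynomial ℂ)) (d : Fin 2 →₀ ℕ) :
    coeff d (evalAt n F) = (coeff d F).eval (n : ℂ) := by
  rw [evalAt, coeff_map, Polynomial.coe_evalRingHom]

theorem polynomial_ext_nat {p q : Polynomial ℂ} (h : ∀ n : ℕ, p.eval (n : ℂ) = q.eval (n : ℂ)) :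
    p = q :=
  Polynomial.eq_of_infinite_eval_eq p q ((Set.infinite_range_of_injective
    (Nat.cast_injective (R := ℂ))).mono (by rintro _ ⟨n, rfl⟩; exact h n))

/-- Natural numbers are Zariski dense in the time line: identities between flows are verified on
iterates, where they are evident. -/
theorem evalAt_ext {F G : MvPowerSeries (Fin 2) (Polynomial ℂ)}
    (h : ∀ n, evalAt n F = evalAt n G) : F = G := by
  ext1 d
  exact polynomial_ext_nat fun n => by rw [← coeff_evalAt, ← coeff_evalAt, h]

theorem evalAt_interpFun (σ : unip) (u : PS) (n : ℕ) :
    evalAt n (interpFun σ u) = ((σ : PS ≃ₐ[ℂ] PS) ^ n) u := by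
  ext d
  have e : coeff d (interpFun σ u) = ∑ k ∈ Finset.range (d.degree + 1),
    Polynomial.C (coeff d ((diffOp σ ^ k) u)) * binomPoly k := rfl
  rw [coeff_evalAt, e, Polynomial.eval_finsetSum, pow_eq_sum_diffOp, map_sum]
  have h1 : ∀ k, (Polynomial.C (coeff d ((diffOp σ ^ k) u)) * binomPoly k).eval (n : ℂ) =
      coeff d ((n.choose k : ℂ) • (diffOp σ ^ k) u) := fun k => by
    rw [Polynomial.eval_mul, Polynomial.eval_C, binomPoly_eval, coeff_smul, mul_comm]
  simp_rw [h1]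
  -- The interpolation stops at `k = d.degree` and the binomial sum at `k = n`. Terms beyond the
  -- first bound vanish by order, those beyond the second by the binomial coefficient, so both sums
  -- equal the one over the union.
  have hA : ∀ k ∉ Finset.range (d.degree + 1),
      coeff d ((n.choose k : ℂ) • (diffOp (σ : PS ≃ₐ[ℂ] PS) ^ k) u) = 0 := fun k hk => by
    rw [coeff_smul, diffOp_pow_mem σ k (ordIdeal_zero u) d (by simpa using hk), mul_zero]
  have hB : ∀ k ∉ Finset.range (n + 1),
      coeff d ((n.choose k : ℂ) • (diffOp (σ : PS ≃ₐ[ℂ] PS) ^ k) u) = 0 := fun k hk => by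
    rw [Nat.choose_eq_zero_of_lt (by simpa using hk), Nat.cast_zero, zero_smul, map_zero]
  rw [Finset.sum_subset (Finset.subset_union_left (s₂ := Finset.range (n + 1)))
      (fun k _ hk => hA k hk),
    ← Finset.sum_subset (Finset.subset_union_right (s₁ := Finset.range (d.degree + 1)))
      (fun k _ hk => hB k hk)]

/-- The interpolation of the iterates of `σ`, as a ring homomorphism. -/
def interp (σ : unip) : PS →+* MvPowerSeries (Fin 2) (Polynomial ℂ) where
  toFun := interpFun σ
  map_one' := evalAt_ext fun n => by rw [evalAt_interpFun, map_one, map_one]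
  map_zero' := evalAt_ext fun n => by rw [evalAt_interpFun, map_zero, map_zero]
  map_add' u v := evalAt_ext fun n => by
    rw [map_add, evalAt_interpFun, evalAt_interpFun, evalAt_interpFun, map_add]
  map_mul' u v := evalAt_ext fun n => by
    rw [map_mul, evalAt_interpFun, evalAt_interpFun, evalAt_interpFun, map_mul]

theorem evalAt_interp (σ : unip) (u : PS) (n : ℕ) :
    evalAt n (interp σ u) = ((σ : PS ≃ₐ[ℂ] PS) ^ n) u := evalAt_interpFun σ u n

/-- The coefficient of the `m`-th power of the parameter. -/
def paramCoeff (m : ℕ) (F : MvPowerSeries (Fin 2) (Polynomial ℂ)) : PS :=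
  fun d => (coeff d F).coeff m

theorem coeff_paramCoeff (m : ℕ) (d : Fin 2 →₀ ℕ) (F : MvPowerSeries (Fin 2) (Polynomial ℂ)) :
    coeff d (paramCoeff m F) = (coeff d F).coeff m := rfl

/-- A series in two variables with polynomial coefficients in a parameter, as a power series in
the parameter. -/
def swap : MvPowerSeries (Fin 2) (Polynomial ℂ) →+* PowerSeries PS where
  toFun F := PowerSeries.mk fun m => paramCoeff m F
  map_one' := by
    ext m d
    rw [PowerSeries.coeff_mk, coeff_paramCoeff, MvPowerSeries.coeff_one, PowerSeries.coeff_one]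
    split_ifs with h1 h2 h2
    · rw [MvPowerSeries.coeff_one, if_pos h1, h2, Polynomial.coeff_one_zero]
    · rw [Polynomial.coeff_one, if_neg h2, map_zero]
    · rw [MvPowerSeries.coeff_one, if_neg h1, Polynomial.coeff_zero]
    · rw [Polynomial.coeff_zero, map_zero]
  map_zero' := by
    ext m d
    rw [PowerSeries.coeff_mk, coeff_paramCoeff, map_zero, map_zero, map_zero,
      Polynomial.coeff_zero]
  map_add' F G := by
    ext m d
    rw [map_add, PowerSeries.coeff_mk, PowerSeries.coeff_mk, PowerSeries.coeff_mk, map_add,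
      coeff_paramCoeff, coeff_paramCoeff, coeff_paramCoeff, map_add, Polynomial.coeff_add]
  map_mul' F G := by
    ext m d
    rw [PowerSeries.coeff_mul, PowerSeries.coeff_mk, coeff_paramCoeff, coeff_mul,
      Polynomial.finsetSum_coeff, map_sum]
    simp_rw [Polynomial.coeff_mul, coeff_mul, PowerSeries.coeff_mk, coeff_paramCoeff]
    rw [Finset.sum_comm]

theorem coeff_swap (m : ℕ) (d : Fin 2 →₀ ℕ) (F : MvPowerSeries (Fin 2) (Polynomial ℂ)) :
    coeff d (PowerSeries.coeff m (swap F)) = (coeff d F).coeff m := by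
  rw [swap, RingHom.coe_mk, MonoidHom.coe_mk, OneHom.coe_mk, PowerSeries.coeff_mk,
    coeff_paramCoeff]

theorem swap_injective : Function.Injective swap := fun F G h => by
  ext d m
  rw [← coeff_swap, ← coeff_swap, h]

/-- The formal flow of `σ`, with values in power series in the time variable. -/
def flow (σ : unip) : PS →+* PowerSeries PS := swap.comp (interp σ)

theorem flow_apply (σ : unip) (u : PS) : flow σ u = swap (interp σ u) := rfl

theorem coeff_flow_zero (σ : unip) (u : PS) : PowerSeries.coeff 0 (flow σ u) = u := by
  ext d
  rw [flow_apply, coeff_swap, Polynomial.coeff_zero_eq_eval_zero]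
  have := coeff_evalAt 0 (interp σ u) d
  rw [evalAt_interp, pow_zero, AlgEquiv.one_apply, Nat.cast_zero] at this
  exact this.symm

theorem flow_C (σ : unip) (c : ℂ) : flow σ (C c) = PowerSeries.C (C c) := by
  have : interp σ (C c) = C (Polynomial.C c) := evalAt_ext fun n => by
    rw [evalAt_interp, evalAt, map_C, Polynomial.coe_evalRingHom, Polynomial.eval_C,
      C_eq_algebraMap, AlgEquiv.commutes]
  rw [flow_apply, this]
  ext m d
  rw [coeff_swap, PowerSeries.coeff_C, coeff_C]
  split_ifs with h1 h2 h2
  · rw [h2, Polynomial.coeff_C_zero, h1, coeff_zero_C]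
  · rw [Polynomial.coeff_C, if_neg h2, map_zero]
  · rw [Polynomial.coeff_zero, coeff_C, if_neg h1]
  · rw [Polynomial.coeff_zero, map_zero]

/-- The infinitesimal generator of the formal flow of `σ`. -/
def logFun (σ : unip) (u : PS) : PS := PowerSeries.coeff 1 (flow σ u)

/-- For `k ≥ 1` the linear coefficient of `binomPoly k` is `(-1)^(k-1)/k`, so the sum is the
truncated series of `log (1 + (σ - 1))`. -/
theorem logFun_approx (σ : unip) (u : PS) (M : ℕ) :
    logFun σ u - ∑ k ∈ Finset.range M, (binomPoly k).coeff 1 • (diffOp σ ^ k) u ∈ ordIdeal M := by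
  intro d hd
  have e : coeff d (interp σ u) = ∑ k ∈ Finset.range (d.degree + 1),
    Polynomial.C (coeff d ((diffOp σ ^ k) u)) * binomPoly k := rfl
  rw [map_sub, logFun, flow_apply, coeff_swap, e, Polynomial.finsetSum_coeff, map_sum]
  simp_rw [Polynomial.coeff_C_mul, coeff_smul]
  rw [← Finset.sum_subset (Finset.range_mono (Nat.succ_le_of_lt hd) :
    Finset.range (d.degree + 1) ⊆ Finset.range M), sub_eq_zero]
  · exact Finset.sum_congr rfl fun k _ => mul_comm _ _
  · intro k _ hk
    rw [diffOp_pow_mem σ k (ordIdeal_zero u) d (by simpa using hk), mul_zero]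

theorem logFun_mem (σ : unip) {j : ℕ} {u : PS} (hu : u ∈ ordIdeal j) :
    logFun σ u ∈ ordIdeal (j + 1) := by
  have hs : ∑ k ∈ Finset.range (j + 1), (binomPoly k).coeff 1 •
      (diffOp (σ : PS ≃ₐ[ℂ] PS) ^ k) u ∈ ordIdeal (j + 1) := Ideal.sum_mem _ fun k _ => ?_
  · have h := (ordIdeal (j + 1)).add_mem (logFun_approx σ u (j + 1)) hs
    rwa [sub_add_cancel] at h
  · rcases k with - | k
    · have : (binomPoly 0).coeff 1 = 0 := by
        simp [binomPoly, Polynomial.coeff_one]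
      rw [this, zero_smul]
      exact zero_mem _
    · exact smul_mem_ordIdeal _ (ordIdeal_anti (by omega) (diffOp_pow_mem σ (k + 1) hu))

theorem diffOp_conj (τ σ : PS ≃ₐ[ℂ] PS) (k : ℕ) (u : PS) :
    (diffOp (τ * σ * τ⁻¹) ^ k) (τ u) = τ ((diffOp σ ^ k) u) := by
  have e : ∀ v, (τ * σ * τ⁻¹) (τ v) = τ (σ v) := fun v => by
    rw [← AlgEquiv.mul_apply, inv_mul_cancel_right, AlgEquiv.mul_apply]
  induction k with
  | zero => rfl
  | succ k ih =>
    rw [pow_succ', pow_succ', Module.End.mul_apply, Module.End.mul_apply, ih, diffOp_apply,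
      diffOp_apply, map_sub, e]

/-- Modulo each order the generator is a polynomial in `σ - 1`, and conjugation by `τ` transports
such polynomials; `τ` preserves the orders of the error terms. -/
theorem logFun_conj (τ σ : unip) (u : PS) :
    logFun (τ * σ * τ⁻¹) ((τ : PS ≃ₐ[ℂ] PS) u) = (τ : PS ≃ₐ[ℂ] PS) (logFun σ u) := by
  rw [← sub_eq_zero]
  refine eq_zero_of_forall_mem_ordIdeal fun M => ?_
  have h1 := logFun_approx (τ * σ * τ⁻¹) ((τ : PS ≃ₐ[ℂ] PS) u) M
  have h2 := unip_map_mem τ.2 (logFun_approx σ u M)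
  have h3 := (ordIdeal M).sub_mem h1 h2
  simp only [Subgroup.coe_mul, Subgroup.coe_inv, diffOp_conj, map_sub, map_sum, map_smul] at h3
  rwa [sub_sub_sub_cancel_right] at h3

theorem logFun_map (σ : unip) (n : ℕ) (u : PS) :
    logFun σ (((σ : PS ≃ₐ[ℂ] PS) ^ n) u) = ((σ : PS ≃ₐ[ℂ] PS) ^ n) (logFun σ u) := by
  have := logFun_conj (σ ^ n) σ u
  have e : σ ^ n * σ * (σ ^ n)⁻¹ = σ := by
    rw [← pow_succ, pow_succ', mul_inv_cancel_right]
  rw [e] at this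
  simpa using this

/-- The flow equation. From `σ^(n+j) = σ^j σ^n`, translating time by `n` amounts to replacing `u` by
`σ^n u`; the linear Taylor coefficient at `n` is then the generator at `σ^n u`, and the generator
commutes with `σ^n`. -/
theorem derivative_interp (σ : unip) (u : PS) (d : Fin 2 →₀ ℕ) :
    Polynomial.derivative (coeff d (interp σ u)) = coeff d (interp σ (logFun σ u)) := by
  refine polynomial_ext_nat fun n => ?_
  have h1 : Polynomial.taylor (n : ℂ) (coeff d (interp σ u)) =
      coeff d (interp σ (((σ : PS ≃ₐ[ℂ] PS) ^ n) u)) := polynomial_ext_nat fun j => by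
    rw [Polynomial.taylor_eval, ← Nat.cast_add, ← coeff_evalAt, ← coeff_evalAt, evalAt_interp,
      evalAt_interp, pow_add, AlgEquiv.mul_apply]
  rw [← Polynomial.taylor_coeff_one, h1, ← coeff_evalAt, evalAt_interp, ← logFun_map,
    ← coeff_swap, ← flow_apply]
  rfl

theorem coeff_flow_succ (σ : unip) (u : PS) (m : ℕ) :
    PowerSeries.coeff (m + 1) (flow σ u) * (m + 1) = PowerSeries.coeff m (flow σ (logFun σ u)) := by
  ext d
  rw [flow_apply, flow_apply, coeff_swap, ← derivative_interp, Polynomial.coeff_derivative]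
  have : (m + 1 : PS) = C (m + 1 : ℂ) := by simp
  rw [this, coeff_mul_C, coeff_swap]

theorem derivative_flow (σ : unip) (u : PS) :
    PowerSeries.derivative PS (flow σ u) = flow σ (logFun σ u) := by
  ext1 m
  rw [PowerSeries.coeff_derivative, coeff_flow_succ]

/-- The infinitesimal generator of `σ`, a derivation of the ring of power series. -/
def logDer (σ : unip) : Derivation ℂ PS PS := Derivation.mk'
  { toFun := logFun σ
    map_add' := fun u v => by rw [logFun, map_add, map_add]; rfl
    map_smul' := fun c u => by
      rw [smul_eq_C_mul, logFun, map_mul, flow_C, PowerSeries.coeff_C_mul, RingHom.id_apply,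
        smul_eq_C_mul]
      rfl }
  (fun u v => by
    change logFun σ (u * v) = u • logFun σ v + v • logFun σ u
    rw [logFun, map_mul, PowerSeries.coeff_mul, Finset.Nat.sum_antidiagonal_eq_sum_range_succ_mk,
      Finset.sum_range_succ, Finset.sum_range_one]
    simp only [coeff_flow_zero, tsub_zero, tsub_self, smul_eq_mul, logFun]
    ring)

theorem logDer_apply (σ : unip) (u : PS) : logDer σ u = logFun σ u := rfl

end FormalDiffeo

end

/-! ### Flows and generators on the field of fractions -/

noncomputable section

namespace FormalDiffeo

open MvPowerSeries

/-- The field of fractions of the ring of formal power series. -/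
abbrev FF := FractionRing PS

/-- The action of formal diffeomorphisms on the field of fractions. -/
def act : unip →* (FF ≃ₐ[ℂ] FF) :=
  (IsFractionRing.fieldEquivOfAlgEquivHom ℂ FF).comp unip.subtype

theorem act_algebraMap (σ : unip) (a : PS) :
    act σ (algebraMap PS FF a) = algebraMap PS FF ((σ : PS ≃ₐ[ℂ] PS) a) :=
  IsFractionRing.fieldEquivOfAlgEquiv_algebraMap ℂ FF FF (σ : PS ≃ₐ[ℂ] PS) a

theorem act_mul_apply (σ τ : unip) (u : FF) : act (σ * τ) u = act σ (act τ u) := by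
  rw [map_mul, AlgEquiv.mul_apply]

theorem act_inv_apply (σ : unip) (u : FF) : act σ⁻¹ (act σ u) = u := by
  rw [← act_mul_apply, inv_mul_cancel, map_one, AlgEquiv.one_apply]

theorem act_apply_inv (σ : unip) (u : FF) : act σ (act σ⁻¹ u) = u := by
  rw [← act_mul_apply, mul_inv_cancel, map_one, AlgEquiv.one_apply]

theorem act_ne_zero (σ : unip) {u : FF} (hu : u ≠ 0) : act σ u ≠ 0 :=
  (map_ne_zero_iff _ (act σ).injective).2 hu

instance : CharZero FF := charZero_of_injective_algebraMap (algebraMap ℂ FF).injective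

theorem algebraMap_FF_injective : Function.Injective (algebraMap PS FF) :=
  IsFractionRing.injective PS FF

theorem act_injective : Function.Injective act := fun σ τ h => by
  apply Subtype.ext
  ext1 a
  apply algebraMap_FF_injective
  rw [← act_algebraMap, ← act_algebraMap, h]

/-- At time zero the flow is the identity, so the constant term in time is `b` itself, a nonzero
element of the field. Hence the flow extends to fractions. -/
theorem isUnit_flow (σ : unip) (b : nonZeroDivisors PS) :
    IsUnit (((PowerSeries.map (algebraMap PS FF)).comp (flow σ)) b) := by
  rw [PowerSeries.isUnit_iff_constantCoeff, ← PowerSeries.coeff_zero_eq_constantCoeff_apply,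
    RingHom.comp_apply, PowerSeries.coeff_map, coeff_flow_zero, isUnit_iff_ne_zero]
  exact IsFractionRing.to_map_ne_zero_of_mem_nonZeroDivisors b.2

/-- The formal flow on the field of fractions. -/
def flowK (σ : unip) : FF →+* PowerSeries FF :=
  IsLocalization.lift (M := nonZeroDivisors PS) (isUnit_flow σ)

theorem flowK_algebraMap (σ : unip) (a : PS) :
    flowK σ (algebraMap PS FF a) = PowerSeries.map (algebraMap PS FF) (flow σ a) :=
  IsLocalization.lift_eq _ _

theorem exists_frac (u : FF) : ∃ a b : PS, b ≠ 0 ∧ u * algebraMap PS FF b = algebraMap PS FF a := by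
  obtain ⟨a, b, hb, rfl⟩ := IsFractionRing.div_surjective (A := PS) u
  refine ⟨a, b, nonZeroDivisors.ne_zero hb, ?_⟩
  rw [div_mul_cancel₀]
  exact IsFractionRing.to_map_ne_zero_of_mem_nonZeroDivisors hb

theorem algebraMap_ne_zero {b : PS} (hb : b ≠ 0) : algebraMap PS FF b ≠ 0 :=
  fun h => hb (algebraMap_FF_injective (h.trans (map_zero _).symm))

theorem flowK_ne_zero (σ : unip) {u : FF} (hu : u ≠ 0) : flowK σ u ≠ 0 :=
  fun h => hu ((flowK σ).injective (h.trans (map_zero _).symm))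

theorem coeff_flowK_zero (σ : unip) (u : FF) : PowerSeries.coeff 0 (flowK σ u) = u := by
  obtain ⟨a, b, hb, h⟩ := exists_frac u
  have h1 := congrArg (fun v => PowerSeries.coeff 0 (flowK σ v)) h
  simp only [map_mul, flowK_algebraMap, PowerSeries.coeff_zero_eq_constantCoeff_apply] at h1
  simp only [← PowerSeries.coeff_zero_eq_constantCoeff_apply, PowerSeries.coeff_map,
    coeff_flow_zero] at h1
  rw [← h] at h1
  exact mul_right_cancel₀ (algebraMap_ne_zero hb) h1

/-- Two flows agree exactly if all iterates do. -/
theorem flowK_eq_iff (σ τ : unip) (u w : FF) :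
    flowK σ u = flowK τ w ↔ ∀ n : ℕ, act (σ ^ n) u = act (τ ^ n) w := by
  obtain ⟨a, b, hb, hu⟩ := exists_frac u
  obtain ⟨c, d, hd, hw⟩ := exists_frac w
  have hb' := algebraMap_ne_zero hb
  have hd' := algebraMap_ne_zero hd
  have hu1 : flowK σ u * flowK σ (algebraMap PS FF b) = flowK σ (algebraMap PS FF a) := by
    rw [← map_mul, hu]
  have hw1 : flowK τ w * flowK τ (algebraMap PS FF d) = flowK τ (algebraMap PS FF c) := by
    rw [← map_mul, hw]
  -- With denominators cleared, both assertions compare `interp σ a * interp τ d` with `interp τ c *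
  -- interp σ b`, which `evalAt_ext` separates at natural times.
  have e1 : flowK σ u = flowK τ w ↔
      flowK σ (algebraMap PS FF a) * flowK τ (algebraMap PS FF d) =
        flowK τ (algebraMap PS FF c) * flowK σ (algebraMap PS FF b) := by
    rw [← hu1, ← hw1]
    constructor
    · intro h; rw [h]; ring
    · intro h
      refine mul_right_cancel₀ (mul_ne_zero (flowK_ne_zero σ hb') (flowK_ne_zero τ hd')) ?_
      linear_combination h
  have e2 : ∀ n, act (σ ^ n) u = act (τ ^ n) w ↔
      evalAt n (interp σ a * interp τ d) = evalAt n (interp τ c * interp σ b) := by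
    intro n
    have hu2 : act (σ ^ n) u * act (σ ^ n) (algebraMap PS FF b) =
      act (σ ^ n) (algebraMap PS FF a) := by rw [← map_mul, hu]
    have hw2 : act (τ ^ n) w * act (τ ^ n) (algebraMap PS FF d) =
      act (τ ^ n) (algebraMap PS FF c) := by rw [← map_mul, hw]
    have hb2 : act (σ ^ n) (algebraMap PS FF b) ≠ 0 := act_ne_zero _ hb'
    have hd2 : act (τ ^ n) (algebraMap PS FF d) ≠ 0 := act_ne_zero _ hd'
    rw [← algebraMap_FF_injective.eq_iff]
    simp only [map_mul, evalAt_interp, ← Subgroup.coe_pow, ← act_algebraMap]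
    rw [← hu2, ← hw2]
    constructor
    · intro h; rw [h]; ring
    · intro h
      refine mul_right_cancel₀ (mul_ne_zero hb2 hd2) ?_
      linear_combination h
  have hinj : Function.Injective (PowerSeries.map (algebraMap PS FF)) := fun F G h => by
    ext1 m
    apply algebraMap_FF_injective
    rw [← PowerSeries.coeff_map, ← PowerSeries.coeff_map, h]
  rw [e1]
  simp only [e2]
  simp only [flowK_algebraMap, ← map_mul, hinj.eq_iff, flow_apply, swap_injective.eq_iff]
  exact ⟨fun h n => by rw [h], evalAt_ext⟩

/-- The infinitesimal generator of `σ`, a derivation of the field of fractions. -/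
def logK (σ : unip) : Derivation ℂ FF FF := Derivation.mk'
  { toFun := fun u => PowerSeries.coeff 1 (flowK σ u)
    map_add' := fun u v => by rw [map_add, map_add]
    map_smul' := fun c u => by
      rw [Algebra.smul_def, map_mul, IsScalarTower.algebraMap_apply ℂ PS FF, flowK_algebraMap,
        ← C_eq_algebraMap, flow_C, PowerSeries.map_C, PowerSeries.coeff_C_mul, RingHom.id_apply,
        C_eq_algebraMap, ← IsScalarTower.algebraMap_apply, Algebra.smul_def] }
  (fun u v => by
    change PowerSeries.coeff 1 (flowK σ (u * v)) =
      u * PowerSeries.coeff 1 (flowK σ v) + v * PowerSeries.coeff 1 (flowK σ u)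
    rw [map_mul, PowerSeries.coeff_mul, Finset.Nat.sum_antidiagonal_eq_sum_range_succ_mk,
      Finset.sum_range_succ, Finset.sum_range_one]
    simp only [coeff_flowK_zero, tsub_zero, tsub_self]
    ring)

theorem logK_apply (σ : unip) (u : FF) : logK σ u = PowerSeries.coeff 1 (flowK σ u) := rfl

theorem logK_algebraMap (σ : unip) (a : PS) :
    logK σ (algebraMap PS FF a) = algebraMap PS FF (logFun σ a) := by
  rw [logK_apply, flowK_algebraMap, PowerSeries.coeff_map]
  rfl

theorem logK_mul (σ : unip) (u v : FF) : logK σ (u * v) = u * logK σ v + v * logK σ u :=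
  (logK σ).leibniz u v

theorem logK_conj (τ σ : unip) (u : FF) :
    logK (τ * σ * τ⁻¹) (act τ u) = act τ (logK σ u) := by
  obtain ⟨a, b, hb, h⟩ := exists_frac u
  have hb' : act τ (algebraMap PS FF b) ≠ 0 := act_ne_zero _ (algebraMap_ne_zero hb)
  have key : ∀ c : PS, logK (τ * σ * τ⁻¹) (act τ (algebraMap PS FF c)) =
      act τ (logK σ (algebraMap PS FF c)) := fun c => by
    rw [act_algebraMap, logK_algebraMap, logK_algebraMap, act_algebraMap, logFun_conj]
  have h1 := key a
  rw [← h, logK_mul, map_mul, logK_mul, map_add, map_mul, map_mul, key b] at h1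
  exact mul_left_cancel₀ hb' (add_left_cancel h1)

theorem derivative_flowK (σ : unip) (u : FF) :
    PowerSeries.derivative FF (flowK σ u) = flowK σ (logK σ u) := by
  obtain ⟨a, b, hb, h⟩ := exists_frac u
  have key : ∀ c : PS, PowerSeries.derivative FF (flowK σ (algebraMap PS FF c)) =
      flowK σ (logK σ (algebraMap PS FF c)) := fun c => by
    rw [logK_algebraMap, flowK_algebraMap, flowK_algebraMap, ← derivative_flow]
    ext1 m
    rw [PowerSeries.coeff_derivative, PowerSeries.coeff_map, PowerSeries.coeff_map,
      PowerSeries.coeff_derivative]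
    simp
  have h1 := key a
  rw [← h, logK_mul, map_mul, Derivation.leibniz, key b, map_add, map_mul, map_mul] at h1
  exact mul_left_cancel₀ (flowK_ne_zero σ (algebraMap_ne_zero hb)) (add_left_cancel h1)

theorem coeff_flowK_succ (σ : unip) (u : FF) (m : ℕ) :
    PowerSeries.coeff (m + 1) (flowK σ u) * (m + 1) =
      PowerSeries.coeff m (flowK σ (logK σ u)) := by
  rw [← derivative_flowK, PowerSeries.coeff_derivative]

/-- Uniqueness for the flow equation, coefficient by coefficient in time, dividing by `m + 1`. Only
invariance of `k` under the generator is needed, so the statement applies later to fields of first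
integrals. -/
theorem flowK_eq_of_logK {k : Set FF} {σ τ : unip} (hk : ∀ u ∈ k, logK σ u ∈ k)
    (h : ∀ u ∈ k, logK σ u = logK τ u) : ∀ u ∈ k, flowK σ u = flowK τ u := by
  have key : ∀ m, ∀ u ∈ k, PowerSeries.coeff m (flowK σ u) = PowerSeries.coeff m (flowK τ u) := by
    intro m
    induction m with
    | zero => intro u _; rw [coeff_flowK_zero, coeff_flowK_zero]
    | succ m ih =>
      intro u hu
      refine mul_right_cancel₀ (Nat.cast_add_one_ne_zero m : (m + 1 : FF) ≠ 0) ?_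
      rw [coeff_flowK_succ, coeff_flowK_succ, ← h u hu, ih _ (hk u hu)]
  exact fun u hu => PowerSeries.ext fun m => key m u hu

/-- Diffeomorphisms with the same generator on an invariant set agree on it. -/
theorem act_eq_of_logK {k : Set FF} {σ τ : unip} (hk : ∀ u ∈ k, logK σ u ∈ k)
    (h : ∀ u ∈ k, logK σ u = logK τ u) : ∀ u ∈ k, act σ u = act τ u := fun u hu => by
  have := (flowK_eq_iff σ τ u u).1 (flowK_eq_of_logK hk h u hu) 1
  rwa [pow_one, pow_one] at this

/-- Diffeomorphisms which agree on an invariant set have the same generator on it. -/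
theorem logK_eq_of_act {k : Set FF} {σ τ : unip} (hk : ∀ u ∈ k, act σ u ∈ k)
    (h : ∀ u ∈ k, act σ u = act τ u) : ∀ u ∈ k, logK σ u = logK τ u := fun u hu => by
  have key : ∀ n : ℕ, ∀ v ∈ k, act (σ ^ n) v = act (τ ^ n) v := by
    intro n
    induction n with
    | zero => intro v _; rfl
    | succ n ih =>
      intro v hv
      rw [pow_succ, pow_succ, act_mul_apply, act_mul_apply, ← h v hv, ih _ (hk v hv)]
  rw [logK_apply, logK_apply, (flowK_eq_iff σ τ u u).2 fun n => key n u hu]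

theorem logK_injective {σ τ : unip} (h : ∀ u, logK σ u = logK τ u) : σ = τ :=
  act_injective (AlgEquiv.ext fun u => act_eq_of_logK (k := Set.univ) (fun _ _ => trivial)
    (fun u _ => h u) u trivial)

theorem logK_one (u : FF) : logK 1 u = 0 := by
  have h1 := logK_mul 1 u 1
  obtain ⟨a, b, hb, h⟩ := exists_frac u
  have key : ∀ c : PS, logFun 1 c = 0 := fun c => eq_zero_of_forall_mem_ordIdeal fun M => by
    have h2 := logFun_approx 1 c (M + 1)
    have : ∀ k, (diffOp ((1 : unip) : PS ≃ₐ[ℂ] PS) ^ (k + 1)) c = 0 := fun k => by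
      rw [pow_succ, Module.End.mul_apply, diffOp_apply]
      simp
    rw [Finset.sum_range_succ'] at h2
    simp only [this, smul_zero, Finset.sum_const_zero] at h2
    have h3 : (binomPoly 0).coeff 1 = 0 := by simp [binomPoly, Polynomial.coeff_one]
    rw [h3, zero_smul, zero_add, sub_zero] at h2
    exact ordIdeal_anti (Nat.le_succ M) h2
  have h2 := logK_algebraMap 1 a
  rw [← h, logK_mul, logK_algebraMap, key, key, map_zero, mul_zero, zero_add] at h2
  exact (mul_eq_zero.1 h2).resolve_left (algebraMap_ne_zero hb)

theorem act_eq_self_iff (σ : unip) (u : FF) : act σ u = u ↔ logK σ u = 0 := by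
  constructor
  · intro h
    have := logK_eq_of_act (k := {u}) (σ := σ) (τ := 1) (by rintro _ rfl; exact h)
      (by rintro _ rfl; rw [h, map_one, AlgEquiv.one_apply]) u rfl
    rwa [logK_one] at this
  · intro h
    -- The element `0` is included because the generator sends `u` to `0` and the set must be
    -- invariant.
    have := act_eq_of_logK (k := {u, 0}) (σ := σ) (τ := 1)
      (by rintro v (rfl | rfl) <;> simp [h])
      (by rintro v (rfl | rfl) <;> simp [h, logK_one]) u (by simp)
    rwa [map_one, AlgEquiv.one_apply] at this

/-- If `δ` preserves the field of invariants of `γ`, then so does its generator. -/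
theorem logK_mem_fixed {γ δ : unip} (h : ∀ u, act γ u = u → act γ (act δ u) = act δ u) :
    ∀ u, act γ u = u → act γ (logK δ u) = logK δ u := by
  intro u hu
  have hpow : ∀ n : ℕ, act γ (act (δ ^ n) u) = act (δ ^ n) u := by
    intro n
    induction n with
    | zero => simpa using hu
    | succ n ih => rw [pow_succ', act_mul_apply]; exact h _ ih
  -- All iterates `δ ^ n u` are fixed by `γ`, so `δ` and its conjugate have the same orbit of `u`,
  -- hence the same flow at `u`.
  have h1 : flowK (γ * δ * γ⁻¹) u = flowK δ u := (flowK_eq_iff _ _ _ _).2 fun n => by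
    have e : act γ⁻¹ u = u := by
      conv_lhs => rw [← hu]
      exact act_inv_apply γ u
    rw [conj_pow, act_mul_apply, act_mul_apply, e, hpow]
  have h2 := logK_conj γ δ u
  rw [hu, logK_apply, h1] at h2
  exact h2.symm

end FormalDiffeo

end

/-! ### Linear dependence of generators and constancy of common first integrals -/

noncomputable section

namespace FormalDiffeo

open MvPowerSeries

theorem derivation_FF_eq_zero {D : Derivation ℂ FF FF} (h : ∀ a : PS, D (algebraMap PS FF a) = 0) :
    D = 0 := by
  ext1 u
  obtain ⟨a, b, hb, hu⟩ := exists_frac u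
  have h1 := h a
  rw [← hu, D.leibniz, h b, smul_zero, zero_add, smul_eq_mul] at h1
  exact (mul_eq_zero.1 h1).resolve_left (algebraMap_ne_zero hb)

/-- A linear relation between generators can be checked on the two variables. -/
theorem logK_relation {σ₁ σ₂ σ₃ : unip} {p₁ p₂ p₃ : PS}
    (h : ∀ i, p₁ * logFun σ₁ (X i) + p₂ * logFun σ₂ (X i) + p₃ * logFun σ₃ (X i) = 0) (u : FF) :
    algebraMap PS FF p₁ * logK σ₁ u + algebraMap PS FF p₂ * logK σ₂ u +
      algebraMap PS FF p₃ * logK σ₃ u = 0 := by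
  have h0 : p₁ • logDer σ₁ + p₂ • logDer σ₂ + p₃ • logDer σ₃ = 0 := derivation_eq_zero h
  have h1 : algebraMap PS FF p₁ • logK σ₁ + algebraMap PS FF p₂ • logK σ₂ +
      algebraMap PS FF p₃ • logK σ₃ = 0 := derivation_FF_eq_zero fun a => by
    have h2 := congrArg (fun D : Derivation ℂ PS PS => algebraMap PS FF (D a)) h0
    simp only [Derivation.add_apply, Derivation.smul_apply, smul_eq_mul, map_add, map_mul,
      Derivation.zero_apply, map_zero, logDer_apply] at h2
    simp only [Derivation.add_apply, Derivation.smul_apply, smul_eq_mul, logK_algebraMap]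
    exact h2
  exact congrArg (fun D : Derivation ℂ FF FF => D u) h1

/-- The determinant of the generators of two formal diffeomorphisms. -/
def wedge (σ τ : unip) : PS :=
  logFun σ (X 0) * logFun τ (X 1) - logFun σ (X 1) * logFun τ (X 0)

/-- Cramer's rule: a derivation is determined by its values on the two variables, so generators are
vectors in a plane over the fraction field. -/
theorem exists_eq_add_of_wedge_ne_zero {σ₁ σ₂ : unip} (h : wedge σ₁ σ₂ ≠ 0) (τ : unip) :
    ∃ a b : FF, ∀ u, logK τ u = a * logK σ₁ u + b * logK σ₂ u := by
  have hw := algebraMap_ne_zero h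
  refine ⟨algebraMap PS FF (wedge τ σ₂) / algebraMap PS FF (wedge σ₁ σ₂),
    algebraMap PS FF (wedge σ₁ τ) / algebraMap PS FF (wedge σ₁ σ₂), fun u => ?_⟩
  have := logK_relation (σ₁ := σ₁) (σ₂ := σ₂) (σ₃ := τ) (p₁ := wedge τ σ₂) (p₂ := wedge σ₁ τ)
    (p₃ := -wedge σ₁ σ₂) (fun i => by
      rw [wedge, wedge, wedge]
      fin_cases i <;> simp only [Fin.zero_eta, Fin.mk_one] <;> ring) u
  rw [map_neg] at this
  field_simp
  linear_combination -this

theorem exists_eq_mul_of_wedge_eq_zero {σ τ : unip} (hσ : σ ≠ 1) (h : wedge σ τ = 0) :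
    ∃ a : FF, ∀ u, logK τ u = a * logK σ u := by
  have hX : ∃ i, logFun σ (X i) ≠ 0 := by
    by_contra! hcon
    refine hσ (logK_injective fun u => ?_)
    rw [logK_one]
    simpa using logK_relation (σ₁ := σ) (σ₂ := 1) (σ₃ := 1) (p₁ := 1) (p₂ := 0) (p₃ := 0)
      (by simpa using hcon) u
  obtain ⟨i, hi⟩ := hX
  have hi' := algebraMap_ne_zero hi
  refine ⟨algebraMap PS FF (logFun τ (X i)) / algebraMap PS FF (logFun σ (X i)), fun u => ?_⟩
  rw [wedge] at h
  have := logK_relation (σ₁ := σ) (σ₂ := τ) (σ₃ := 1) (p₁ := logFun τ (X i))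
    (p₂ := -logFun σ (X i)) (p₃ := 0) (fun j => by
      fin_cases i <;> fin_cases j <;> simp only [Fin.zero_eta, Fin.mk_one]
      · ring
      · linear_combination -h
      · linear_combination h
      · ring) u
  rw [map_neg, map_zero, zero_mul, add_zero] at this
  field_simp
  linear_combination -this

/-- The derivation `xᵢ ∂/∂xᵢ`. -/
def euler (i : Fin 2) : Derivation ℂ PS PS := (X i : PS) • pderiv ℂ i

/-- Euler derivations are used rather than partial derivatives because they are diagonal on
monomials and so do not shift the least exponent of a series. -/
theorem coeff_euler (i : Fin 2) (f : PS) (d : Fin 2 →₀ ℕ) :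
    coeff d (euler i f) = coeff d f * d i := by
  rw [euler, Derivation.smul_apply, smul_eq_mul, X_def, coeff_monomial_mul]
  simp only [Finsupp.single_le_iff, one_mul]
  split_ifs with h
  · rw [coeff_pderiv, tsub_add_cancel_of_le (by rwa [Finsupp.single_le_iff])]
    congr 1
    have : (d - Finsupp.single i 1 : Fin 2 →₀ ℕ) i = d i - 1 := by simp
    rw [this, Nat.cast_sub h]
    simp
  · rw [(by omega : d i = 0)]
    simp

theorem coeff_add_mul_of_lex {f g : PS} {p q : Fin 2 →₀ ℕ}
    (hf : ∀ d, toLex d < toLex p → coeff d f = 0) (hg : ∀ d, toLex d < toLex q → coeff d g = 0) :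
    coeff (p + q) (f * g) = coeff p f * coeff q g := by
  rw [coeff_mul, Finset.sum_eq_single_of_mem ⟨p, q⟩ (by simp)]
  rintro ⟨u, v⟩ h h'
  simp only [Finset.HasAntidiagonal.mem_antidiagonal] at h
  rcases trichotomy_of_add_eq_add (congrArg toLex h) with h'' | h'' | h''
  · exact False.elim (h' (by simp [h''.1, h''.2]))
  · rw [hf _ h'', zero_mul]
  · rw [hg _ h'', mul_zero]

theorem exists_lex_min {f : PS} (hf : f ≠ 0) :
    ∃ p : Fin 2 →₀ ℕ, coeff p f ≠ 0 ∧ ∀ d, toLex d < toLex p → coeff d f = 0 := by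
  obtain ⟨p, hp⟩ := exists_finsupp_eq_lexOrder_of_ne_zero hf
  refine ⟨p, coeff_ne_zero_of_lexOrder hp.symm, fun d hd => coeff_eq_zero_of_lt_lexOrder ?_⟩
  rw [hp]
  exact_mod_cast hd

/-- At exponent `p + q` only the initial terms contribute, and the relation becomes `p i = q i` up
to the nonzero factor `coeff p a * coeff q b`. -/
theorem lex_min_eq {a b : PS} (h : ∀ i, euler i a * b = a * euler i b) {p q : Fin 2 →₀ ℕ}
    (hp : coeff p a ≠ 0) (hp' : ∀ d, toLex d < toLex p → coeff d a = 0)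
    (hq : coeff q b ≠ 0) (hq' : ∀ d, toLex d < toLex q → coeff d b = 0) : p = q := by
  ext i
  have h1 := congrArg (coeff (p + q)) (h i)
  rw [coeff_add_mul_of_lex (fun d hd => by rw [coeff_euler, hp' d hd, zero_mul]) hq',
    coeff_add_mul_of_lex hp' (fun d hd => by rw [coeff_euler, hq' d hd, zero_mul]),
    coeff_euler, coeff_euler] at h1
  have h2 : (p i : ℂ) = q i := by
    refine mul_left_cancel₀ (mul_ne_zero hp hq) ?_
    linear_combination h1
  exact_mod_cast h2

/-- Subtract from `a` the multiple of `b` that cancels the coefficient at the least exponent `q` of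
`b`. The difference satisfies the same relation, so if nonzero it would also have least exponent
`q`, where its coefficient is zero. -/
theorem eq_smul_of_euler {a b : PS} (hb : b ≠ 0) (h : ∀ i, euler i a * b = a * euler i b) :
    ∃ c : ℂ, a = c • b := by
  rcases eq_or_ne a 0 with rfl | ha
  · exact ⟨0, (zero_smul _ _).symm⟩
  obtain ⟨p, hp, hp'⟩ := exists_lex_min ha
  obtain ⟨q, hq, hq'⟩ := exists_lex_min hb
  refine ⟨coeff q a / coeff q b, ?_⟩
  by_contra hne
  obtain ⟨r, hr, hr'⟩ := exists_lex_min (sub_ne_zero.2 hne)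
  have hrq := lex_min_eq (fun i => by
    rw [map_sub, Derivation.map_smul, sub_mul, sub_mul, h i, smul_mul_assoc, smul_mul_assoc,
      mul_comm b]) hr hr' hq hq'
  apply hr
  rw [hrq, map_sub, coeff_smul, div_mul_cancel₀ _ hq, sub_self]

/-- A fraction killed by two independent generators is a constant. -/
theorem exists_const_of_wedge_ne_zero {σ₁ σ₂ : unip} (hw : wedge σ₁ σ₂ ≠ 0) {u : FF}
    (h₁ : logK σ₁ u = 0) (h₂ : logK σ₂ u = 0) : ∃ c : ℂ, u = algebraMap ℂ FF c := by
  obtain ⟨a, b, hb, hu⟩ := exists_frac u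
  have key : ∀ σ : unip, logK σ u = 0 → logFun σ a * b = a * logFun σ b := fun σ hσ => by
    have h3 : logK σ (algebraMap PS FF a) = u * logK σ (algebraMap PS FF b) := by
      rw [← hu, logK_mul, hσ, mul_zero, add_zero]
    rw [logK_algebraMap, logK_algebraMap] at h3
    apply algebraMap_FF_injective
    rw [map_mul, map_mul, h3, ← hu]
    ring
  -- By Cramer's rule the multiple of any derivation by the wedge is a combination of the two
  -- generators; so a fraction killed by both is killed by the Euler derivations.
  have hE : ∀ i, wedge σ₁ σ₂ • euler i =
      (euler i (X 0) * logFun σ₂ (X 1) - euler i (X 1) * logFun σ₂ (X 0)) • logDer σ₁ +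
      (logFun σ₁ (X 0) * euler i (X 1) - logFun σ₁ (X 1) * euler i (X 0)) • logDer σ₂ := by
    intro i
    rw [← sub_eq_zero]
    refine derivation_eq_zero fun j => ?_
    simp only [Derivation.sub_apply, Derivation.add_apply, Derivation.smul_apply, smul_eq_mul,
      logDer_apply, wedge]
    fin_cases j <;> simp only [Fin.zero_eta, Fin.mk_one] <;> ring
  have hE' : ∀ i, euler i a * b = a * euler i b := fun i => by
    have ha := congrArg (fun D : Derivation ℂ PS PS => D a) (hE i)
    have hb := congrArg (fun D : Derivation ℂ PS PS => D b) (hE i)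
    simp only [Derivation.add_apply, Derivation.smul_apply, smul_eq_mul, logDer_apply] at ha hb
    refine mul_left_cancel₀ hw ?_
    generalize euler i (X 0) * logFun σ₂ (X 1) - euler i (X 1) * logFun σ₂ (X 0) = s at ha hb
    generalize logFun σ₁ (X 0) * euler i (X 1) - logFun σ₁ (X 1) * euler i (X 0) = t at ha hb
    linear_combination b * ha - a * hb + s * key σ₁ h₁ + t * key σ₂ h₂
  obtain ⟨c, hc⟩ := eq_smul_of_euler hb hE'
  refine ⟨c, mul_right_cancel₀ (algebraMap_ne_zero hb) ?_⟩
  rw [hu, hc, smul_eq_C_mul, map_mul, C_eq_algebraMap, ← IsScalarTower.algebraMap_apply]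

end FormalDiffeo

end

/-! ### Derived series, conjugated commutators and the pigeonhole on derived lengths -/

noncomputable section

section IteratedCommutators

variable {A B : Type*} [Group A] [Group B]

/-- The derived series of a subgroup, inside the ambient group. -/
def iterComm (H : Subgroup A) : ℕ → Subgroup A
  | 0 => H
  | n + 1 => ⁅iterComm H n, iterComm H n⁆

theorem iterComm_mono {H K : Subgroup A} (h : H ≤ K) (n : ℕ) : iterComm H n ≤ iterComm K n := by
  induction n with
  | zero => exact h
  | succ n ih => exact Subgroup.commutator_mono ih ih

theorem iterComm_le (H : Subgroup A) (n : ℕ) : iterComm H n ≤ H := by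
  induction n with
  | zero => exact le_rfl
  | succ n ih =>
    refine le_trans ((Subgroup.commutator_le).2 fun g hg h hh => ?_) ih
    rw [commutatorElement_def]
    exact mul_mem (mul_mem (mul_mem hg hh) (inv_mem hg)) (inv_mem hh)

theorem iterComm_add (H : Subgroup A) (m n : ℕ) :
    iterComm H (m + n) = iterComm (iterComm H m) n := by
  induction n with
  | zero => rfl
  | succ n ih =>
    change ⁅iterComm H (m + n), iterComm H (m + n)⁆ = _
    rw [ih]
    rfl

theorem map_iterComm (f : A →* B) (H : Subgroup A) (n : ℕ) :
    (iterComm H n).map f = iterComm (H.map f) n := by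
  induction n with
  | zero => rfl
  | succ n ih =>
    change Subgroup.map f ⁅iterComm H n, iterComm H n⁆ = _
    rw [Subgroup.map_commutator, ih]
    rfl

theorem conj_mem_iterComm {H K : Subgroup A} {s : A} (h : ∀ x ∈ H, s * x * s⁻¹ ∈ K) (n : ℕ) :
    ∀ x ∈ iterComm H n, s * x * s⁻¹ ∈ iterComm K n := by
  intro x hx
  have h1 : H.map (MulAut.conj s).toMonoidHom ≤ K := by
    rintro _ ⟨y, hy, rfl⟩
    exact h y hy
  refine iterComm_mono h1 n ?_
  rw [← map_iterComm]
  exact ⟨x, hx, rfl⟩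

theorem isSolvable_of_iterComm_eq_bot {H : Subgroup A} {n : ℕ} (h : iterComm H n = ⊥) :
    Group.IsSolvable H := by
  have key : ∀ n, (derivedSeries H n).map H.subtype = iterComm H n := by
    intro n
    induction n with
    | zero => rw [derivedSeries_zero, ← MonoidHom.range_eq_map, Subgroup.range_subtype]; rfl
    | succ n ih => rw [derivedSeries_succ, Subgroup.map_commutator, ih]; rfl
  refine ⟨n, ?_⟩
  rw [← Subgroup.map_eq_bot_iff_of_injective _ H.subtype_injective, key, h]

/-- The commutators of elements of `S` and their conjugates by words of length at most `n` in
elements of `S`. -/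
def conjComm (S : Set A) : ℕ → Set A
  | 0 => {g | ∃ s ∈ S, ∃ t ∈ S, g = s * t * s⁻¹ * t⁻¹}
  | n + 1 => conjComm S n ∪ {g | ∃ s ∈ S, ∃ x ∈ conjComm S n, g = s * x * s⁻¹}

theorem image_conjComm (f : A →* B) (S : Set A) (n : ℕ) :
    f '' conjComm S n = conjComm (f '' S) n := by
  induction n with
  | zero =>
    ext g
    constructor
    · rintro ⟨_, ⟨s, hs, t, ht, rfl⟩, rfl⟩
      exact ⟨f s, ⟨s, hs, rfl⟩, f t, ⟨t, ht, rfl⟩, by simp⟩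
    · rintro ⟨_, ⟨s, hs, rfl⟩, _, ⟨t, ht, rfl⟩, rfl⟩
      exact ⟨_, ⟨s, hs, t, ht, rfl⟩, by simp⟩
  | succ n ih =>
    change f '' (conjComm S n ∪ _) = conjComm (f '' S) n ∪ _
    rw [Set.image_union, ih, ← ih]
    congr 1
    ext g
    constructor
    · rintro ⟨_, ⟨s, hs, t, ht, rfl⟩, rfl⟩
      exact ⟨f s, ⟨s, hs, rfl⟩, f t, ⟨t, ht, rfl⟩, by simp⟩
    · rintro ⟨_, ⟨s, hs, rfl⟩, _, ⟨t, ht, rfl⟩, rfl⟩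
      exact ⟨_, ⟨s, hs, t, ht, rfl⟩, by simp⟩

theorem conjComm_subset_succ (S : Set A) (n : ℕ) : conjComm S n ⊆ conjComm S (n + 1) :=
  fun _ h => Or.inl h

theorem conjComm_subset_closure (S : Set A) (n : ℕ) :
    conjComm S n ⊆ Subgroup.closure S := by
  have hS := Subgroup.subset_closure (k := S)
  induction n with
  | zero =>
    rintro _ ⟨s, hs, t, ht, rfl⟩
    exact mul_mem (mul_mem (mul_mem (hS hs) (hS ht)) (inv_mem (hS hs))) (inv_mem (hS ht))
  | succ n ih =>
    rintro _ (h | ⟨s, hs, x, hx, rfl⟩)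
    · exact ih h
    · exact mul_mem (mul_mem (hS hs) (ih hx)) (inv_mem (hS hs))

theorem conj_mem_closure_conjComm {S : Set A} {s : A} (hs : s ∈ S) (n : ℕ) :
    ∀ x ∈ Subgroup.closure (conjComm S n), s * x * s⁻¹ ∈ Subgroup.closure (conjComm S (n + 1)) := by
  intro x hx
  have h1 : Subgroup.closure (conjComm S n) ≤
      (Subgroup.closure (conjComm S (n + 1))).comap (MulAut.conj s).toMonoidHom := by
    rw [Subgroup.closure_le]
    intro y hy
    exact Subgroup.subset_closure (Or.inr ⟨s, hs, y, hy, rfl⟩)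
  exact h1 hx

theorem closure_conjComm_mono (S : Set A) : Monotone fun n => Subgroup.closure (conjComm S n) :=
  monotone_nat_of_le_succ fun n => Subgroup.closure_mono (conjComm_subset_succ S n)

/-- A subgroup normalized by `S` and containing the commutators of elements of `S` contains the
commutator subgroup of the group generated by `S`. -/
theorem commutator_closure_le {S : Set A} {N : Subgroup A}
    (hN : ∀ g ∈ Subgroup.closure S, ∀ x ∈ N, g * x * g⁻¹ ∈ N)
    (h : ∀ s ∈ S, ∀ t ∈ S, s * t * s⁻¹ * t⁻¹ ∈ N) :
    ⁅Subgroup.closure S, Subgroup.closure S⁆ ≤ N := by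
  -- Since `N` is normalized, the elements whose commutator with a fixed `t` lies in `N` are closed
  -- under products and inverses. This is used twice, for each argument of the commutator in turn.
  have key : ∀ t, (∀ s ∈ S, s * t * s⁻¹ * t⁻¹ ∈ N) → ∀ g ∈ Subgroup.closure S,
      g * t * g⁻¹ * t⁻¹ ∈ N := by
    intro t ht g hg
    induction hg using Subgroup.closure_induction with
    | mem x hx => exact ht x hx
    | one => simp
    | mul x y hx hy ihx ihy =>
      have : x * y * t * (x * y)⁻¹ * t⁻¹ =
        (x * (y * t * y⁻¹ * t⁻¹) * x⁻¹) * (x * t * x⁻¹ * t⁻¹) := by group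
      rw [this]
      exact mul_mem (hN x hx _ ihy) ihx
    | inv x hx ihx =>
      have : x⁻¹ * t * x⁻¹⁻¹ * t⁻¹ = x⁻¹ * (x * t * x⁻¹ * t⁻¹)⁻¹ * x⁻¹⁻¹ := by group
      rw [this]
      exact hN _ (inv_mem hx) _ (inv_mem ihx)
  rw [Subgroup.commutator_le]
  intro g hg t ht
  rw [commutatorElement_def]
  refine key t (fun s hs => ?_) g hg
  have := inv_mem (key s (fun t ht => h t ht s hs) t ht)
  have e : (t * s * t⁻¹ * s⁻¹)⁻¹ = s * t * s⁻¹ * t⁻¹ := by group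
  rwa [e] at this

/-- In an increasing chain of subgroups of derived length at most four modulo `N`, the derived
length stabilizes somewhere. -/
theorem exists_stable_iterComm {H : ℕ → Subgroup A} {N : Subgroup A} (h0 : ¬ H 0 ≤ N)
    (h8 : iterComm (H 8) 4 ≤ N) :
    ∃ i j, ¬ iterComm (H i) j ≤ N ∧ iterComm (H (i + 2)) (j + 1) ≤ N := by
  by_contra! hcon
  -- Without a stable pair, every two levels of the chain would cost one more derived step: `(0,0)`,
  -- `(2,1)`, `(4,2)`, `(6,3)`, `(8,4)`. This is where `8 = 2 · 4` comes from.
  exact hcon 6 3 (hcon 4 2 (hcon 2 1 (hcon 0 0 h0))) h8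

end IteratedCommutators

namespace FormalDiffeo

open MvPowerSeries

theorem wedge_relation {σ τ : unip} (hw : wedge σ τ ≠ 0) {a b : FF}
    (h : ∀ u, a * logK σ u + b * logK τ u = 0) : a = 0 ∧ b = 0 := by
  have h0 := h (algebraMap PS FF (X 0))
  have h1 := h (algebraMap PS FF (X 1))
  simp only [logK_algebraMap] at h0 h1
  have hw' := algebraMap_ne_zero hw
  rw [wedge, map_sub, map_mul, map_mul] at hw'
  constructor
  · refine (mul_eq_zero.1 ?_).resolve_right hw'
    linear_combination algebraMap PS FF (logFun τ (X 1)) * h0 -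
      algebraMap PS FF (logFun τ (X 0)) * h1
  · refine (mul_eq_zero.1 ?_).resolve_right hw'
    linear_combination algebraMap PS FF (logFun σ (X 0)) * h1 -
      algebraMap PS FF (logFun σ (X 1)) * h0

theorem logK_comm {δ σ : unip} (h : Commute δ σ) (u : FF) :
    act δ (logK σ u) = logK σ (act δ u) := by
  rw [← logK_conj, h.eq, mul_inv_cancel_right]

theorem commute_of_logK {δ σ : unip} (h : ∀ u, act δ (logK σ u) = logK σ (act δ u)) :
    Commute δ σ := by
  have : δ * σ * δ⁻¹ = σ := logK_injective fun u => by
    have := logK_conj δ σ (act δ⁻¹ u)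
    rw [h, act_apply_inv] at this
    exact this
  exact mul_inv_eq_iff_eq_mul.1 this

theorem exists_logK_ne_zero {γ : unip} (hγ : γ ≠ 1) : ∃ u, logK γ u ≠ 0 := by
  by_contra! hcon
  exact hγ (logK_injective fun u => by rw [logK_one, hcon])

/-- The coefficients of a generator with respect to two others are fixed by a diffeomorphism
commuting with all three. -/
theorem coeff_fixed_of_commute {δ η σ τ : unip} (hw : wedge σ τ ≠ 0) (hη : Commute δ η)
    (hσ : Commute δ σ) (hτ : Commute δ τ) {a b : FF}
    (h : ∀ u, logK η u = a * logK σ u + b * logK τ u) : act δ a = a ∧ act δ b = b := by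
  have := wedge_relation hw (a := act δ a - a) (b := act δ b - b) fun u => by
    have h1 := congrArg (act δ) (h (act δ⁻¹ u))
    rw [logK_comm hη, map_add, map_mul, map_mul, logK_comm hσ, logK_comm hτ, act_apply_inv, h] at h1
    linear_combination -h1
  exact ⟨sub_eq_zero.1 this.1, sub_eq_zero.1 this.2⟩

end FormalDiffeo

end

/-! ### Rank two: the adjoint action on the plane spanned by two commuting generators -/

noncomputable section

namespace FormalDiffeo

open MvPowerSeries
open scoped commutatorElement

/-- Operators which strictly raise a separated filtration, on an invariant space of dimension at
most two: the product of any two of them vanishes. -/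
theorem mul_eq_zero_of_raise {V : Type*} [AddCommGroup V] [Module ℂ V] {F : ℕ → Submodule ℂ V}
    (hF : ∀ n, F (n + 1) ≤ F n) (hsep : ∀ v, (∀ n, v ∈ F n) → v = 0) {W : Submodule ℂ V}
    [FiniteDimensional ℂ W] (hW : Module.finrank ℂ W ≤ 2) (hW0 : W ≤ F 0) {T T' : V → V}
    (hT : ∀ n, ∀ v ∈ F n, T v ∈ F (n + 1)) (hT' : ∀ n, ∀ v ∈ F n, T' v ∈ F (n + 1))
    (hTW : ∀ v ∈ W, T v ∈ W) (hTW' : ∀ v ∈ W, T' v ∈ W) :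
    ∀ v ∈ W, T (T' v) = 0 := by
  -- No linearity of `T` is assumed; that it fixes `0` follows from raising the filtration.
  have hT0 : T 0 = 0 := hsep _ fun n => by
    rcases n with - | n
    · exact hF _ (hT 0 0 (zero_mem _))
    · exact hT n 0 (zero_mem _)
  by_cases hall : ∀ n, W ≤ F n
  · intro v hv
    rw [hsep _ fun n => hall n (hTW' v hv), hT0]
  push Not at hall
  -- With `r` the last level containing `W`, the images of `T'` and of `T ∘ T'` on `W` lie in `W ⊓ F
  -- (r + 1)`, which is at most a line.
  obtain ⟨r, hr, hr'⟩ : ∃ r, W ≤ F r ∧ ¬ W ≤ F (r + 1) := by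
    by_contra! hcon
    obtain ⟨n, hn⟩ := hall
    exact hn (Nat.rec hW0 hcon n)
  have hlt : W ⊓ F (r + 1) < W := lt_of_le_of_ne inf_le_left fun h => hr' (inf_eq_left.1 h)
  have hdim : Module.finrank ℂ ↥(W ⊓ F (r + 1)) ≤ 1 := by
    have := Submodule.finrank_lt_finrank_of_lt hlt
    omega
  have : FiniteDimensional ℂ ↥(W ⊓ F (r + 1)) := Submodule.finiteDimensional_of_le inf_le_left
  obtain ⟨v₀, hv₀⟩ := finrank_le_one_iff.1 hdim
  intro v hv
  have hw : T' v ∈ W ⊓ F (r + 1) := ⟨hTW' v hv, hT' r v (hr hv)⟩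
  have hw' : T (T' v) ∈ W ⊓ F (r + 1) := ⟨hTW _ hw.1, hF _ (hT _ _ hw.2)⟩
  obtain ⟨c₁, hc₁⟩ := hv₀ ⟨_, hw⟩
  obtain ⟨c₂, hc₂⟩ := hv₀ ⟨_, hw'⟩
  have h₁ : c₁ • (v₀ : V) = T' v := congrArg Subtype.val hc₁
  have h₂ : c₂ • (v₀ : V) = T (T' v) := congrArg Subtype.val hc₂
  rcases eq_or_ne c₂ 0 with rfl | h0
  · rw [← h₂, zero_smul]
  -- If `T (T' v)` spans the line, then `T' v` is a multiple of it and so lies one level deeper than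
  -- itself, hence at every level.
  · have hz : T' v = 0 := hsep _ fun n => by
      induction n with
      | zero => exact hW0 hw.1
      | succ n ih =>
        have h3 := hT n _ ih
        rw [← h₂] at h3
        have h4 := (F (n + 1)).smul_mem (c₁ * c₂⁻¹) h3
        rwa [smul_smul, inv_mul_cancel_right₀ h0, h₁] at h4
    rw [hz, hT0]

/-- A left inverse of a linear map preserving a finite-dimensional subspace preserves it too. -/
theorem mem_of_leftInverse {V : Type*} [AddCommGroup V] [Module ℂ V] {W : Submodule ℂ V}
    [FiniteDimensional ℂ W] (f : V → V) (hadd : ∀ v w, f (v + w) = f v + f w)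
    (hsmul : ∀ (c : ℂ) v, f (c • v) = c • f v) {f' : V → V} (hf' : ∀ v, f' (f v) = v)
    (hf : ∀ v ∈ W, f v ∈ W) : ∀ v ∈ W, f' v ∈ W := by
  let T : W →ₗ[ℂ] W :=
    { toFun := fun v => ⟨f v, hf v v.2⟩
      map_add' := fun v w => Subtype.ext (hadd v w)
      map_smul' := fun c v => Subtype.ext (hsmul c v) }
  have hT : Function.Injective T := fun v w h => by
    have h1 : f v = f w := congrArg Subtype.val h
    exact Subtype.ext (by rw [← hf' v, h1, hf'])
  intro v hv
  obtain ⟨w, hw⟩ := LinearMap.surjective_of_injective hT ⟨v, hv⟩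
  have h1 : f w = v := congrArg Subtype.val hw
  rw [← h1, hf']
  exact w.2

/-- The action of automorphisms on derivations. -/
def conjDer (σ : PS ≃ₐ[ℂ] PS) (D : Derivation ℂ PS PS) : Derivation ℂ PS PS := Derivation.mk'
  (σ.toLinearMap ∘ₗ D.toLinearMap ∘ₗ σ⁻¹.toLinearMap) (fun a b => by
    change σ (D (σ⁻¹ (a * b))) = a * σ (D (σ⁻¹ b)) + b * σ (D (σ⁻¹ a))
    have e : ∀ v, σ (σ⁻¹ v) = v := σ.apply_symm_apply
    rw [map_mul, D.leibniz, map_add, smul_eq_mul, smul_eq_mul, map_mul, map_mul, e, e])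

theorem conjDer_apply (σ : PS ≃ₐ[ℂ] PS) (D : Derivation ℂ PS PS) (u : PS) :
    conjDer σ D u = σ (D (σ⁻¹ u)) := rfl

theorem conjDer_mul (σ τ : PS ≃ₐ[ℂ] PS) (D : Derivation ℂ PS PS) :
    conjDer (σ * τ) D = conjDer σ (conjDer τ D) := by
  ext u
  rw [conjDer_apply, conjDer_apply, conjDer_apply, mul_inv_rev]
  rfl

theorem conjDer_one (D : Derivation ℂ PS PS) : conjDer 1 D = D := rfl

theorem conjDer_add (σ : PS ≃ₐ[ℂ] PS) (D D' : Derivation ℂ PS PS) :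
    conjDer σ (D + D') = conjDer σ D + conjDer σ D' := by
  ext1 u
  simp only [conjDer_apply, Derivation.add_apply, map_add]

theorem conjDer_sub (σ : PS ≃ₐ[ℂ] PS) (D D' : Derivation ℂ PS PS) :
    conjDer σ (D - D') = conjDer σ D - conjDer σ D' := by
  ext1 u
  simp only [conjDer_apply, Derivation.sub_apply, map_sub]

theorem conjDer_smul (σ : PS ≃ₐ[ℂ] PS) (c : ℂ) (D : Derivation ℂ PS PS) :
    conjDer σ (c • D) = c • conjDer σ D := by
  ext1 u
  simp only [conjDer_apply, Derivation.smul_apply, map_smul]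

theorem conjDer_logDer (τ σ : unip) : conjDer τ (logDer σ) = logDer (τ * σ * τ⁻¹) := by
  ext1 u
  have := logFun_conj τ σ ((τ : PS ≃ₐ[ℂ] PS)⁻¹ u)
  have e : (τ : PS ≃ₐ[ℂ] PS) ((τ : PS ≃ₐ[ℂ] PS)⁻¹ u) = u := (τ : PS ≃ₐ[ℂ] PS).apply_symm_apply u
  rw [e] at this
  rw [conjDer_apply, logDer_apply, logDer_apply, this]

theorem logDer_injective : Function.Injective logDer := fun σ τ h => logK_injective fun u => by
  have h1 : logK σ - logK τ = 0 := derivation_FF_eq_zero fun a => by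
    rw [Derivation.sub_apply, logK_algebraMap, logK_algebraMap, ← logDer_apply, h, logDer_apply,
      sub_self]
  rw [sub_eq_zero.1 h1]

/-- Derivations raising the order by at least `r`. -/
def ordDer (r : ℕ) : Submodule ℂ (Derivation ℂ PS PS) where
  carrier := {D | ∀ j, ∀ u ∈ ordIdeal j, D u ∈ ordIdeal (j + r)}
  zero_mem' := fun _ _ _ => zero_mem _
  add_mem' := fun ha hb j u hu => add_mem (ha j u hu) (hb j u hu)
  smul_mem' := fun c _ ha j u hu => smul_mem_ordIdeal c (ha j u hu)

/-- Split `σ D σ⁻¹ - D` as `(σ - 1) D σ⁻¹ + D (σ⁻¹ - 1)`; each difference gains one order. -/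
theorem conjDer_sub_mem (σ : unip) {r : ℕ} {D : Derivation ℂ PS PS} (hD : D ∈ ordDer r) :
    conjDer σ D - D ∈ ordDer (r + 1) := by
  intro j u hu
  have hv : (σ : PS ≃ₐ[ℂ] PS)⁻¹ u ∈ ordIdeal j := unip_map_mem (unip.inv_mem σ.2) hu
  have h1 := (σ⁻¹).2 j u hu
  rw [Subgroup.coe_inv] at h1
  have e : (conjDer σ D - D) u =
      ((σ : PS ≃ₐ[ℂ] PS) (D ((σ : PS ≃ₐ[ℂ] PS)⁻¹ u)) - D ((σ : PS ≃ₐ[ℂ] PS)⁻¹ u)) +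
        D ((σ : PS ≃ₐ[ℂ] PS)⁻¹ u - u) := by
    rw [Derivation.sub_apply, conjDer_apply, map_sub]
    ring
  rw [e, ← add_assoc]
  refine add_mem (σ.2 _ _ (hD j _ hv)) ?_
  have h2 := hD _ _ h1
  rwa [add_right_comm] at h2

/-- The coefficients of `log η` on the independent generators are fixed by `σ` and `τ`, hence killed
by both generators, hence constant. -/
theorem logDer_mem_span_of_commute {σ τ η : unip} (hw : wedge σ τ ≠ 0) (hστ : Commute σ τ)
    (hσ : Commute σ η) (hτ : Commute τ η) :
    logDer η ∈ Submodule.span ℂ {logDer σ, logDer τ} := by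
  obtain ⟨a, b, h⟩ := exists_eq_add_of_wedge_ne_zero hw η
  obtain ⟨ha₁, hb₁⟩ := coeff_fixed_of_commute hw hσ (Commute.refl σ) hστ h
  obtain ⟨ha₂, hb₂⟩ := coeff_fixed_of_commute hw hτ hστ.symm (Commute.refl τ) h
  rw [act_eq_self_iff] at ha₁ hb₁ ha₂ hb₂
  obtain ⟨c, rfl⟩ := exists_const_of_wedge_ne_zero hw ha₁ ha₂
  obtain ⟨d, rfl⟩ := exists_const_of_wedge_ne_zero hw hb₁ hb₂
  rw [Submodule.mem_span_pair]
  refine ⟨c, d, Derivation.ext fun u => algebraMap_FF_injective ?_⟩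
  have h1 := h (algebraMap PS FF u)
  rw [logK_algebraMap, logK_algebraMap, logK_algebraMap] at h1
  rw [Derivation.add_apply, Derivation.smul_apply, Derivation.smul_apply, logDer_apply,
    logDer_apply, logDer_apply, h1, smul_eq_C_mul, smul_eq_C_mul, map_add, map_mul, map_mul,
    C_eq_algebraMap, C_eq_algebraMap, ← IsScalarTower.algebraMap_apply,
    ← IsScalarTower.algebraMap_apply]

/-- A group generated by elements which conjugate a commuting pair of rank two into its
commutant is metabelian. -/
theorem iterComm_two_of_rank_two {S : Set unip} {σ τ : unip} (hw : wedge σ τ ≠ 0)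
    (hστ : Commute σ τ)
    (hS : ∀ s ∈ S, ∀ x ∈ ({σ, τ} : Set unip), ∀ y ∈ ({σ, τ} : Set unip),
      Commute y (s * x * s⁻¹)) :
    iterComm (Subgroup.closure S) 2 = ⊥ := by
  set W : Submodule ℂ (Derivation ℂ PS PS) := Submodule.span ℂ {logDer σ, logDer τ} with hWdef
  have hσW : logDer σ ∈ W := Submodule.subset_span (by simp)
  have hτW : logDer τ ∈ W := Submodule.subset_span (by simp)
  have : FiniteDimensional ℂ W := FiniteDimensional.span_of_finite ℂ (by simp)
  have hdim : Module.finrank ℂ W ≤ 2 := by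
    classical
    have h1 := finrank_span_finset_le_card (R := ℂ) ({logDer σ, logDer τ} : Finset _)
    have h2 : ({logDer σ, logDer τ} : Finset (Derivation ℂ PS PS)).card ≤ 2 := Finset.card_le_two
    rw [Finset.coe_pair] at h1
    exact h1.trans h2
  have hind : ∀ g : unip, conjDer g (logDer σ) ∈ W → conjDer g (logDer τ) ∈ W →
      ∀ D ∈ W, conjDer g D ∈ W := by
    intro g h1 h2 D hD
    obtain ⟨c, d, rfl⟩ := Submodule.mem_span_pair.1 hD
    rw [conjDer_add, conjDer_smul, conjDer_smul]
    exact W.add_mem (W.smul_mem _ h1) (W.smul_mem _ h2)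
  have hgen : ∀ s ∈ S, ∀ D ∈ W, conjDer (s : unip) D ∈ W := by
    intro s hs
    refine hind s ?_ ?_
    · rw [conjDer_logDer]
      exact logDer_mem_span_of_commute hw hστ (hS s hs σ (by simp) σ (by simp))
        (hS s hs σ (by simp) τ (by simp))
    · rw [conjDer_logDer]
      exact logDer_mem_span_of_commute hw hστ (hS s hs τ (by simp) σ (by simp))
        (hS s hs τ (by simp) τ (by simp))
  have hinv : ∀ g : unip, (∀ D ∈ W, conjDer (g : unip) D ∈ W) →
      ∀ D ∈ W, conjDer (g⁻¹ : unip) D ∈ W := by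
    intro g hg
    refine mem_of_leftInverse (fun D => conjDer (g : unip) D) (fun D D' => conjDer_add _ _ _)
      (fun c D => conjDer_smul _ _ _) (fun D => ?_) hg
    rw [← conjDer_mul, ← Subgroup.coe_mul, inv_mul_cancel, Subgroup.coe_one, conjDer_one]
  have hall : ∀ g ∈ Subgroup.closure S, ∀ D ∈ W, conjDer (g : unip) D ∈ W := by
    intro g hg
    induction hg using Subgroup.closure_induction with
    | mem x hx => exact hgen x hx
    | one => exact fun D hD => hD
    | mul x y hx hy ihx ihy =>
      intro D hD
      rw [Subgroup.coe_mul, conjDer_mul]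
      exact ihx _ (ihy D hD)
    | inv x hx ihx => exact hinv x ihx
  have hcomm : ∀ g ∈ Subgroup.closure S, ∀ h ∈ Subgroup.closure S, ∀ D ∈ W,
      conjDer ((g * h : unip) : PS ≃ₐ[ℂ] PS) D = conjDer ((h * g : unip) : PS ≃ₐ[ℂ] PS) D := by
    intro g hg h hh D hD
    -- On `W` the product `(x - 1)(y - 1)` vanishes, so `x y = x + y - 1`, which is symmetric in `x`
    -- and `y`.
    have key : ∀ x ∈ Subgroup.closure S, ∀ y ∈ Subgroup.closure S,
        conjDer ((x * y : unip) : PS ≃ₐ[ℂ] PS) D =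
          conjDer (x : PS ≃ₐ[ℂ] PS) D + conjDer (y : PS ≃ₐ[ℂ] PS) D - D := by
      intro x hx y hy
      have h0 := mul_eq_zero_of_raise (F := ordDer) (W := W)
        (fun n D hD j u hu => ordIdeal_anti (by omega) (hD j u hu))
        (fun D hD => derivation_eq_zero fun i => eq_zero_of_forall_mem_ordIdeal fun j =>
          ordIdeal_anti (by omega) (hD j 1 (X i) (X_mem_ordIdeal i)))
        hdim (by
          rw [hWdef, Submodule.span_le]
          rintro _ (rfl | rfl)
          · exact fun j u hu => ordIdeal_anti (by omega) (logFun_mem σ hu)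
          · exact fun j u hu => ordIdeal_anti (by omega) (logFun_mem τ hu))
        (T := fun D => conjDer (x : PS ≃ₐ[ℂ] PS) D - D)
        (T' := fun D => conjDer (y : PS ≃ₐ[ℂ] PS) D - D)
        (fun n v hv => conjDer_sub_mem x hv) (fun n v hv => conjDer_sub_mem y hv)
        (fun v hv => W.sub_mem (hall x hx v hv) hv) (fun v hv => W.sub_mem (hall y hy v hv) hv)
        D hD
      simp only [conjDer_sub] at h0
      rw [Subgroup.coe_mul, conjDer_mul, ← sub_eq_zero, ← h0]
      abel
    rw [key g hg h hh, key h hh g hg, add_comm (conjDer (g : PS ≃ₐ[ℂ] PS) D)]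
  have hC : ⁅Subgroup.closure S, Subgroup.closure S⁆ ≤ Subgroup.centralizer {σ, τ} := by
    rw [Subgroup.commutator_le]
    intro g hg h hh
    have h1 : ∀ D ∈ W, conjDer ((⁅g, h⁆ : unip) : PS ≃ₐ[ℂ] PS) D = D := by
      intro D hD
      have h2 := hcomm g hg h hh _ (hall _ (inv_mem (mul_mem hh hg)) D hD)
      rw [← conjDer_mul, ← conjDer_mul, ← Subgroup.coe_mul, ← Subgroup.coe_mul, mul_inv_cancel,
        Subgroup.coe_one, conjDer_one] at h2
      have e : ⁅g, h⁆ = g * h * (h * g)⁻¹ := by rw [commutatorElement_def]; group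
      rw [e]
      exact h2
    rw [Subgroup.mem_centralizer_iff]
    intro x hx
    have h3 : logDer x ∈ W := by
      rcases hx with rfl | rfl
      exacts [hσW, hτW]
    have h4 := h1 _ h3
    rw [conjDer_logDer] at h4
    exact (mul_inv_eq_iff_eq_mul.1 (logDer_injective h4)).symm
  change ⁅⁅Subgroup.closure S, Subgroup.closure S⁆, ⁅Subgroup.closure S, Subgroup.closure S⁆⁆ = ⊥
  rw [Subgroup.commutator_eq_bot_iff_le_centralizer]
  intro x hx
  have hx' := Subgroup.mem_centralizer_iff.1 (hC hx)
  -- A commutator `x` centralizes `σ` and `τ`, so its generator lies in `W`, on which any other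
  -- commutator `y` acts trivially; thus `y` fixes `log x` and commutes with `x`.
  have hxW : logDer x ∈ W := logDer_mem_span_of_commute hw hστ (hx' σ (by simp)) (hx' τ (by simp))
  obtain ⟨c, d, hcd⟩ := Submodule.mem_span_pair.1 hxW
  rw [Subgroup.mem_centralizer_iff]
  intro y hy
  have hy' := Subgroup.mem_centralizer_iff.1 (hC hy)
  have hfix : ∀ z ∈ ({σ, τ} : Set unip), conjDer (y : PS ≃ₐ[ℂ] PS) (logDer z) = logDer z := by
    intro z hz
    rw [conjDer_logDer, ← hy' z hz, mul_inv_cancel_right]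
  have h5 : logDer (y * x * y⁻¹) = logDer x := by
    rw [← conjDer_logDer, ← hcd, conjDer_add, conjDer_smul, conjDer_smul, hfix σ (by simp),
      hfix τ (by simp)]
  exact mul_inv_eq_iff_eq_mul.1 (logDer_injective h5)

end FormalDiffeo

end

/-! ### Rank one: first integrals, and the algebraic theorem on derived length four -/

noncomputable section

namespace FormalDiffeo

open MvPowerSeries
open scoped commutatorElement

/-- The first integrals of a formal diffeomorphism. -/
def firstInt (γ : unip) : Set FF := {u | act γ u = u}

theorem mem_firstInt {γ : unip} {u : FF} : u ∈ firstInt γ ↔ act γ u = u := Iff.rfl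

theorem mem_firstInt_iff_logK {γ : unip} {u : FF} : u ∈ firstInt γ ↔ logK γ u = 0 :=
  act_eq_self_iff γ u

/-- The group of formal diffeomorphisms which preserve a set of fractions. -/
def setStab (k : Set FF) : Subgroup unip where
  carrier := {g | ∀ u, act g u ∈ k ↔ u ∈ k}
  one_mem' := fun u => by rw [map_one, AlgEquiv.one_apply]
  mul_mem' := fun {g h} hg hh u => by rw [act_mul_apply, hg, hh]
  inv_mem' := fun {g} hg u => by rw [← hg, act_apply_inv]

/-- The group of formal diffeomorphisms which fix every element of a set of fractions. -/
def fixer (k : Set FF) : Subgroup unip where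
  carrier := {g | ∀ u ∈ k, act g u = u}
  one_mem' := fun u _ => by rw [map_one, AlgEquiv.one_apply]
  mul_mem' := fun {g h} hg hh u hu => by rw [act_mul_apply, hh u hu, hg u hu]
  inv_mem' := fun {g} hg u hu => by
    conv_lhs => rw [← hg u hu]
    exact act_inv_apply g u

theorem conj_mem_fixer {k : Set FF} {g : unip} (hg : g ∈ setStab k) {x : unip}
    (hx : x ∈ fixer k) : g * x * g⁻¹ ∈ fixer k := fun u hu => by
  rw [act_mul_apply, act_mul_apply, hx _ (((setStab k).inv_mem hg u).2 hu), act_apply_inv]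

theorem commutator_mem_fixer_iff {k : Set FF} {g h : unip} (hg : g ∈ setStab k)
    (hh : h ∈ setStab k) :
    ⁅g, h⁆ ∈ fixer k ↔ ∀ u ∈ k, act g (act h u) = act h (act g u) := by
  constructor
  · intro hc u hu
    have h1 := hc (act h (act g u)) ((hh _).2 ((hg u).2 hu))
    have e : ⁅g, h⁆ * (h * g) = g * h := by rw [commutatorElement_def]; group
    rw [← act_mul_apply h g, ← act_mul_apply ⁅g, h⁆ (h * g), e, act_mul_apply] at h1
    rw [h1, act_mul_apply]
  · intro hc u hu
    have e : ⁅g, h⁆ = g * h * (h * g)⁻¹ := by rw [commutatorElement_def]; group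
    have h1 := hc (act (h * g)⁻¹ u) (((setStab k).inv_mem ((setStab k).mul_mem hh hg) u).2 hu)
    rw [← act_mul_apply h g, act_apply_inv] at h1
    rw [e, act_mul_apply, act_mul_apply, h1]

/-- Elements that conjugate the generator of `γ`, restricted to `k`, to a multiple of itself with
factor fixed by the group. -/
theorem scaling_closure {k₀ k : Set FF} {S : Set unip} {γ : unip} (hc0 : (1 : FF) ∈ k₀)
    (hcmul : ∀ a ∈ k₀, ∀ b ∈ k₀, a * b ∈ k₀) (hcinv : ∀ a ∈ k₀, a⁻¹ ∈ k₀)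
    (hΓ₀ : Subgroup.closure S ≤ setStab k₀) (hΓ : Subgroup.closure S ≤ setStab k)
    (hS : ∀ s ∈ S, ∃ c ∈ k₀, c ≠ 0 ∧ ∀ u ∈ k, act s (logK γ u) = c * logK γ (act s u)) :
    ∀ g ∈ Subgroup.closure S,
      ∃ c ∈ k₀, c ≠ 0 ∧ ∀ u ∈ k, act g (logK γ u) = c * logK γ (act g u) := by
  intro g hg
  induction hg using Subgroup.closure_induction with
  | mem x hx => exact hS x hx
  | one => exact ⟨1, hc0, one_ne_zero, fun u _ => by simp⟩
  | mul x y hx hy ihx ihy =>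
    obtain ⟨a, ha, ha0, hxa⟩ := ihx
    obtain ⟨b, hb, hb0, hyb⟩ := ihy
    refine ⟨act x b * a, hcmul _ ((hΓ₀ hx b).2 hb) _ ha, mul_ne_zero (act_ne_zero x hb0) ha0,
      fun u hu => ?_⟩
    rw [act_mul_apply, act_mul_apply, hyb u hu, map_mul, hxa _ ((hΓ hy u).2 hu), mul_assoc]
  | inv x hx ihx =>
    obtain ⟨a, ha, ha0, hxa⟩ := ihx
    refine ⟨(act x⁻¹ a)⁻¹, hcinv _ ((hΓ₀ (inv_mem hx) a).2 ha), inv_ne_zero (act_ne_zero _ ha0),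
      fun u hu => ?_⟩
    have h1 := congrArg (act x⁻¹) (hxa (act x⁻¹ u) ((hΓ (inv_mem hx) u).2 hu))
    rw [act_inv_apply, act_apply_inv, map_mul] at h1
    rw [h1, inv_mul_cancel_left₀ (act_ne_zero _ ha0)]

/-- Commutators of elements scaling a generator by invariant factors commute with it. -/
theorem commutator_commutes_of_scaling {k : Set FF} {g h γ : unip} (hg : g ∈ setStab k)
    (hh : h ∈ setStab k) {a b : FF} (ha0 : a ≠ 0) (hb0 : b ≠ 0)
    (hga : act g a = a) (hgb : act g b = b) (hha : act h a = a) (hhb : act h b = b)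
    (ha : ∀ u ∈ k, act g (logK γ u) = a * logK γ (act g u))
    (hb : ∀ u ∈ k, act h (logK γ u) = b * logK γ (act h u)) :
    ∀ u ∈ k, act ⁅g, h⁆ (logK γ u) = logK γ (act ⁅g, h⁆ u) := by
  intro u hu
  have hw := ((setStab k).inv_mem ((setStab k).mul_mem hh hg) u).2 hu
  have e : ⁅g, h⁆ * (h * g) = g * h := by rw [commutatorElement_def]; group
  set w := act (h * g)⁻¹ u with hwdef
  have hu' : u = act (h * g) w := by rw [hwdef, act_apply_inv]
  -- As `a` and `b` are fixed by both `g` and `h`, the products `g h` and `h g` scale the generator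
  -- by the same factor `a b`, which cancels in the commutator.
  have h1 : act (g * h) (logK γ w) = a * b * logK γ (act (g * h) w) := by
    rw [act_mul_apply, hb w hw, map_mul, hgb, ha _ ((hh w).2 hw), act_mul_apply]
    ring
  have h2 : act (h * g) (logK γ w) = a * b * logK γ u := by
    rw [act_mul_apply, ha w hw, map_mul, hha, hb _ ((hg w).2 hw), hu', act_mul_apply]
    ring
  have h3 := congrArg (act ⁅g, h⁆) h2
  have fg : ∀ x, act g x = x → act g⁻¹ x = x := fun x hx => by
    conv_lhs => rw [← hx]
    exact act_inv_apply g x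
  have fh : ∀ x, act h x = x → act h⁻¹ x = x := fun x hx => by
    conv_lhs => rw [← hx]
    exact act_inv_apply h x
  have hfix : ∀ x, act g x = x → act h x = x → act ⁅g, h⁆ x = x := fun x hx hx' => by
    rw [commutatorElement_def, act_mul_apply, act_mul_apply, act_mul_apply, fh x hx', fg x hx, hx',
      hx]
  rw [← act_mul_apply ⁅g, h⁆ (h * g), e, h1, map_mul (act ⁅g, h⁆), map_mul (act ⁅g, h⁆),
    hfix a hga hha, hfix b hgb hhb] at h3
  rw [hu', ← act_mul_apply ⁅g, h⁆ (h * g), e, ← hu']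
  exact (mul_left_cancel₀ (mul_ne_zero ha0 hb0) h3).symm

theorem firstInt_stab {γ : unip} {s : unip} {c : FF} (hc : c ≠ 0)
    (h : ∀ u, act s (logK γ u) = c * logK γ (act s u)) : s ∈ setStab (firstInt γ) := by
  intro u
  rw [mem_firstInt_iff_logK, mem_firstInt_iff_logK]
  constructor
  · intro h1
    have h2 := h u
    rw [h1, mul_zero] at h2
    by_contra h3
    exact act_ne_zero s h3 h2
  · intro h1
    have h2 := h u
    rw [h1, map_zero] at h2
    exact (mul_eq_zero.1 h2.symm).resolve_left hc

section RankOne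

variable {S : Set unip} {γ : unip}

/-- A subgroup preserving the direction of a generator: the part acting trivially on first
integrals is metabelian. -/
theorem iterComm_two_inf_fixer (hsc : ∀ g ∈ Subgroup.closure S,
      ∃ c ∈ firstInt γ, c ≠ 0 ∧ ∀ u, act g (logK γ u) = c * logK γ (act g u)) :
    iterComm (Subgroup.closure S ⊓ fixer (firstInt γ)) 2 = ⊥ := by
  set Γ₁ := Subgroup.closure S ⊓ fixer (firstInt γ) with hΓ₁
  have h1 : ⁅Γ₁, Γ₁⁆ ≤ fixer (firstInt γ) ⊓ Subgroup.centralizer {γ} := by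
    refine le_inf ((iterComm_le Γ₁ 1).trans inf_le_right) ?_
    rw [Subgroup.commutator_le]
    intro g hg h hh
    obtain ⟨a, ha, ha0, hga⟩ := hsc g hg.1
    obtain ⟨b, hb, hb0, hhb⟩ := hsc h hh.1
    have h2 := commutator_commutes_of_scaling (k := Set.univ) (g := g) (h := h) (γ := γ)
      (fun u => by simp) (fun u => by simp) ha0 hb0 (hg.2 a ha) (hg.2 b hb) (hh.2 a ha)
      (hh.2 b hb) (fun u _ => hga u) (fun u _ => hhb u)
    rw [Subgroup.mem_centralizer_singleton_iff]
    exact (commute_of_logK fun u => h2 u trivial).eq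
  change ⁅⁅Γ₁, Γ₁⁆, ⁅Γ₁, Γ₁⁆⁆ = ⊥
  rw [Subgroup.commutator_eq_bot_iff_le_centralizer]
  intro x hx
  rw [Subgroup.mem_centralizer_iff]
  intro y hy
  obtain ⟨hx₁, hx₂⟩ := h1 hx
  obtain ⟨hy₁, hy₂⟩ := h1 hy
  have hxγ : Commute x γ := Subgroup.mem_centralizer_singleton_iff.1 hx₂
  have hyγ : Commute y γ := Subgroup.mem_centralizer_singleton_iff.1 hy₂
  by_cases hγ : γ = 1
  · have : ∀ z ∈ fixer (firstInt γ), z = 1 := fun z hz => act_injective (AlgEquiv.ext fun u => by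
      rw [hz u (by rw [mem_firstInt, hγ, map_one, AlgEquiv.one_apply]), map_one,
        AlgEquiv.one_apply])
    rw [this x hx₁, this y hy₁]
  -- If `log x` is a multiple of `log γ`, the coefficient is a first integral, fixed by `y`, so `y`
  -- commutes with `x`. Otherwise `log y` is a combination of `log γ` and `log x` whose coefficients
  -- are first integrals, fixed by `x`.
  by_cases hw : wedge γ x = 0
  · obtain ⟨a, ha⟩ := exists_eq_mul_of_wedge_eq_zero hγ hw
    have haγ : a ∈ firstInt γ := by
      obtain ⟨u, hu⟩ := exists_logK_ne_zero hγ
      have h2 := congrArg (act γ) (ha u)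
      rw [logK_comm hxγ.symm, ha, map_mul, logK_comm (Commute.refl γ)] at h2
      have h3 : logK γ (act γ u) ≠ 0 := by
        rw [← logK_comm (Commute.refl γ)]
        exact act_ne_zero γ hu
      exact (mul_right_cancel₀ h3 h2).symm
    exact commute_of_logK fun u => by rw [ha, map_mul, hy₁ a haγ, logK_comm hyγ, ha]
  · obtain ⟨a, b, hab⟩ := exists_eq_add_of_wedge_ne_zero hw y
    obtain ⟨ha, hb⟩ := coeff_fixed_of_commute hw hyγ.symm (Commute.refl γ) hxγ.symm hab
    refine Eq.symm (commute_of_logK fun u => ?_)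
    rw [hab, map_add, map_mul, map_mul, hx₁ a ha, hx₁ b hb, logK_comm hxγ,
      logK_comm (Commute.refl x), hab]

/-- Generators on first integrals: an element commuting on `firstInt γ` with `η`, which moves some
first integral, has a generator there that is a constant multiple of that of `η`. -/
theorem exists_const_mul_on_firstInt (hγ : γ ≠ 1) {η δ : unip} (hη : η ∈ setStab (firstInt γ))
    (hδ : δ ∈ setStab (firstInt γ)) (hne : η ∉ fixer (firstInt γ))
    (hc : ∀ u ∈ firstInt γ, act η (act δ u) = act δ (act η u)) :
    ∃ c : ℂ, ∀ u ∈ firstInt γ, logK δ u = algebraMap ℂ FF c * logK η u := by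
  obtain ⟨u₀, hu₀, hne₀⟩ : ∃ u ∈ firstInt γ, logK η u ≠ 0 := by
    by_contra! hcon
    exact hne fun u hu => (act_eq_self_iff η u).2 (hcon u hu)
  have hγη : wedge γ η ≠ 0 := fun h => by
    obtain ⟨a, ha⟩ := exists_eq_mul_of_wedge_eq_zero hγ h
    rw [ha, mem_firstInt_iff_logK.1 hu₀, mul_zero] at hne₀
    exact hne₀ rfl
  have hlog : ∀ x ∈ setStab (firstInt γ), ∀ u ∈ firstInt γ, logK x u ∈ firstInt γ :=
    fun x hx u hu => logK_mem_fixed (fun v hv => (hx v).2 hv) u hu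
  -- On first integrals the `log γ` term disappears and `log δ = v log η`. The factor `v` is fixed
  -- by `γ` and by `η`, whose generators are independent, so it is a constant.
  obtain ⟨a, v, hav⟩ := exists_eq_add_of_wedge_ne_zero hγη δ
  have hv : ∀ u ∈ firstInt γ, logK δ u = v * logK η u := fun u hu => by
    rw [hav, mem_firstInt_iff_logK.1 hu, mul_zero, zero_add]
  have hvγ : act γ v = v := by
    have h1 := hlog δ hδ u₀ hu₀
    rw [mem_firstInt, hv u₀ hu₀, map_mul, hlog η hη u₀ hu₀] at h1
    exact mul_right_cancel₀ hne₀ h1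
  have hvη : act η v = v := by
    have hst := (setStab (firstInt γ)).mul_mem ((setStab (firstInt γ)).mul_mem hη hδ)
      ((setStab (firstInt γ)).inv_mem hη)
    have h1 : ∀ u ∈ firstInt γ, logK (η * δ * η⁻¹) u = logK δ u :=
      logK_eq_of_act (fun u hu => (hst u).2 hu) fun u hu => by
        rw [act_mul_apply, act_mul_apply, hc _ (((setStab (firstInt γ)).inv_mem hη u).2 hu),
          act_apply_inv]
    have hηu := (hη u₀).2 hu₀
    have h2 := logK_conj η δ u₀
    rw [h1 _ hηu, hv _ hηu, hv _ hu₀, map_mul, logK_comm (Commute.refl η)] at h2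
    have h3 : logK η (act η u₀) ≠ 0 := by
      rw [← logK_comm (Commute.refl η)]
      exact act_ne_zero η hne₀
    exact (mul_right_cancel₀ h3 h2).symm
  obtain ⟨c, rfl⟩ := exists_const_of_wedge_ne_zero hγη ((act_eq_self_iff _ _).1 hvγ)
    ((act_eq_self_iff _ _).1 hvη)
  exact ⟨c, hv⟩

/-- If some element `η` moves a first integral of `γ` and its conjugates by the generators commute
with it on first integrals, then the action on first integrals is metabelian. -/
theorem iterComm_two_le_fixer (hγ : γ ≠ 1) (hΓ : Subgroup.closure S ≤ setStab (firstInt γ))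
    {η : unip} (hη : η ∈ setStab (firstInt γ)) (hne : η ∉ fixer (firstInt γ))
    (hS : ∀ s ∈ S, ⁅η, s * η * s⁻¹⁆ ∈ fixer (firstInt γ)) :
    iterComm (Subgroup.closure S) 2 ≤ fixer (firstInt γ) := by
  have hlog : ∀ x ∈ setStab (firstInt γ), ∀ u ∈ firstInt γ, logK x u ∈ firstInt γ :=
    fun x hx u hu => logK_mem_fixed (fun v hv => (hx v).2 hv) u hu
  have hconst : ∀ (g : unip) (c : ℂ), act g (algebraMap ℂ FF c) = algebraMap ℂ FF c :=
    fun g c => (act g).commutes c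
  have hsc : ∀ g ∈ Subgroup.closure S, ∃ c ∈ Set.range (algebraMap ℂ FF), c ≠ 0 ∧
      ∀ u ∈ firstInt γ, act g (logK η u) = c * logK η (act g u) := by
    refine scaling_closure ⟨1, map_one _⟩ ?_ ?_ ?_ hΓ ?_
    · rintro _ ⟨a, rfl⟩ _ ⟨b, rfl⟩
      exact ⟨a * b, map_mul _ _ _⟩
    · rintro _ ⟨a, rfl⟩
      exact ⟨a⁻¹, map_inv₀ _ _⟩
    · intro g _ u
      constructor
      · rintro ⟨c, hc⟩
        refine ⟨c, ?_⟩
        rw [← act_inv_apply g u, ← hc, hconst]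
      · rintro ⟨c, rfl⟩
        exact ⟨c, (hconst g c).symm⟩
    · intro s hs
      have hsΓ := hΓ (Subgroup.subset_closure hs)
      have hst := (setStab (firstInt γ)).mul_mem ((setStab (firstInt γ)).mul_mem hsΓ hη)
        ((setStab (firstInt γ)).inv_mem hsΓ)
      obtain ⟨c, hc⟩ := exists_const_mul_on_firstInt hγ hη hst hne
        ((commutator_mem_fixer_iff hη hst).1 (hS s hs))
      have key : ∀ u ∈ firstInt γ, act s (logK η u) = algebraMap ℂ FF c * logK η (act s u) :=
        fun u hu => by rw [← logK_conj, hc _ ((hsΓ u).2 hu)]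
      refine ⟨_, ⟨c, rfl⟩, fun h0 => hne fun u hu => ?_, key⟩
      rw [act_eq_self_iff]
      have h1 := key u hu
      rw [h0, zero_mul] at h1
      by_contra h2
      exact act_ne_zero s h2 h1
  -- On first integrals the group scales `log η` by constants, so commutators preserve it.
  have hD : ∀ g ∈ ⁅Subgroup.closure S, Subgroup.closure S⁆, ∀ u ∈ firstInt γ,
      act g (logK η u) = logK η (act g u) := by
    let C : Subgroup unip :=
      { carrier := {g | g ∈ setStab (firstInt γ) ∧
          ∀ u ∈ firstInt γ, act g (logK η u) = logK η (act g u)}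
        one_mem' := ⟨one_mem _, fun u _ => by simp⟩
        mul_mem' := fun {x y} hx hy => ⟨mul_mem hx.1 hy.1, fun u hu => by
          rw [act_mul_apply, hy.2 u hu, hx.2 _ ((hy.1 u).2 hu), act_mul_apply]⟩
        inv_mem' := fun {x} hx => ⟨inv_mem hx.1, fun u hu => by
          have h1 := hx.2 _ (((setStab (firstInt γ)).inv_mem hx.1 u).2 hu)
          rw [act_apply_inv] at h1
          rw [← h1, act_inv_apply]⟩ }
    have hC : ⁅Subgroup.closure S, Subgroup.closure S⁆ ≤ C := by
      rw [Subgroup.commutator_le]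
      intro g hg h hh
      obtain ⟨_, ⟨a, rfl⟩, ha0, hga⟩ := hsc g hg
      obtain ⟨_, ⟨b, rfl⟩, hb0, hhb⟩ := hsc h hh
      have hst := hΓ ((iterComm_le (Subgroup.closure S) 1) (Subgroup.commutator_mem_commutator hg hh))
      exact ⟨hst, commutator_commutes_of_scaling (hΓ hg) (hΓ hh) ha0 hb0 (hconst g a) (hconst g b)
        (hconst h a) (hconst h b) hga hhb⟩
    exact fun g hg => (hC hg).2
  change ⁅⁅Subgroup.closure S, Subgroup.closure S⁆, ⁅Subgroup.closure S, Subgroup.closure S⁆⁆ ≤ _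
  rw [Subgroup.commutator_le]
  intro x hx y hy
  have hxs := hΓ ((iterComm_le (Subgroup.closure S) 1) hx)
  have hys := hΓ ((iterComm_le (Subgroup.closure S) 1) hy)
  rw [commutator_mem_fixer_iff hxs hys]
  have hcy : ∀ u ∈ firstInt γ, act η (act y u) = act y (act η u) := by
    have hst := (setStab (firstInt γ)).mul_mem ((setStab (firstInt γ)).mul_mem hys hη)
      ((setStab (firstInt γ)).inv_mem hys)
    have h1 : ∀ u ∈ firstInt γ, act (y * η * y⁻¹) u = act η u :=
      act_eq_of_logK (hlog _ hst) fun u hu => by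
        have hu' := ((setStab (firstInt γ)).inv_mem hys u).2 hu
        have h2 := logK_conj y η (act y⁻¹ u)
        rw [hD y hy _ hu', act_apply_inv] at h2
        exact h2
    intro u hu
    rw [← h1 _ ((hys u).2 hu), act_mul_apply, act_mul_apply, act_inv_apply]
  -- On first integrals `log y` is a constant multiple of `log η`, which `x` preserves; so
  -- conjugating `y` by `x` does not change its action there.
  obtain ⟨c, hc⟩ := exists_const_mul_on_firstInt hγ hη hys hne hcy
  have hst := (setStab (firstInt γ)).mul_mem ((setStab (firstInt γ)).mul_mem hxs hys)
    ((setStab (firstInt γ)).inv_mem hxs)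
  have h1 : ∀ u ∈ firstInt γ, act (x * y * x⁻¹) u = act y u :=
    act_eq_of_logK (hlog _ hst) fun u hu => by
      have hu' := ((setStab (firstInt γ)).inv_mem hxs u).2 hu
      have h2 := logK_conj x y (act x⁻¹ u)
      rw [hc _ hu', map_mul, hconst, hD x hx _ hu', act_apply_inv, ← hc u hu] at h2
      exact h2
  intro u hu
  rw [← h1 _ ((hxs u).2 hu), act_mul_apply, act_mul_apply, act_inv_apply]

end RankOne

/-- If the conjugated commutators of elements of `S` generate a group of derived length at most
four, then so does `S`. -/
theorem iterComm_four_closure (S : Set unip)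
    (h : iterComm (Subgroup.closure (conjComm S 8)) 4 = ⊥) :
    iterComm (Subgroup.closure S) 4 = ⊥ := by
  have hbot : ∀ n m, iterComm (Subgroup.closure S) n = ⊥ → n ≤ m →
      iterComm (Subgroup.closure S) m = ⊥ := by
    intro n m hn hnm
    obtain ⟨j, rfl⟩ := Nat.exists_eq_add_of_le hnm
    rw [iterComm_add, hn]
    exact le_bot_iff.1 (iterComm_le _ _)
  have hmono := closure_conjComm_mono S
  by_cases h0 : Subgroup.closure (conjComm S 0) ≤ ⊥
  · refine hbot 1 4 (le_bot_iff.1 ?_) (by norm_num)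
    refine commutator_closure_le (fun g _ x hx => ?_) fun s hs t ht =>
      h0 (Subgroup.subset_closure ⟨s, hs, t, ht, rfl⟩)
    rw [Subgroup.mem_bot] at hx ⊢
    rw [hx, mul_one, mul_inv_cancel]
  obtain ⟨i, j, hij, hij'⟩ := exists_stable_iterComm
    (H := fun n => Subgroup.closure (conjComm S n)) h0 h.le
  set A : ℕ → Subgroup unip := fun n => iterComm (Subgroup.closure (conjComm S n)) j with hA
  have hAmono : ∀ {m n}, m ≤ n → A m ≤ A n := fun hmn => iterComm_mono (hmono hmn) j
  have hAconj : ∀ s ∈ S, ∀ n, ∀ x ∈ A n, s * x * s⁻¹ ∈ A (n + 1) := fun s hs n x hx =>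
    conj_mem_iterComm (conj_mem_closure_conjComm hs n) j x hx
  have hAcomm : ∀ x ∈ A (i + 2), ∀ y ∈ A (i + 2), Commute x y := fun x hx y hy => by
    have := hij' (Subgroup.commutator_mem_commutator hx hy)
    exact commutatorElement_eq_one_iff_commute.1 (Subgroup.mem_bot.1 this)
  -- `A (i + 1)` is abelian, being contained in `A (i + 2)`; the question is whether its generators
  -- span a plane or at most a line over the fraction field.
  by_cases hrank : ∃ σ ∈ A (i + 1), ∃ τ ∈ A (i + 1), wedge σ τ ≠ 0
  · obtain ⟨σ, hσ, τ, hτ, hw⟩ := hrank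
    have hle : A (i + 1) ≤ A (i + 2) := hAmono (Nat.le_succ _)
    refine hbot 2 4 (iterComm_two_of_rank_two hw (hAcomm σ (hle hσ) τ (hle hτ)) ?_) (by norm_num)
    have hmem : ∀ x ∈ ({σ, τ} : Set unip), x ∈ A (i + 1) := by
      rintro x (rfl | rfl)
      exacts [hσ, hτ]
    exact fun s hs x hx y hy => hAcomm y (hle (hmem y hy)) _ (hAconj s hs _ x (hmem x hx))
  · push Not at hrank
    -- Choosing `γ` in `A i` leaves its conjugates by `S` in `A (i + 1)`, where generators are
    -- pairwise dependent.
    obtain ⟨γ, hγ, hγ1⟩ : ∃ γ ∈ A i, γ ≠ 1 := by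
      by_contra! hcon
      exact hij fun x hx => Subgroup.mem_bot.2 (hcon x hx)
    have hγ' : γ ∈ A (i + 1) := hAmono (Nat.le_succ i) hγ
    have hS : ∀ s ∈ S, ∃ c ∈ firstInt γ, c ≠ 0 ∧
        ∀ u ∈ Set.univ, act s (logK γ u) = c * logK γ (act s u) := by
      intro s hs
      have hs' := hAconj s hs i γ hγ
      obtain ⟨c, hc⟩ := exists_eq_mul_of_wedge_eq_zero hγ1 (hrank γ hγ' _ hs')
      have hcomm : Commute γ (s * γ * s⁻¹) :=
        hAcomm _ (hAmono (by omega) hγ) _ (hAmono (Nat.le_succ _) hs')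
      have key : ∀ u, act s (logK γ u) = c * logK γ (act s u) := fun u => by
        rw [← logK_conj, hc]
      obtain ⟨u, hu⟩ := exists_logK_ne_zero hγ1
      refine ⟨c, ?_, fun h0 => ?_, fun u _ => key u⟩
      · have h2 := congrArg (act γ) (hc u)
        rw [logK_comm hcomm, hc, map_mul, logK_comm (Commute.refl γ)] at h2
        have h3 : logK γ (act γ u) ≠ 0 := by
          rw [← logK_comm (Commute.refl γ)]
          exact act_ne_zero γ hu
        exact (mul_right_cancel₀ h3 h2).symm
      · have h1 := key u
        rw [h0, zero_mul] at h1
        exact act_ne_zero s hu h1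
    have hΓ : Subgroup.closure S ≤ setStab (firstInt γ) := by
      rw [Subgroup.closure_le]
      intro s hs
      obtain ⟨c, -, hc0, hc⟩ := hS s hs
      exact firstInt_stab hc0 fun u => hc u trivial
    have hsc := scaling_closure (k₀ := firstInt γ) (k := Set.univ) (map_one (act γ))
      (fun a ha b hb => by rw [mem_firstInt, map_mul, ha, hb])
      (fun a ha => by rw [mem_firstInt, map_inv₀, ha]) hΓ (fun g _ u => by simp) hS
    have h1 : iterComm (Subgroup.closure S ⊓ fixer (firstInt γ)) 2 = ⊥ :=
      iterComm_two_inf_fixer fun g hg => by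
        obtain ⟨c, hc, hc0, hcu⟩ := hsc g hg
        exact ⟨c, hc, hc0, fun u => hcu u trivial⟩
    -- The pigeonhole is repeated modulo the elements acting trivially on first integrals. Either
    -- the commutators of `S` already act trivially, or some `η` moves a first integral while
    -- commuting there with its conjugates by `S`.
    have h2 : iterComm (Subgroup.closure S) 2 ≤ fixer (firstInt γ) := by
      by_cases hfix : Subgroup.closure (conjComm S 0) ≤ fixer (firstInt γ)
      · have h3 : iterComm (Subgroup.closure S) 1 ≤ fixer (firstInt γ) :=
          commutator_closure_le (fun g hg x hx => conj_mem_fixer (hΓ hg) hx)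
            fun s hs t ht => hfix (Subgroup.subset_closure ⟨s, hs, t, ht, rfl⟩)
        exact (iterComm_add _ 1 1).le.trans ((iterComm_le _ _).trans h3)
      · obtain ⟨p, q, hpq, hpq'⟩ := exists_stable_iterComm
          (H := fun n => Subgroup.closure (conjComm S n)) hfix (h.le.trans bot_le)
        obtain ⟨η, hη, hη1⟩ := SetLike.not_le_iff_exists.1 hpq
        have hηΓ : η ∈ Subgroup.closure S :=
          (Subgroup.closure_le _).2 (conjComm_subset_closure S p) (iterComm_le _ _ hη)
        refine iterComm_two_le_fixer hγ1 hΓ (hΓ hηΓ) hη1 fun s hs => hpq' ?_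
        have h4 := conj_mem_iterComm (conj_mem_closure_conjComm hs p) q η hη
        exact Subgroup.commutator_mem_commutator
          (iterComm_mono (hmono (by omega : p ≤ p + 2)) q hη)
          (iterComm_mono (hmono (by omega : p + 1 ≤ p + 2)) q h4)
    have h3 : iterComm (Subgroup.closure S) 2 ≤ Subgroup.closure S ⊓ fixer (firstInt γ) :=
      le_inf (iterComm_le _ _) h2
    exact le_bot_iff.1 ((iterComm_add _ 2 2).le.trans ((iterComm_mono h3 2).trans h1.le))

end FormalDiffeo

end

/-! ### Taylor series of holomorphic functions on `ℂ²` -/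

noncomputable section

namespace FormalDiffeo

open MvPowerSeries Asymptotics

/-- The space on which the germs live. -/
abbrev C2 := EuclideanSpace ℂ (Fin 2)

/-- The value of a polynomial at a point of `ℂ²`. -/
def pEval (P : MvPolynomial (Fin 2) ℂ) (x : C2) : ℂ := MvPolynomial.eval (fun i => x i) P

theorem continuous_pEval (P : MvPolynomial (Fin 2) ℂ) : Continuous (pEval P) := by
  have := MvPolynomial.continuous_eval P
  exact this.comp (by fun_prop)

theorem isBigO_norm_pow_of_le {i j : ℕ} (h : i ≤ j) :
    (fun x : C2 => ‖x‖ ^ j) =O[𝓝 0] (fun x : C2 => ‖x‖ ^ i) := by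
  refine IsBigO.of_bound 1 ?_
  filter_upwards [Metric.ball_mem_nhds (0 : C2) one_pos] with x hx
  rw [mem_ball_zero_iff] at hx
  rw [one_mul, norm_pow, norm_pow, norm_norm]
  exact pow_le_pow_of_le_one (norm_nonneg x) hx.le h

theorem isBigO_one_of_continuousAt {u : C2 → ℂ} (hu : ContinuousAt u 0) :
    u =O[𝓝 0] (fun x : C2 => ‖x‖ ^ 0) := by
  simp only [pow_zero]
  exact hu.isBigO_one ℝ

theorem isBigO_coord (i : Fin 2) : (fun x : C2 => x i) =O[𝓝 0] (fun x : C2 => ‖x‖) :=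
  IsBigO.of_bound 1 (Eventually.of_forall fun x => by
    rw [one_mul, norm_norm]
    exact PiLp.norm_apply_le x i)

/-- A polynomial without terms of degree less than `j` is `O(‖x‖ ^ j)`. -/
theorem isBigO_pEval {P : MvPolynomial (Fin 2) ℂ} {j : ℕ} (h : (P : PS) ∈ ordIdeal j) :
    pEval P =O[𝓝 0] (fun x : C2 => ‖x‖ ^ j) := by
  have e : pEval P = fun x : C2 => ∑ d ∈ P.support, P.coeff d * ∏ i, x i ^ d i := by
    funext x
    exact MvPolynomial.eval_eq' _ _
  rw [e]
  refine IsBigO.fun_sum fun d hd => IsBigO.const_mul_left ?_ _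
  have hj : j ≤ d.degree := by
    by_contra hlt
    have := h d (not_le.1 hlt)
    rw [MvPolynomial.coeff_coe] at this
    exact MvPolynomial.mem_support_iff.1 hd this
  refine IsBigO.trans ?_ (isBigO_norm_pow_of_le hj)
  rw [degree_fin_two]
  simp only [Fin.prod_univ_two, pow_add]
  exact ((isBigO_coord 0).pow _).mul ((isBigO_coord 1).pow _)

/-- A homogeneous function of degree `j` which is `O(‖x‖ ^ (j + 1))` vanishes. -/
theorem eq_zero_of_homogeneous {f : C2 → ℂ} {j : ℕ} (hf : ∀ (t : ℂ) x, f (t • x) = t ^ j * f x)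
    (h : f =O[𝓝 0] (fun x : C2 => ‖x‖ ^ (j + 1))) (x : C2) : f x = 0 := by
  have ht : Tendsto (fun t : ℂ => t • x) (𝓝[≠] 0) (𝓝 0) := by
    have : Tendsto (fun t : ℂ => t • x) (𝓝 0) (𝓝 ((0 : ℂ) • x)) :=
      tendsto_id.smul_const x
    rw [zero_smul] at this
    exact this.mono_left nhdsWithin_le_nhds
  have h1 := h.comp_tendsto ht
  have h2 : (fun _ : ℂ => f x) =O[𝓝[≠] 0] (fun t : ℂ => t * (‖x‖ ^ (j + 1) : ℝ)) := by
    obtain ⟨c, hc⟩ := h1.bound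
    refine IsBigO.of_bound c ?_
    filter_upwards [hc, self_mem_nhdsWithin] with t h3 h4
    have h5 : 0 < ‖t‖ ^ j := pow_pos (norm_pos_iff.2 h4) _
    simp only [Function.comp, hf, norm_mul, norm_pow, norm_smul, norm_norm, mul_pow] at h3
    simp only [norm_mul, Complex.norm_real, norm_pow, norm_norm]
    refine le_of_mul_le_mul_left (h3.trans_eq ?_) h5
    ring
  have h6 : Tendsto (fun t : ℂ => t * (‖x‖ ^ (j + 1) : ℝ)) (𝓝[≠] 0) (𝓝 0) := by
    have : Tendsto (fun t : ℂ => t * (‖x‖ ^ (j + 1) : ℝ)) (𝓝 0) (𝓝 (0 * (‖x‖ ^ (j + 1) : ℝ))) :=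
      tendsto_id.mul_const _
    rw [zero_mul] at this
    exact this.mono_left nhdsWithin_le_nhds
  exact tendsto_nhds_unique tendsto_const_nhds (h2.trans_tendsto h6)

/-- A polynomial which is `O(‖x‖ ^ j)` has no terms of degree less than `j`. -/
theorem mem_ordIdeal_of_isBigO {P : MvPolynomial (Fin 2) ℂ} {j : ℕ}
    (h : pEval P =O[𝓝 0] (fun x : C2 => ‖x‖ ^ j)) : (P : PS) ∈ ordIdeal j := by
  induction j with
  | zero => exact ordIdeal_zero _
  | succ j ih =>
    -- Only the homogeneous component of degree `j` remains to be removed; it is `O(‖x‖ ^ (j + 1))`,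
    -- and scaling forces it to vanish.
    have hj := ih (h.trans (isBigO_norm_pow_of_le (Nat.le_succ j)))
    set H := MvPolynomial.homogeneousComponent j P with hH
    have hHc : ∀ d, H.coeff d = if d.degree = j then P.coeff d else 0 := fun d =>
      MvPolynomial.coeff_homogeneousComponent _ _ _
    have hrest : ((P - H : MvPolynomial (Fin 2) ℂ) : PS) ∈ ordIdeal (j + 1) := by
      intro d hd
      rw [MvPolynomial.coeff_coe, MvPolynomial.coeff_sub, hHc]
      split_ifs with hdj
      · exact sub_self _
      · rw [sub_zero, ← MvPolynomial.coeff_coe]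
        exact hj d (by omega)
    have hHO : pEval H =O[𝓝 0] (fun x : C2 => ‖x‖ ^ (j + 1)) := by
      have := h.sub (isBigO_pEval hrest)
      refine this.congr_left fun x => ?_
      simp [pEval]
    have hhom : ∀ (t : ℂ) (x : C2), pEval H (t • x) = t ^ j * pEval H x := by
      intro t x
      simp only [pEval, MvPolynomial.eval_eq', PiLp.smul_apply, smul_eq_mul, mul_pow,
        Finset.prod_mul_distrib, Finset.mul_sum]
      refine Finset.sum_congr rfl fun d hd => ?_
      have hdj : d.degree = j := by
        by_contra hne
        rw [MvPolynomial.mem_support_iff, hHc, if_neg hne] at hd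
        exact hd rfl
      rw [← hdj, degree_fin_two, Fin.prod_univ_two, Fin.prod_univ_two]
      ring
    have hH0 : H = 0 := MvPolynomial.funext fun x => by
      rw [map_zero]
      exact eq_zero_of_homogeneous hhom hHO (WithLp.toLp 2 x)
    rwa [hH0, sub_zero] at hrest

/-- `U` is the Taylor series at the origin of the function `u` on `ℂ²`. -/
def IsTaylor (u : C2 → ℂ) (U : PS) : Prop :=
  ∀ j, ∃ P : MvPolynomial (Fin 2) ℂ,
    (fun x => u x - pEval P x) =O[𝓝 0] (fun x : C2 => ‖x‖ ^ j) ∧ U - (P : PS) ∈ ordIdeal j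

namespace IsTaylor

variable {u v : C2 → ℂ} {U W : PS}

theorem congr (h : IsTaylor u U) (e : u =ᶠ[𝓝 0] v) : IsTaylor v U := fun j => by
  obtain ⟨P, h1, h2⟩ := h j
  refine ⟨P, h1.congr' ?_ EventuallyEq.rfl, h2⟩
  filter_upwards [e] with x hx
  rw [hx]

theorem of_pEval (P : MvPolynomial (Fin 2) ℂ) : IsTaylor (pEval P) P := fun j =>
  ⟨P, by simpa using isBigO_zero _ _, by simp⟩

theorem const (c : ℂ) : IsTaylor (fun _ => c) (C c) := by
  have := of_pEval (MvPolynomial.C c)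
  rw [MvPolynomial.coe_C] at this
  exact this.congr (Eventually.of_forall fun x => by simp [pEval])

theorem coord (i : Fin 2) : IsTaylor (fun x => x i) (X i) := by
  have := of_pEval (MvPolynomial.X i)
  rw [MvPolynomial.coe_X] at this
  exact this.congr (Eventually.of_forall fun x => by simp [pEval])

theorem add (hu : IsTaylor u U) (hv : IsTaylor v W) : IsTaylor (fun x => u x + v x) (U + W) := by
  intro j
  obtain ⟨P, h1, h2⟩ := hu j
  obtain ⟨Q, h3, h4⟩ := hv j
  refine ⟨P + Q, (h1.add h3).congr_left fun x => ?_, ?_⟩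
  · simp only [pEval, map_add]; ring
  · rw [MvPolynomial.coe_add, add_sub_add_comm]
    exact (ordIdeal j).add_mem h2 h4

theorem isBigO_one (hu : IsTaylor u U) : u =O[𝓝 0] (fun x : C2 => ‖x‖ ^ 0) := by
  obtain ⟨P, h1, -⟩ := hu 0
  have := h1.add (isBigO_one_of_continuousAt (continuous_pEval P).continuousAt)
  simpa using this

theorem mul (hu : IsTaylor u U) (hv : IsTaylor v W) : IsTaylor (fun x => u x * v x) (U * W) := by
  intro j
  obtain ⟨P, h1, h2⟩ := hu j
  obtain ⟨Q, h3, h4⟩ := hv j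
  refine ⟨P * Q, ?_, ?_⟩
  · have h5 := h1.mul hv.isBigO_one
    have h6 := (isBigO_one_of_continuousAt (continuous_pEval P).continuousAt).mul h3
    simp only [pow_zero, mul_one, one_mul] at h5 h6
    refine (h5.add h6).congr_left fun x => ?_
    simp only [pEval, map_mul]; ring
  · have e : U * W - ((P * Q : MvPolynomial (Fin 2) ℂ) : PS) =
        (U - (P : PS)) * W + (P : PS) * (W - (Q : PS)) := by
      rw [MvPolynomial.coe_mul]; ring
    rw [e]
    exact (ordIdeal j).add_mem ((ordIdeal j).mul_mem_right _ h2)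
      ((ordIdeal j).mul_mem_left _ h4)

theorem sub (hu : IsTaylor u U) (hv : IsTaylor v W) : IsTaylor (fun x => u x - v x) (U - W) := by
  have := hu.add ((const (-1)).mul hv)
  have e : U + C (-1 : ℂ) * W = U - W := by rw [map_neg, map_one]; ring
  rw [e] at this
  exact this.congr (Eventually.of_forall fun x => by ring)

/-- Flatness to order `j` of a function and of its Taylor series are equivalent. -/
theorem isBigO_iff (hu : IsTaylor u U) {j : ℕ} :
    u =O[𝓝 0] (fun x : C2 => ‖x‖ ^ j) ↔ U ∈ ordIdeal j := by
  obtain ⟨P, h1, h2⟩ := hu j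
  constructor
  · intro h
    have h3 : pEval P =O[𝓝 0] (fun x : C2 => ‖x‖ ^ j) :=
      (h.sub h1).congr_left fun x => by ring
    have := (ordIdeal j).add_mem h2 (mem_ordIdeal_of_isBigO h3)
    rwa [sub_add_cancel] at this
  · intro h
    have h3 : (P : PS) ∈ ordIdeal j := by
      have := (ordIdeal j).sub_mem h h2
      rwa [sub_sub_cancel] at this
    exact (h1.add (isBigO_pEval h3)).congr_left fun x => by ring

theorem unique (h : IsTaylor u U) (h' : IsTaylor u W) : U = W := by
  refine sub_eq_zero.1 (eq_zero_of_forall_mem_ordIdeal fun j => ?_)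
  refine (h.sub h').isBigO_iff.1 ?_
  simpa using isBigO_zero _ _

/-- Substitution of a map into a function substitutes the Taylor series. -/
theorem comp (hu : IsTaylor u U) {g : C2 → C2} {σ : PS →ₐ[ℂ] PS}
    (hg : ∀ i, IsTaylor (fun x => g x i) (σ (X i))) (hg0 : g =O[𝓝 0] (fun x : C2 => ‖x‖)) :
    IsTaylor (fun x => u (g x)) (σ U) := by
  have hσ : ∀ i, σ (X i) ∈ ordIdeal 1 := fun i => by
    refine (hg i).isBigO_iff.1 ?_
    simp only [pow_one]
    refine IsBigO.trans ?_ hg0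
    exact IsBigO.of_bound 1 (Eventually.of_forall fun x => by
      rw [one_mul]; exact PiLp.norm_apply_le _ i)
  have ht : Tendsto g (𝓝 0) (𝓝 0) := hg0.trans_tendsto (by
    simpa using (continuous_norm (E := C2)).tendsto 0)
  have hpoly : ∀ P : MvPolynomial (Fin 2) ℂ, IsTaylor (fun x => pEval P (g x)) (σ (P : PS)) := by
    intro P
    induction P using MvPolynomial.induction_on with
    | C a =>
      have := const a
      rw [MvPolynomial.coe_C, C_eq_algebraMap, AlgHom.commutes, ← C_eq_algebraMap]
      simpa [pEval] using this
    | add P Q hP hQ =>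
      have := hP.add hQ
      rw [MvPolynomial.coe_add, map_add]
      simpa [pEval] using this
    | mul_X P i hP =>
      have := hP.mul (hg i)
      rw [MvPolynomial.coe_mul, map_mul, MvPolynomial.coe_X]
      simpa [pEval] using this
  intro j
  obtain ⟨P, h1, h2⟩ := hu j
  obtain ⟨Q, h3, h4⟩ := hpoly P j
  refine ⟨Q, ?_, ?_⟩
  · have h5 := (h1.comp_tendsto ht).trans ((hg0.norm_left).pow j)
    exact (h5.add h3).congr_left fun x => by simp
  · have := (ordIdeal j).add_mem (map_mem_of_X σ hσ j _ h2) h4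
    rwa [map_sub, sub_add_sub_cancel] at this

end IsTaylor

/-- The diagonal of a multilinear form as a homogeneous polynomial. -/
theorem exists_polynomial_of_multilinear (n : ℕ) (p : C2 [×n]→L[ℂ] ℂ) :
    ∃ Q : MvPolynomial (Fin 2) ℂ, Q.IsHomogeneous n ∧ ∀ x, pEval Q x = p fun _ => x := by
  let e : Fin 2 → C2 := fun i => EuclideanSpace.basisFun (Fin 2) ℂ i
  refine ⟨∑ s : Fin n → Fin 2, MvPolynomial.C (p fun i => e (s i)) *
    ∏ i, MvPolynomial.X (s i), ?_, fun x => ?_⟩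
  · refine MvPolynomial.IsHomogeneous.sum _ _ _ fun s _ => ?_
    have h1 := MvPolynomial.IsHomogeneous.prod Finset.univ
      (fun i : Fin n => (MvPolynomial.X (s i) : MvPolynomial (Fin 2) ℂ)) (fun _ => 1)
      (fun i _ => MvPolynomial.isHomogeneous_X ℂ (s i))
    have h2 := (MvPolynomial.isHomogeneous_C (Fin 2) (p fun i => e (s i))).mul h1
    simpa using h2
  · have hx : x = ∑ i, x i • e i := by
      have := (EuclideanSpace.basisFun (Fin 2) ℂ).sum_repr x
      simpa [e] using this.symm
    have : (p fun _ => x) = p fun _ : Fin n => ∑ i, x i • e i := by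
      conv_lhs => rw [hx]
    rw [this, p.map_sum]
    simp only [p.map_smul_univ, smul_eq_mul]
    rw [pEval, map_sum]
    refine Finset.sum_congr rfl fun s _ => ?_
    simp [mul_comm]

/-- Every holomorphic function has a Taylor series. -/
theorem exists_isTaylor {u : C2 → ℂ} (hu : AnalyticAt ℂ u 0) : ∃ U, IsTaylor u U := by
  obtain ⟨p, hp⟩ := hu
  choose Q hQ hQe using fun n => exists_polynomial_of_multilinear n (p n)
  let U : PS := fun d => (Q d.degree).coeff d
  refine ⟨U, fun j => ⟨∑ n ∈ Finset.range j, Q n, ?_, ?_⟩⟩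
  · refine (hp.isBigO_sub_partialSum_pow j).congr_left fun x => ?_
    rw [zero_add]
    congr 1
    rw [pEval, map_sum]
    exact Finset.sum_congr rfl fun n _ => (hQe n x).symm
  · intro d hd
    have h1 : coeff d U = (Q d.degree).coeff d := rfl
    rw [map_sub, h1, MvPolynomial.coeff_coe, MvPolynomial.coeff_sum,
      Finset.sum_eq_single d.degree, sub_self]
    · intro n _ hn
      exact (hQ n).coeff_eq_zero hn.symm
    · intro h
      exact absurd (Finset.mem_range.2 hd) h

/-- A holomorphic function whose Taylor series vanishes is zero near the origin. -/
theorem eventually_eq_zero_of_isTaylor {u : C2 → ℂ} (hu : AnalyticAt ℂ u 0) (h : IsTaylor u 0) :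
    u =ᶠ[𝓝 0] 0 := by
  obtain ⟨p, hp⟩ := hu
  have hO : ∀ j : ℕ, u =O[𝓝 0] (fun x : C2 => ‖x‖ ^ j) := fun j =>
    h.isBigO_iff.2 (ordIdeal j).zero_mem
  -- Once all lower terms vanish, the term of degree `n` is itself `O(‖x‖ ^ (n + 1))`, hence zero on
  -- the diagonal.
  have key : ∀ n x, (p n fun _ => x) = 0 := by
    intro n
    induction n using Nat.strong_induction_on with
    | _ n ih =>
      have hs : p.partialSum (n + 1) = fun x => p n fun _ => x := by
        funext x
        refine Finset.sum_eq_single _ (fun b hb hbn => ?_) fun hn => ?_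
        · exact ih b (lt_of_le_of_ne (Finset.mem_range_succ_iff.1 hb) hbn) x
        · exact absurd (Finset.mem_range.2 (Nat.lt_succ_self n)) hn
      have h1 := hp.isBigO_sub_partialSum_pow (n + 1)
      simp only [hs, zero_add] at h1
      have h2 := (hO (n + 1)).sub h1
      simp only [sub_sub_cancel] at h2
      exact h2.continuousMultilinearMap_apply_eq_zero
  filter_upwards [hp.eventually_hasSum] with x hx
  rw [zero_add] at hx
  simp only [key] at hx
  exact hx.unique hasSum_zero

end FormalDiffeo

end

/-! ### From germs of diffeomorphisms to automorphisms of the ring of power series -/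

noncomputable section

namespace FormalDiffeo

open MvPowerSeries Asymptotics LocalDyn

theorem isBigO_of_holFixing (f : holFixing C2) :
    (f.1 : C2 → C2) =O[𝓝 0] (fun x : C2 => ‖x‖) := by
  have := f.2.1.differentiableAt.isBigO_sub
  rw [f.2.2] at this
  simpa using this.norm_right

theorem analyticAt_coord {f : C2 → C2} (hf : AnalyticAt ℂ f 0) (i : Fin 2) :
    AnalyticAt ℂ (fun x => f x i) 0 :=
  ((EuclideanSpace.proj i : C2 →L[ℂ] ℂ).analyticAt _).comp hf

/-- Substitution of the Taylor series of a map fixing the origin, as an endomorphism of the ring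
of power series. -/
theorem exists_taylorHom (f : holFixing C2) :
    ∃ σ : PS →ₐ[ℂ] PS, ∀ i, IsTaylor (fun x => (f.1 : C2 → C2) x i) (σ (X i)) := by
  choose G hG using fun i => exists_isTaylor (analyticAt_coord f.2.1 i)
  have h0 : ∀ i, constantCoeff (G i) = 0 := fun i => by
    have : G i ∈ ordIdeal 1 := by
      refine (hG i).isBigO_iff.1 ?_
      simp only [pow_one]
      exact IsBigO.trans (IsBigO.of_bound 1 (Eventually.of_forall fun x => by
        rw [one_mul]; exact PiLp.norm_apply_le _ i)) (isBigO_of_holFixing f)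
    rw [← coeff_zero_eq_constantCoeff_apply]
    exact coeff_zero_of_mem this
  refine ⟨substAlgHom (hasSubst_of_constantCoeff_zero h0), fun i => ?_⟩
  rw [substAlgHom_X]
  exact hG i

/-- The endomorphism of the ring of power series induced by a holomorphic map fixing the
origin. -/
def taylorHom (f : holFixing C2) : PS →ₐ[ℂ] PS := (exists_taylorHom f).choose

theorem taylorHom_spec (f : holFixing C2) (i : Fin 2) :
    IsTaylor (fun x => (f.1 : C2 → C2) x i) (taylorHom f (X i)) :=
  (exists_taylorHom f).choose_spec i

theorem taylorHom_X_mem (f : holFixing C2) (i : Fin 2) : taylorHom f (X i) ∈ ordIdeal 1 := by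
  refine (taylorHom_spec f i).isBigO_iff.1 ?_
  simp only [pow_one]
  exact IsBigO.trans (IsBigO.of_bound 1 (Eventually.of_forall fun x => by
    rw [one_mul]; exact PiLp.norm_apply_le _ i)) (isBigO_of_holFixing f)

/-- Endomorphisms of this kind are determined by the images of the variables, and Taylor series are
unique. Independence of the representative and functoriality follow. -/
theorem taylorHom_eq {f : holFixing C2} {σ : PS →ₐ[ℂ] PS}
    (h : ∀ i, IsTaylor (fun x => (f.1 : C2 → C2) x i) (σ (X i))) : taylorHom f = σ :=
  algHom_ext_of_X (taylorHom_X_mem f) fun i => (taylorHom_spec f i).unique (h i)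

theorem taylorHom_one : taylorHom 1 = AlgHom.id ℂ PS :=
  taylorHom_eq fun i => IsTaylor.coord i

theorem taylorHom_mul (f g : holFixing C2) :
    taylorHom (f * g) = (taylorHom g).comp (taylorHom f) :=
  taylorHom_eq fun i => (taylorHom_spec f i).comp (taylorHom_spec g) (isBigO_of_holFixing g)

theorem taylorHom_congr {f g : holFixing C2} (h : (f.1 : C2 → C2) =ᶠ[𝓝 0] (g.1 : C2 → C2)) :
    taylorHom f = taylorHom g :=
  taylorHom_eq fun i => (taylorHom_spec g i).congr (by
    filter_upwards [h] with x hx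
    rw [hx])

/-- A holomorphic map with trivial Taylor series is the identity near the origin. -/
theorem eventually_eq_id_of_taylorHom {f : holFixing C2} (h : taylorHom f = AlgHom.id ℂ PS) :
    (f.1 : C2 → C2) =ᶠ[𝓝 0] id := by
  have key : ∀ i, (fun x => (f.1 : C2 → C2) x i - x i) =ᶠ[𝓝 0] 0 := fun i => by
    have h1 := (taylorHom_spec f i).sub (IsTaylor.coord i)
    rw [h, AlgHom.id_apply, sub_self] at h1
    exact eventually_eq_zero_of_isTaylor
      ((analyticAt_coord f.2.1 i).sub (analyticAt_coord analyticAt_id i)) h1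
  filter_upwards [key 0, key 1] with x h0 h1
  ext i
  fin_cases i
  · exact sub_eq_zero.1 h0
  · exact sub_eq_zero.1 h1

/-- A holomorphic map tangent to the identity moves the variables by terms of order two. -/
theorem taylorHom_X_sub_mem {f : holFixing C2}
    (h : fderiv ℂ (f.1 : C2 → C2) 0 = ContinuousLinearMap.id ℂ C2) (i : Fin 2) :
    taylorHom f (X i) - X i ∈ ordIdeal 2 := by
  refine ((taylorHom_spec f i).sub (IsTaylor.coord i)).isBigO_iff.1 ?_
  obtain ⟨p, hp⟩ := f.2.1
  have h1 := hp.isBigO_sub_partialSum_pow 2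
  have h2 : ∀ x, p.partialSum 2 x = x := by
    intro x
    have h3 : p 0 (fun _ => x) = 0 := by
      rw [hp.coeff_zero]; exact f.2.2
    have h4 : p 1 (fun _ => x) = x := by
      have := congrArg (fun L : C2 →L[ℂ] C2 => L x) (hp.fderiv_eq.symm.trans h)
      simp only [continuousMultilinearCurryFin1_apply, ContinuousLinearMap.id_apply] at this
      convert this using 2
      funext i
      rw [Subsingleton.elim i (Fin.last 0), Fin.snoc_last]
    rw [FormalMultilinearSeries.partialSum, Finset.sum_range_succ, Finset.sum_range_one, h3, h4,
      zero_add]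
  simp only [h2, zero_add] at h1
  refine IsBigO.trans (IsBigO.of_bound 1 (Eventually.of_forall fun x => ?_)) h1
  rw [one_mul]
  exact PiLp.norm_apply_le ((f.1 : C2 → C2) x - x) i

/-- Taylor series on germs, as an anti-homomorphism. -/
def germTaylor : HolGerm C2 →* (PS →ₐ[ℂ] PS)ᵐᵒᵖ :=
  (germCon C2).lift
    { toFun := fun f => MulOpposite.op (taylorHom f)
      map_one' := by rw [taylorHom_one]; rfl
      map_mul' := fun f g => by rw [taylorHom_mul]; rfl }
    (fun _ _ h => congrArg MulOpposite.op (taylorHom_congr h))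

/-- A germ of diffeomorphism acts on power series by substitution of its inverse. -/
def germAct : DiffGerm C2 →* (PS ≃ₐ[ℂ] PS) where
  toFun g := AlgEquiv.ofAlgHom (germTaylor (g⁻¹).val).unop (germTaylor g.val).unop
    (by
      have : germTaylor g.val * germTaylor (g⁻¹).val = 1 := by
        rw [← map_mul, Units.mul_inv, map_one]
      exact congrArg MulOpposite.unop this)
    (by
      have : germTaylor (g⁻¹).val * germTaylor g.val = 1 := by
        rw [← map_mul, Units.inv_mul, map_one]
      exact congrArg MulOpposite.unop this)
  map_one' := by
    ext1 u
    change (germTaylor ((1 : DiffGerm C2)⁻¹).val).unop u = u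
    rw [inv_one, Units.val_one, map_one]
    rfl
  map_mul' f g := by
    ext1 u
    change (germTaylor ((f * g)⁻¹).val).unop u =
      (germTaylor (f⁻¹).val).unop ((germTaylor (g⁻¹).val).unop u)
    rw [mul_inv_rev, Units.val_mul, map_mul]
    rfl

theorem germAct_apply (g : DiffGerm C2) (u : PS) : germAct g u = (germTaylor (g⁻¹).val).unop u :=
  rfl

theorem germAct_injective : Function.Injective germAct := by
  rw [injective_iff_map_eq_one]
  intro g hg
  obtain ⟨f, hf⟩ := Con.mk'_surjective (c := germCon C2) (g⁻¹).val
  have h1 : taylorHom f = AlgHom.id ℂ PS := by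
    ext1 u
    have := congrArg (fun σ : PS ≃ₐ[ℂ] PS => σ u) hg
    simp only [germAct_apply, ← hf] at this
    exact this
  rw [← inv_eq_one]
  refine Units.ext ?_
  rw [← hf]
  exact (Con.eq (germCon C2)).2 (eventually_eq_id_of_taylorHom h1)

theorem germAct_mem_unip {g : DiffGerm C2} (hg : g ∈ tangentToId C2) : germAct g ∈ unip := by
  obtain ⟨f, hf⟩ := Con.mk'_surjective (c := germCon C2) (g⁻¹).val
  have h1 : fderiv ℂ (f.1 : C2 → C2) 0 = ContinuousLinearMap.id ℂ C2 := by
    have h2 : Units.map (derivHom C2) g⁻¹ = 1 := (tangentToId C2).inv_mem hg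
    have h3 := congrArg Units.val h2
    rw [Units.coe_map, ← hf] at h3
    exact h3
  intro j u hu
  rw [germAct_apply, ← hf]
  exact sub_mem_of_X (taylorHom f) (taylorHom_X_sub_mem h1) j u hu

/-- If the iterated commutators of a set `S` of germs tangent to the identity generate a group of
derived length at most four, then so does `S`. -/
theorem iterComm_four_germ (S : Set (DiffGerm C2)) (hS : S ⊆ tangentToId C2)
    (h : iterComm (Subgroup.closure (conjComm S 8)) 4 = ⊥) :
    iterComm (Subgroup.closure S) 4 = ⊥ := by
  let f : tangentToId C2 →* unip :=
    (germAct.comp (tangentToId C2).subtype).codRestrict unip fun g => germAct_mem_unip g.2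
  have hf : Function.Injective f := fun a b hab =>
    Subtype.ext (germAct_injective (congrArg Subtype.val hab))
  let T : Set (tangentToId C2) := Subtype.val ⁻¹' S
  have hT : (tangentToId C2).subtype '' T = S := by
    ext g
    constructor
    · rintro ⟨x, hx, rfl⟩
      exact hx
    · exact fun hg => ⟨⟨g, hS hg⟩, hg, rfl⟩
  have e1 : ∀ n, iterComm (Subgroup.closure (conjComm S n)) 4 =
      (iterComm (Subgroup.closure (conjComm T n)) 4).map (tangentToId C2).subtype := by
    intro n
    rw [map_iterComm, MonoidHom.map_closure, image_conjComm, hT]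
  have e2 : iterComm (Subgroup.closure (conjComm T 8)) 4 = ⊥ := by
    rw [e1, Subgroup.map_eq_bot_iff_of_injective _ (tangentToId C2).subtype_injective] at h
    exact h
  have e3 := iterComm_four_closure (f '' T) (by
    rw [← image_conjComm, ← MonoidHom.map_closure, ← map_iterComm, e2, Subgroup.map_bot])
  rw [← MonoidHom.map_closure, ← map_iterComm, Subgroup.map_eq_bot_iff_of_injective _ hf] at e3
  rw [← hT, ← MonoidHom.map_closure, ← map_iterComm, e3, Subgroup.map_bot]

end FormalDiffeo

end

/-! ### Quantitative estimates for commutators and conjugates near the identity -/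

noncomputable section

namespace LocalDyn

section Estimates

variable {E : Type*} [NormedAddCommGroup E] [NormedSpace ℂ E]

/-- Cauchy's estimate: a holomorphic map bounded by `ε` on a ball is Lipschitz with constant
`ε / τ` on the concentric ball whose radius is smaller by `τ`. -/
theorem norm_sub_le_of_bounded {a : E → E} {ρ ε τ : ℝ} (hτ : 0 < τ)
    (ha : AnalyticOnNhd ℂ a (Metric.ball 0 ρ)) (hb : ∀ x ∈ Metric.ball (0 : E) ρ, ‖a x‖ ≤ ε)
    {x y : E} (hx : x ∈ Metric.ball (0 : E) (ρ - τ)) (hy : y ∈ Metric.ball (0 : E) (ρ - τ)) :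
    ‖a y - a x‖ ≤ ε / τ * ‖y - x‖ := by
  have hsub : Metric.ball (0 : E) (ρ - τ) ⊆ Metric.ball 0 ρ :=
    Metric.ball_subset_ball (by linarith)
  have hε : 0 ≤ ε := (norm_nonneg _).trans (hb x (hsub hx))
  refine (convex_ball (0 : E) (ρ - τ)).norm_image_sub_le_of_norm_fderiv_le (𝕜 := ℂ)
    (fun z hz => (ha z (hsub hz)).differentiableAt) (fun z hz => ?_) hx hy
  refine ContinuousLinearMap.opNorm_le_bound _ (div_nonneg hε hτ.le) fun v => ?_
  by_cases hv : v = 0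
  · simp [hv]
  have hv' : 0 < ‖v‖ := norm_pos_iff.2 hv
  -- The complex line through `z` in direction `v` stays in the large ball for `‖t‖ ≤ τ / ‖v‖`, so
  -- the one-variable Cauchy estimate bounds the directional derivative.
  have hmem : ∀ t ∈ Metric.closedBall (0 : ℂ) (τ / ‖v‖), z + t • v ∈ Metric.ball (0 : E) ρ := by
    intro t ht
    rw [mem_closedBall_zero_iff, le_div_iff₀ hv'] at ht
    rw [mem_ball_zero_iff] at hz ⊢
    have := norm_add_le z (t • v)
    rw [norm_smul] at this
    linarith
  have hline : ∀ t : ℂ, HasDerivAt (fun t : ℂ => z + t • v) v t := fun t => by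
    simpa using ((hasDerivAt_id t).smul_const v).const_add z
  have hd : ∀ t ∈ Metric.closedBall (0 : ℂ) (τ / ‖v‖),
      HasDerivAt (fun t : ℂ => a (z + t • v)) (fderiv ℂ a (z + t • v) v) t := fun t ht =>
    ((ha _ (hmem t ht)).differentiableAt.hasFDerivAt).comp_hasDerivAt t (hline t)
  have hR : 0 < τ / ‖v‖ := div_pos hτ hv'
  have h1 := Complex.norm_deriv_le_of_forall_mem_sphere_norm_le (c := 0) (R := τ / ‖v‖) (C := ε) hR
    (f := fun t : ℂ => a (z + t • v)) (DifferentiableOn.diffContOnCl fun t ht => by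
      rw [closure_ball _ hR.ne'] at ht
      exact (hd t ht).differentiableAt.differentiableWithinAt)
    (fun t ht => hb _ (hmem t (Metric.sphere_subset_closedBall ht)))
  rw [(hd 0 (Metric.mem_closedBall_self hR.le)).deriv, zero_smul, add_zero] at h1
  refine h1.trans_eq ?_
  field_simp

/-- Holomorphic maps which are `ε`-close to the identity on a ball are uniformly close to
commuting. -/
theorem norm_comm_le {s t : E → E} {ρ ε τ : ℝ} (hτ : 0 < τ)
    (hs : AnalyticOnNhd ℂ s (Metric.ball 0 ρ)) (ht : AnalyticOnNhd ℂ t (Metric.ball 0 ρ))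
    (hsb : ∀ x ∈ Metric.ball (0 : E) ρ, ‖s x - x‖ ≤ ε)
    (htb : ∀ x ∈ Metric.ball (0 : E) ρ, ‖t x - x‖ ≤ ε) {y : E}
    (hy : y ∈ Metric.ball (0 : E) (ρ - τ)) (hys : s y ∈ Metric.ball (0 : E) (ρ - τ))
    (hyt : t y ∈ Metric.ball (0 : E) (ρ - τ)) :
    ‖s (t y) - t (s y)‖ ≤ 2 * ε ^ 2 / τ := by
  have hsub : Metric.ball (0 : E) (ρ - τ) ⊆ Metric.ball 0 ρ :=
    Metric.ball_subset_ball (by linarith)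
  have hε : 0 ≤ ε := (norm_nonneg _).trans (hsb y (hsub hy))
  have h1 := norm_sub_le_of_bounded hτ (hs.sub analyticOnNhd_id) hsb hy hyt
  have h2 := norm_sub_le_of_bounded hτ (ht.sub analyticOnNhd_id) htb hy hys
  have h3 := htb y (hsub hy)
  have h4 := hsb y (hsub hy)
  have h5 := mul_le_mul_of_nonneg_left h3 (div_nonneg hε hτ.le)
  have h6 := mul_le_mul_of_nonneg_left h4 (div_nonneg hε hτ.le)
  simp only [Pi.sub_apply] at h1 h2
  -- With `a = s - id` and `b = t - id` this is `(a (t y) - a y) - (b (s y) - b y)`; each difference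
  -- is at most `(ε / τ) ε`.
  have e : s (t y) - t (s y) = (s (t y) - t y - (s y - y)) - (t (s y) - s y - (t y - y)) := by
    abel
  rw [e]
  refine (norm_sub_le _ _).trans ((add_le_add (h1.trans h5) (h2.trans h6)).trans_eq ?_)
  ring

/-- A holomorphic map `ε`-close to the identity on a ball is Lipschitz on smaller balls. -/
theorem norm_map_sub_map_le {s : E → E} {ρ ε τ : ℝ} (hτ : 0 < τ) (hετ : ε ≤ τ)
    (hs : AnalyticOnNhd ℂ s (Metric.ball 0 ρ))
    (hsb : ∀ x ∈ Metric.ball (0 : E) ρ, ‖s x - x‖ ≤ ε) {x y : E}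
    (hx : x ∈ Metric.ball (0 : E) (ρ - τ)) (hy : y ∈ Metric.ball (0 : E) (ρ - τ)) :
    ‖s y - s x‖ ≤ 2 * ‖y - x‖ := by
  have h1 := norm_sub_le_of_bounded hτ (hs.sub analyticOnNhd_id) hsb hx hy
  have h2 : ε / τ * ‖y - x‖ ≤ 1 * ‖y - x‖ :=
    mul_le_mul_of_nonneg_right ((div_le_one hτ).2 hετ) (norm_nonneg _)
  simp only [Pi.sub_apply] at h1
  have e : s y - s x = (s y - y - (s x - x)) + (y - x) := by abel
  rw [e]
  linarith [norm_add_le (s y - y - (s x - x)) (y - x)]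

omit [NormedSpace ℂ E] in
theorem mem_ball_of_norm_sub_le {x y : E} {ρ ρ' ε : ℝ} (hx : x ∈ Metric.ball (0 : E) ρ)
    (h : ‖y - x‖ ≤ ε) (hρ : ρ + ε ≤ ρ') : y ∈ Metric.ball (0 : E) ρ' := by
  rw [mem_ball_zero_iff] at hx ⊢
  have := norm_add_le (y - x) x
  rw [sub_add_cancel] at this
  linarith

end Estimates

namespace Pseudogroup

section Words

variable {E : Type*} [NormedAddCommGroup E] [NormedSpace ℂ E] (P : Pseudogroup E)

theorem wordMap_append (w w' : List (Fin P.k × Bool)) (x : E) :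
    P.wordMap (w ++ w') x = P.wordMap w (P.wordMap w' x) := by
  induction w with
  | nil => rfl
  | cons a w ih =>
    change P.letter a (P.wordMap (w ++ w') x) = P.letter a (P.wordMap w (P.wordMap w' x))
    rw [ih]

theorem dom_subset_V (w : List (Fin P.k × Bool)) : P.dom w ⊆ P.V := by
  induction w with
  | nil => exact fun _ h => h
  | cons a w ih => exact fun x h => ih h.1

theorem mem_dom_append {w w' : List (Fin P.k × Bool)} {x : E} (hx : x ∈ P.dom w')
    (h : P.wordMap w' x ∈ P.dom w) : x ∈ P.dom (w ++ w') := by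
  induction w with
  | nil => exact hx
  | cons a w ih =>
    refine ⟨ih h.1, ?_⟩
    change P.wordMap (w ++ w') x ∈ P.V
    rw [wordMap_append]
    exact h.2

theorem analyticAt_letter (a : Fin P.k × Bool) {x : E} (hx : x ∈ P.V) :
    AnalyticAt ℂ (P.letter a) x := by
  unfold letter
  split_ifs
  · exact (P.gen a.1).holo x (P.subset_source _ hx)
  · exact (P.gen a.1).holo_symm x (P.subset_target _ hx)

theorem letter_zero (a : Fin P.k × Bool) : P.letter a 0 = 0 := by
  unfold letter
  split_ifs
  · exact (P.gen a.1).map_zero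
  · exact (P.gen a.1).inv_zero

theorem analyticOnNhd_wordMap (w : List (Fin P.k × Bool)) :
    AnalyticOnNhd ℂ (P.wordMap w) (P.dom w) := by
  induction w with
  | nil => exact fun x _ => analyticAt_id
  | cons a w ih =>
    intro x hx
    exact AnalyticAt.fun_comp (g := P.letter a) (f := P.wordMap w) (P.analyticAt_letter a hx.2)
      (ih x hx.1)

theorem wordMap_zero (w : List (Fin P.k × Bool)) : P.wordMap w 0 = 0 := by
  induction w with
  | nil => rfl
  | cons a w ih =>
    change P.letter a (P.wordMap w 0) = 0
    rw [ih, letter_zero]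

/-- The germ of a letter. -/
def letterGerm (a : Fin P.k × Bool) : DiffGerm E :=
  if a.2 then (P.gen a.1).germ else (P.gen a.1).germ⁻¹

/-- The germ of a word. -/
def wordGerm (w : List (Fin P.k × Bool)) : DiffGerm E := (w.map P.letterGerm).prod

theorem wordGerm_append (w w' : List (Fin P.k × Bool)) :
    P.wordGerm (w ++ w') = P.wordGerm w * P.wordGerm w' := by
  simp [wordGerm]

theorem zero_mem_dom (w : List (Fin P.k × Bool)) : (0 : E) ∈ P.dom w := by
  induction w with
  | nil => exact P.zero_mem
  | cons a w ih => exact ⟨ih, by rw [wordMap_zero]; exact P.zero_mem⟩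

theorem wordGerm_val (w : List (Fin P.k × Bool)) :
    (P.wordGerm w).val = ((⟨P.wordMap w, P.analyticOnNhd_wordMap w 0 (P.zero_mem_dom w),
      P.wordMap_zero w⟩ : holFixing E) : HolGerm E) := by
  induction w with
  | nil => rfl
  | cons a w ih =>
    have h : (P.letterGerm a).val = ((⟨P.letter a, P.analyticAt_letter a P.zero_mem,
        P.letter_zero a⟩ : holFixing E) : HolGerm E) := by
      obtain ⟨i, b⟩ := a
      cases b <;> rfl
    have e : P.wordGerm (a :: w) = P.letterGerm a * P.wordGerm w := by simp [wordGerm]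
    rw [e, Units.val_mul, h, ih]
    rfl

theorem wordGerm_eq_one_of_eventuallyEq {w : List (Fin P.k × Bool)}
    (h : P.wordMap w =ᶠ[𝓝 0] id) : P.wordGerm w = 1 :=
  Units.ext ((P.wordGerm_val w).trans ((Con.eq (germCon E)).2 h))

/-- The germ `g` and its inverse are given by words of the pseudogroup which are defined and
`ε`-close to the identity on the ball of radius `ρ`. -/
def IsClose (ρ ε : ℝ) (g : DiffGerm E) : Prop :=
  ∃ w w' : List (Fin P.k × Bool), P.wordGerm w = g ∧ P.wordGerm w' = g⁻¹ ∧
    ∀ x ∈ Metric.ball (0 : E) ρ, (x ∈ P.dom w ∧ ‖P.wordMap w x - x‖ ≤ ε ∧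
      P.wordMap w' (P.wordMap w x) = x) ∧ (x ∈ P.dom w' ∧ ‖P.wordMap w' x - x‖ ≤ ε ∧
      P.wordMap w (P.wordMap w' x) = x)

variable {P}

theorem IsClose.mono {ρ ρ' ε ε' : ℝ} {g : DiffGerm E} (h : P.IsClose ρ ε g) (hρ : ρ' ≤ ρ)
    (hε : ε ≤ ε') : P.IsClose ρ' ε' g := by
  obtain ⟨w, w', h1, h2, h3⟩ := h
  refine ⟨w, w', h1, h2, fun x hx => ?_⟩
  obtain ⟨⟨h4, h5, h6⟩, h7, h8, h9⟩ := h3 x (Metric.ball_subset_ball hρ hx)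
  exact ⟨⟨h4, h5.trans hε, h6⟩, h7, h8.trans hε, h9⟩

/-- The word `s t s⁻¹ t⁻¹` on a smaller ball. -/
theorem comm_word {ρ ε τ : ℝ} (hτ : 0 < τ) (hετ : 4 * ε ≤ τ)
    {s s' t t' : List (Fin P.k × Bool)}
    (hs : ∀ x ∈ Metric.ball (0 : E) ρ, (x ∈ P.dom s ∧ ‖P.wordMap s x - x‖ ≤ ε ∧
      P.wordMap s' (P.wordMap s x) = x) ∧ (x ∈ P.dom s' ∧ ‖P.wordMap s' x - x‖ ≤ ε ∧
      P.wordMap s (P.wordMap s' x) = x))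
    (ht : ∀ x ∈ Metric.ball (0 : E) ρ, (x ∈ P.dom t ∧ ‖P.wordMap t x - x‖ ≤ ε ∧
      P.wordMap t' (P.wordMap t x) = x) ∧ (x ∈ P.dom t' ∧ ‖P.wordMap t' x - x‖ ≤ ε ∧
      P.wordMap t (P.wordMap t' x) = x)) {x : E} (hx : x ∈ Metric.ball (0 : E) (ρ - τ)) :
    x ∈ P.dom (s ++ (t ++ (s' ++ t'))) ∧
      ‖P.wordMap (s ++ (t ++ (s' ++ t'))) x - x‖ ≤ 8 * ε ^ 2 / τ ∧
      P.wordMap (t ++ (s ++ (t' ++ s'))) (P.wordMap (s ++ (t ++ (s' ++ t'))) x) = x := by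
  have hx0 := Metric.ball_subset_ball (by linarith : ρ - τ ≤ ρ) hx
  have hε : 0 ≤ ε := (norm_nonneg _).trans (hs x hx0).1.2.1
  obtain ⟨-, a1, a2, a3⟩ := ht x hx0
  set x1 := P.wordMap t' x with hx1
  have m1 := mem_ball_of_norm_sub_le hx a2 le_rfl
  have m1' := Metric.ball_subset_ball (by linarith : ρ - τ + ε ≤ ρ) m1
  obtain ⟨-, b1, b2, b3⟩ := hs x1 m1'
  set y := P.wordMap s' x1 with hy
  have m2 := mem_ball_of_norm_sub_le m1 b2 le_rfl
  have m2' := Metric.ball_subset_ball (by linarith : ρ - τ + ε + ε ≤ ρ) m2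
  obtain ⟨⟨c1, c2, c3⟩, -⟩ := ht y m2'
  set z := P.wordMap t y with hz
  have m3 := mem_ball_of_norm_sub_le m2 c2 le_rfl
  have m3' := Metric.ball_subset_ball (by linarith : ρ - τ + ε + ε + ε ≤ ρ) m3
  obtain ⟨⟨d1, d2, d3⟩, -⟩ := hs z m3'
  have e1 : P.wordMap (s ++ (t ++ (s' ++ t'))) x = P.wordMap s z := by
    rw [wordMap_append, wordMap_append, wordMap_append]
  refine ⟨?_, ?_, ?_⟩
  · refine mem_dom_append P (mem_dom_append P (mem_dom_append P a1 b1) ?_) ?_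
    · rw [wordMap_append]; exact c1
    · rw [wordMap_append, wordMap_append]; exact d1
  · rw [e1]
    have hxe : P.wordMap t (P.wordMap s y) = x := by rw [hy, b3, hx1, a3]
    have hm : ∀ {r : ℝ}, r ≤ ρ - τ + ε + ε + ε → Metric.ball (0 : E) r ⊆
        Metric.ball 0 (ρ - τ / 4) := fun hr => Metric.ball_subset_ball (by linarith)
    -- The estimate is applied at `y = s⁻¹ t⁻¹ x`, where `t s y = x`. The intermediate points move
    -- by at most `3 ε ≤ 3 τ / 4`, which leaves a margin `τ / 4` and gives `2 ε² / (τ / 4) = 8 ε² /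
    -- τ`.
    have := norm_comm_le (s := P.wordMap s) (t := P.wordMap t) (ρ := ρ) (ε := ε) (τ := τ / 4)
      (by linarith) (fun q hq => P.analyticOnNhd_wordMap s q (hs q hq).1.1)
      (fun q hq => P.analyticOnNhd_wordMap t q (ht q hq).1.1)
      (fun q hq => (hs q hq).1.2.1) (fun q hq => (ht q hq).1.2.1)
      (hm (by linarith) m2) (by rw [hy, b3]; exact hm (by linarith) m1) (hm le_rfl m3)
    rw [hxe] at this
    refine this.trans_eq ?_
    field_simp
    ring
  · rw [e1, wordMap_append, wordMap_append, wordMap_append, d3, hz, c3, hy, b3, hx1, a3]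

theorem IsClose.comm {ρ ε τ : ℝ} (hτ : 0 < τ) (hετ : 4 * ε ≤ τ) {g h : DiffGerm E}
    (hg : P.IsClose ρ ε g) (hh : P.IsClose ρ ε h) :
    P.IsClose (ρ - τ) (8 * ε ^ 2 / τ) (g * h * g⁻¹ * h⁻¹) := by
  obtain ⟨s, s', h1, h2, hs⟩ := hg
  obtain ⟨t, t', h3, h4, ht⟩ := hh
  refine ⟨s ++ (t ++ (s' ++ t')), t ++ (s ++ (t' ++ s')), ?_, ?_, fun x hx =>
    ⟨comm_word hτ hετ hs ht hx, comm_word hτ hετ ht hs hx⟩⟩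
  · simp only [wordGerm_append, h1, h2, h3, h4]; group
  · simp only [wordGerm_append, h1, h2, h3, h4]; group

/-- The word `s t s⁻¹` on a smaller ball. -/
theorem conj_word {ρ ρ' ε δ τ : ℝ} (hτ : 0 < τ) (hετ : 4 * ε ≤ τ) (hρ : ρ' ≤ ρ) (hδ : δ ≤ ε)
    {s s' t t' : List (Fin P.k × Bool)}
    (hs : ∀ x ∈ Metric.ball (0 : E) ρ, (x ∈ P.dom s ∧ ‖P.wordMap s x - x‖ ≤ ε ∧
      P.wordMap s' (P.wordMap s x) = x) ∧ (x ∈ P.dom s' ∧ ‖P.wordMap s' x - x‖ ≤ ε ∧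
      P.wordMap s (P.wordMap s' x) = x))
    (ht : ∀ x ∈ Metric.ball (0 : E) ρ', x ∈ P.dom t ∧ ‖P.wordMap t x - x‖ ≤ δ ∧
      P.wordMap t' (P.wordMap t x) = x) {x : E} (hx : x ∈ Metric.ball (0 : E) (ρ' - τ)) :
    x ∈ P.dom (s ++ (t ++ s')) ∧ ‖P.wordMap (s ++ (t ++ s')) x - x‖ ≤ 2 * δ ∧
      P.wordMap (s ++ (t' ++ s')) (P.wordMap (s ++ (t ++ s')) x) = x := by
  have hx0 := Metric.ball_subset_ball (by linarith : ρ' - τ ≤ ρ) hx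
  have hε : 0 ≤ ε := (norm_nonneg _).trans (hs x hx0).1.2.1
  obtain ⟨-, a1, a2, a3⟩ := hs x hx0
  set y := P.wordMap s' x with hy
  have m1 := mem_ball_of_norm_sub_le hx a2 le_rfl
  obtain ⟨b1, b2, b3⟩ := ht y (Metric.ball_subset_ball (by linarith : ρ' - τ + ε ≤ ρ') m1)
  set z := P.wordMap t y with hz
  have m2 := mem_ball_of_norm_sub_le m1 b2 le_rfl
  obtain ⟨⟨c1, c2, c3⟩, -⟩ :=
    hs z (Metric.ball_subset_ball (by linarith : ρ' - τ + ε + δ ≤ ρ) m2)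
  have e1 : P.wordMap (s ++ (t ++ s')) x = P.wordMap s z := by
    rw [wordMap_append, wordMap_append]
  refine ⟨?_, ?_, ?_⟩
  · refine mem_dom_append P (mem_dom_append P a1 b1) ?_
    rw [wordMap_append]; exact c1
  · rw [e1]
    have := norm_map_sub_map_le (s := P.wordMap s) (ρ := ρ) (ε := ε) (τ := τ / 4) (x := y) (y := z)
      (by linarith) (by linarith) (fun q hq => P.analyticOnNhd_wordMap s q (hs q hq).1.1)
      (fun q hq => (hs q hq).1.2.1) (Metric.ball_subset_ball (by linarith) m1)
      (Metric.ball_subset_ball (by linarith) m2)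
    rw [a3] at this
    linarith
  · rw [e1, wordMap_append, wordMap_append, c3, b3, a3]

theorem IsClose.conj {ρ ρ' ε δ τ : ℝ} (hτ : 0 < τ) (hετ : 4 * ε ≤ τ) (hρ : ρ' ≤ ρ) (hδ : δ ≤ ε)
    {g h : DiffGerm E} (hg : P.IsClose ρ ε g) (hh : P.IsClose ρ' δ h) :
    P.IsClose (ρ' - τ) (2 * δ) (g * h * g⁻¹) := by
  obtain ⟨s, s', h1, h2, hs⟩ := hg
  obtain ⟨t, t', h3, h4, ht⟩ := hh
  refine ⟨s ++ (t ++ s'), s ++ (t' ++ s'), ?_, ?_, fun x hx =>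
    ⟨conj_word hτ hετ hρ hδ hs (fun q hq => (ht q hq).1) hx,
      conj_word hτ hετ hρ hδ hs (fun q hq => (ht q hq).2) hx⟩⟩
  · simp only [wordGerm_append, h1, h2, h3]; group
  · simp only [wordGerm_append, h1, h2, h4]; group

/-- A commutator costs `τ` of radius and has displacement `8 ε² / τ`; each conjugation costs a
further `τ` and doubles it. The bounds on `n` and `ε` keep the displacement below `ε`, as
conjugation requires. -/
theorem isClose_conjComm {S : Set (DiffGerm E)} {ρ ε τ : ℝ} (hτ : 0 < τ) (hε : 0 ≤ ε)
    (hετ : 4096 * ε ≤ τ) (hS : ∀ g ∈ S, P.IsClose ρ ε g) (n : ℕ) (hn : n ≤ 8) :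
    ∀ g ∈ conjComm S n, P.IsClose (ρ - (n + 1) * τ) (2 ^ n * (8 * ε ^ 2 / τ)) g := by
  induction n with
  | zero =>
    rintro _ ⟨s, hs, t, ht, rfl⟩
    exact ((hS s hs).comm hτ (by linarith) (hS t ht)).mono (by simp) (by simp)
  | succ n ih =>
    have hδ0 : 0 ≤ 8 * ε ^ 2 / τ := by positivity
    rintro _ (h | ⟨s, hs, x, hx, rfl⟩)
    · refine (ih (by omega) _ h).mono ?_ ?_
      · push_cast; linarith
      · gcongr
        · norm_num
        · omega
    · have hδ : 2 ^ n * (8 * ε ^ 2 / τ) ≤ ε := by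
        have h1 : (2 : ℝ) ^ n ≤ 2 ^ 8 := pow_le_pow_right₀ (by norm_num) (by omega)
        have h2 : 8 * ε ^ 2 / τ ≤ ε / 512 := by
          rw [div_le_iff₀ hτ]
          nlinarith
        calc (2 : ℝ) ^ n * (8 * ε ^ 2 / τ) ≤ 2 ^ 8 * (ε / 512) := by gcongr
          _ ≤ ε := by linarith
      refine ((hS s hs).conj hτ (by linarith) ?_ hδ (ih (by omega) x hx)).mono ?_ ?_
      · have : 0 ≤ ((n : ℝ) + 1) * τ := by positivity
        linarith
      · push_cast; linarith
      · exact le_of_eq (by ring)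

/-- Generators close to the identity have iterated commutators twice as close to it, on a
slightly smaller ball. -/
theorem isClose_conjComm_eight {S : Set (DiffGerm E)} {ρ ε τ : ℝ} (hτ : 0 < τ) (hε : 0 ≤ ε)
    (hετ : 4096 * ε ≤ τ) (hS : ∀ g ∈ S, P.IsClose ρ ε g) :
    ∀ g ∈ conjComm S 8, P.IsClose (ρ - 9 * τ) (ε / 2) g := by
  intro g hg
  refine (isClose_conjComm hτ hε hετ hS 8 le_rfl g hg).mono (by norm_num) ?_
  -- Here `2 ^ 8 · 8 ε² / τ ≤ ε / 2` follows from `4096 ε ≤ τ`.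
  rw [← mul_div_assoc, div_le_iff₀ hτ]
  nlinarith

/-- Iterated sets of commutators. -/
def commSeq {A : Type*} [Group A] (S : Set A) : ℕ → Set A
  | 0 => S
  | n + 1 => conjComm (commSeq S n) 8

/-- At stage `n` take `τ = r / 36 / 2 ^ n`: the loss `9 τ = r / 4 / 2 ^ n` is the decrease of the
stated radius, and `147456 = 36 · 4096` makes `4096 ε = τ`. -/
theorem isClose_commSeq {S : Set (DiffGerm E)} {r : ℝ} (hr : 0 < r)
    (hS : ∀ g ∈ S, P.IsClose r (r / 147456) g) (n : ℕ) :
    ∀ g ∈ commSeq S n, P.IsClose (r / 2 + r / 2 / 2 ^ n) (r / 147456 / 2 ^ n) g := by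
  induction n with
  | zero => exact fun g hg => (hS g hg).mono (by simp) (by simp)
  | succ n ih =>
    intro g hg
    have hp : (0 : ℝ) < 2 ^ n := by positivity
    refine (isClose_conjComm_eight (τ := r / 36 / 2 ^ n) (by positivity) (by positivity)
      (le_of_eq ?_) ih g hg).mono (le_of_eq ?_) (le_of_eq ?_)
    · field_simp; norm_num
    · field_simp; ring
    · field_simp; ring

/-- Generators tangent to the identity are close to it on small balls. -/
theorem exists_isClose_gen (h : P.group ≤ tangentToId E) {c : ℝ} (hc : 0 < c) :
    ∃ r, 0 < r ∧ ∀ g ∈ Set.range fun i => (P.gen i).germ, P.IsClose r (r * c) g := by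
  have key : ∀ a : Fin P.k × Bool, ∀ᶠ x in 𝓝 (0 : E), ‖P.letter a x - x‖ ≤ c * ‖x‖ := by
    intro a
    have h1 : P.letterGerm a ∈ tangentToId E := by
      have h0 : (P.gen a.1).germ ∈ tangentToId E := h (Subgroup.subset_closure ⟨a.1, rfl⟩)
      unfold letterGerm
      split_ifs
      · exact h0
      · exact inv_mem h0
    have h2 : fderiv ℂ (P.letter a) 0 = ContinuousLinearMap.id ℂ E := by
      have h3 : Units.map (derivHom E) (P.letterGerm a) = 1 := h1
      have h4 := congrArg Units.val h3
      have e : P.letterGerm a = P.wordGerm [a] := by simp [wordGerm]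
      rw [Units.coe_map, e, wordGerm_val] at h4
      exact h4
    have h5 := (P.analyticAt_letter a P.zero_mem).differentiableAt.hasFDerivAt
    rw [h2, hasFDerivAt_iff_isLittleO_nhds_zero] at h5
    filter_upwards [h5.def hc] with x hx
    simpa [letter_zero] using hx
  obtain ⟨r, hr, hr'⟩ := Metric.eventually_nhds_iff_ball.1
    ((eventually_all.2 key).and (P.isOpen_V.mem_nhds P.zero_mem))
  refine ⟨r, hr, ?_⟩
  rintro _ ⟨i, rfl⟩
  refine ⟨[(i, true)], [(i, false)], by simp [wordGerm, letterGerm],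
    by simp [wordGerm, letterGerm], fun x hx => ?_⟩
  obtain ⟨h1, h2⟩ := hr' x hx
  have h3 : c * ‖x‖ ≤ r * c := by
    rw [mem_ball_zero_iff] at hx
    rw [mul_comm]
    exact mul_le_mul_of_nonneg_right hx.le hc.le
  exact ⟨⟨⟨h2, h2⟩, (h1 _).trans h3, (P.gen i).left_inv' (P.subset_source i h2)⟩,
    ⟨h2, h2⟩, (h1 _).trans h3, (P.gen i).right_inv' (P.subset_target i h2)⟩

end Words

end Pseudogroup

end LocalDyn

end

/-! ### Discrete orbits, Baire category and nontrivial elements converging to the identity -/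

noncomputable section

namespace LocalDyn

namespace Pseudogroup

section Orbits

variable {E : Type*} [NormedAddCommGroup E] [NormedSpace ℂ E] {P : Pseudogroup E}

/-- A sequence of elements of the pseudogroup moving a point with discrete orbit by less and less
fixes it eventually. -/
theorem LocallyDiscreteAt.eventually_fixed {p : E} (hp : P.LocallyDiscreteAt p)
    {h : ℕ → List (Fin P.k × Bool)} (hdom : ∀ n, p ∈ P.dom (h n))
    (hlim : Tendsto (fun n => P.wordMap (h n) p) atTop (𝓝 p)) :
    ∀ᶠ n in atTop, P.wordMap (h n) p = p := by
  have hpV : p ∈ P.V := P.dom_subset_V _ (hdom 0)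
  obtain ⟨W, hW, hWp⟩ := hp p ⟨hpV, [], hpV, rfl⟩
  filter_upwards [hlim.eventually hW, hlim.eventually (P.isOpen_V.mem_nhds hpV)] with n h1 h2
  have : P.wordMap (h n) p ∈ W ∩ P.orbit p := ⟨h1, h2, h n, hdom n, rfl⟩
  rwa [hWp] at this

/-- Nontrivial elements of the pseudogroup converging to the identity on a ball force orbits which
are not locally discrete. -/
theorem exists_not_locallyDiscreteAt [CompleteSpace E] {r : ℝ} (hr : 0 < r)
    {h : ℕ → List (Fin P.k × Bool)} (hdom : ∀ n, Metric.ball 0 r ⊆ P.dom (h n))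
    (hne : ∀ n, ¬ P.wordMap (h n) =ᶠ[𝓝 0] id)
    (hlim : TendstoUniformlyOn (fun n => P.wordMap (h n)) id atTop (Metric.ball 0 r)) :
    ∃ p ∈ Metric.ball (0 : E) r, ¬ P.LocallyDiscreteAt p := by
  by_contra! hall
  have hfix : ∀ p ∈ Metric.ball (0 : E) r, ∀ᶠ n in atTop, P.wordMap (h n) p = p := fun p hp =>
    (hall p hp).eventually_fixed (fun n => hdom n hp) (hlim.tendsto_at hp)
  have han : ∀ n, AnalyticOnNhd ℂ (P.wordMap (h n)) (Metric.ball 0 r) := fun n =>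
    (P.analyticOnNhd_wordMap (h n)).mono (hdom n)
  have hball : Metric.closedBall (0 : E) (r / 2) ⊆ Metric.ball 0 r :=
    Metric.closedBall_subset_ball (by linarith)
  -- Baire is applied in the whole space: `none` stands for the complement of the half ball, and
  -- `some N` for the points fixed by all maps from index `N` on. The smaller closed ball makes the
  -- fixed-point sets closed.
  let C : Option ℕ → Set E := fun o => o.elim (Metric.ball 0 (r / 2))ᶜ fun N =>
    ⋂ n ≥ N, {p ∈ Metric.closedBall (0 : E) (r / 2) | P.wordMap (h n) p = p}
  have hC : ∀ o, IsClosed (C o) := by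
    rintro (_ | N)
    · exact Metric.isOpen_ball.isClosed_compl
    · refine isClosed_iInter fun n => isClosed_iInter fun _ => ?_
      exact Metric.isClosed_closedBall.isClosed_eq ((han n).continuousOn.mono hball)
        continuousOn_id
  have hU : ⋃ o, C o = Set.univ := by
    refine Set.eq_univ_of_forall fun p => Set.mem_iUnion.2 ?_
    by_cases hp : p ∈ Metric.ball (0 : E) (r / 2)
    · have hp' := Metric.ball_subset_closedBall hp
      obtain ⟨N, hN⟩ := eventually_atTop.1 (hfix p (hball hp'))
      exact ⟨some N, Set.mem_iInter₂.2 fun n hn => ⟨hp', hN n hn⟩⟩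
    · exact ⟨none, hp⟩
  obtain ⟨q, hq, hqi⟩ := (dense_iUnion_interior_of_closed hC hU).exists_mem_open
    (Metric.isOpen_ball (x := (0 : E)) (ε := r / 2))
    ⟨0, Metric.mem_ball_self (by linarith)⟩
  obtain ⟨o, ho⟩ := Set.mem_iUnion.1 hq
  rcases o with _ | N
  · exact interior_subset ho hqi
  · refine hne N ?_
    have h1 : P.wordMap (h N) =ᶠ[𝓝 q] id := by
      filter_upwards [mem_interior_iff_mem_nhds.1 ho] with x hx
      exact (Set.mem_iInter₂.1 hx N le_rfl).2
    have h2 := (han N).eqOn_of_preconnected_of_eventuallyEq analyticOnNhd_id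
      (convex_ball 0 r).isPreconnected (hball (Metric.ball_subset_closedBall hqi)) h1
    exact h2.eventuallyEq_of_mem (Metric.ball_mem_nhds 0 hr)

end Orbits

end Pseudogroup

open FormalDiffeo Pseudogroup

theorem commSeq_subset_tangentToId {S : Set (DiffGerm C2)} (hS : S ⊆ tangentToId C2) (n : ℕ) :
    commSeq S n ⊆ tangentToId C2 := by
  induction n with
  | zero => exact hS
  | succ n ih =>
    exact (conjComm_subset_closure _ 8).trans ((Subgroup.closure_le _).2 ih)

/-- The iterated sets of commutators of generators of a nonsolvable group of germs contain
nontrivial elements. -/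
theorem exists_mem_commSeq_ne_one {S : Set (DiffGerm C2)} (hS : S ⊆ tangentToId C2)
    (hns : ¬ Group.IsSolvable (Subgroup.closure S)) (n : ℕ) : ∃ g ∈ commSeq S n, g ≠ 1 := by
  by_contra! hall
  -- Descending from stage `n`, supposed trivial: derived length at most four passes from each set
  -- of commutators to the set it was formed from, down to the generators.
  have key : ∀ m ≤ n, iterComm (Subgroup.closure (commSeq S (n - m))) 4 = ⊥ := by
    intro m
    induction m with
    | zero =>
      intro _
      have : Subgroup.closure (commSeq S n) = ⊥ :=
        (Subgroup.closure_eq_bot_iff).2 fun g hg => hall g hg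
      rw [Nat.sub_zero, this]
      exact le_bot_iff.1 (iterComm_le _ _)
    | succ m ih =>
      intro hm
      refine iterComm_four_germ _ (commSeq_subset_tangentToId hS _) ?_
      have := ih (by omega)
      rwa [show n - m = n - (m + 1) + 1 by omega] at this
  have := key n le_rfl
  rw [Nat.sub_self] at this
  exact hns (isSolvable_of_iterComm_eq_bot this)

/-- In a nonsolvable pseudogroup of maps tangent to the identity, nontrivial elements converge to
the identity on a ball. -/
theorem exists_tendstoUniformlyOn_id (P : Pseudogroup C2) (hP : P.group ≤ tangentToId C2)
    (hns : ¬ Group.IsSolvable P.group) :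
    ∃ r : ℝ, 0 < r ∧ ∃ h : ℕ → List (Fin P.k × Bool),
      (∀ n, Metric.ball 0 r ⊆ P.dom (h n)) ∧ (∀ n, ¬ P.wordMap (h n) =ᶠ[𝓝 0] id) ∧
      TendstoUniformlyOn (fun n => P.wordMap (h n)) id atTop (Metric.ball 0 r) := by
  obtain ⟨r, hr, hgen⟩ := P.exists_isClose_gen hP (c := 1 / 147456) (by norm_num)
  have hS : (Set.range fun i => (P.gen i).germ) ⊆ tangentToId C2 :=
    Subgroup.subset_closure.trans hP
  have hgen' : ∀ g ∈ Set.range fun i => (P.gen i).germ, P.IsClose r (r / 147456) g :=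
    fun g hg => (hgen g hg).mono le_rfl (le_of_eq (by ring))
  have key : ∀ n : ℕ, ∃ w, Metric.ball 0 (r / 2) ⊆ P.dom w ∧ ¬ P.wordMap w =ᶠ[𝓝 0] id ∧
      ∀ x ∈ Metric.ball (0 : C2) (r / 2), ‖P.wordMap w x - x‖ ≤ r / 147456 / 2 ^ n := by
    intro n
    obtain ⟨g, hg, hg1⟩ := exists_mem_commSeq_ne_one hS hns n
    have hpos : 0 ≤ r / 2 / 2 ^ n := by positivity
    obtain ⟨w, w', h1, -, h3⟩ := (isClose_commSeq hr hgen' n g hg).mono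
      (by linarith : r / 2 ≤ _) le_rfl
    refine ⟨w, fun x hx => (h3 x hx).1.1, fun he => hg1 ?_, fun x hx => (h3 x hx).1.2.1⟩
    rw [← h1]
    exact P.wordGerm_eq_one_of_eventuallyEq he
  choose h h1 h2 h3 using key
  refine ⟨r / 2, by positivity, h, h1, h2, ?_⟩
  rw [Metric.tendstoUniformlyOn_iff]
  intro δ hδ
  have hlim : Tendsto (fun n : ℕ => r / 147456 / 2 ^ n) atTop (𝓝 0) :=
    tendsto_const_nhds.div_atTop (tendsto_pow_atTop_atTop_of_one_lt (by norm_num))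
  filter_upwards [hlim.eventually_lt_const hδ] with n hn x hx
  rw [dist_comm, dist_eq_norm]
  exact (h3 n x hx).trans_lt hn

end LocalDyn

end

theorem mainTheorem7
    (G : Subgroup (LocalDyn.DiffGerm (EuclideanSpace ℂ (Fin 2)))) (hfg : G.FG)
    (hG : G ≤ LocalDyn.tangentToId (EuclideanSpace ℂ (Fin 2))) :
    (LocalDyn.HasLocallyDiscreteOrbits G → Group.IsSolvable G) ∧
    (¬ Group.IsSolvable G →
      ∀ P : LocalDyn.Pseudogroup (EuclideanSpace ℂ (Fin 2)), P.group = G →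
        ∃ ε : ℝ, 0 < ε ∧
          (∃ h : ℕ → List (Fin P.k × Bool),
            (∀ n, Metric.ball 0 ε ⊆ P.dom (h n)) ∧
            (∀ n, ¬ (P.wordMap (h n) =ᶠ[𝓝 0] id)) ∧
            TendstoUniformlyOn (fun n => P.wordMap (h n)) id atTop (Metric.ball 0 ε)) ∧
          ∃ p ∈ Metric.ball 0 ε, ¬ P.LocallyDiscreteAt p) := by
  have h2 : ¬ Group.IsSolvable G →
      ∀ P : LocalDyn.Pseudogroup (EuclideanSpace ℂ (Fin 2)), P.group = G →
        ∃ ε : ℝ, 0 < ε ∧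
          (∃ h : ℕ → List (Fin P.k × Bool),
            (∀ n, Metric.ball 0 ε ⊆ P.dom (h n)) ∧
            (∀ n, ¬ (P.wordMap (h n) =ᶠ[𝓝 0] id)) ∧
            TendstoUniformlyOn (fun n => P.wordMap (h n)) id atTop (Metric.ball 0 ε)) ∧
          ∃ p ∈ Metric.ball 0 ε, ¬ P.LocallyDiscreteAt p := by
    rintro hns P rfl
    obtain ⟨r, hr, h, h1, h2, h3⟩ := LocalDyn.exists_tendstoUniformlyOn_id P hG hns
    exact ⟨r, hr, ⟨h, h1, h2, h3⟩, LocalDyn.Pseudogroup.exists_not_locallyDiscreteAt hr h1 h2 h3⟩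
  refine ⟨fun ⟨P, hP, hd⟩ => ?_, h2⟩
  by_contra hns
  obtain ⟨ε, -, ⟨h, hdom, -⟩, p, hp, hpd⟩ := h2 hns P hP
  exact hpd (hd p (P.dom_subset_V _ (hdom 0 hp)))
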